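/- For every $\epsilon > 0$ there is a connected smooth surface $M$ of infinite topological type (that is, $M$ is not homeomorphic to the interior of a compact surface with, possibly empty, boundary), equipped with a complete smooth Riemannian metric and a basepoint $\star \in M$, along with constants $c, c_1', c_2' > 0$, such that $$\liminf_{r \to \infty} \; \inf_{m \in S_r(\star)} r^{-2} \, \mathrm{vol}(B_{r/2}(m)) \;\ge\; c \qquad \text{(noncollapsing)},$$ $$c_1' \;\le\; \liminf_{r \to \infty} r^{-2} \, \mathrm{vol}(B_r(\star)) \;\le\; \limsup_{r \to \infty} r^{-2} \, \mathrm{vol}(B_r(\star)) \;\le\; c_2' \qquad \text{(Euclidean volume growth)}$$ and $$\limsup_{r \to \infty} \; \sup_{m \in S_r(\star),\; P \subset T_mM} r^2 \, |K(P)| \;\le\; \epsilon \qquad \text{(quadratic curvature decay)}.$$ Here $B_r(m)$ is the open distance ball of radius $r$ around $m$, $S_r(\star) = \partial \overline{B_r(\star)}$ is the distance sphere, $\mathrm{vol}$ is the Riemannian volume (area), $P$ runs over the $2$-planes in $T_mM$ (for a surface, only $P = T_mM$), and $K(P)$ is the sectional curvature of $P$, i.e. the Gaussian curvature at $m$. 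-/

import Mathlib

open Bundle Manifold MeasureTheory Filter Topology
open scoped ContDiff ENNReal

noncomputable section

/-- The Euclidean plane, the model space of a surface. -/
abbrev Plane : Type := EuclideanSpace ℝ (Fin 2)

/-- The `i`-th standard basis vector of the plane. -/
def planeBasis (i : Fin 2) : Plane := EuclideanSpace.single i (1 : ℝ)

/-! ### Finite topological type -/

/-- The interior of a topological surface with boundary: the set of the points that have an open
neighbourhood homeomorphic to an open subset of the plane. (This is the textbook definition for
topological manifolds with boundary; it does not refer to a chosen atlas.) -/
def surfaceInterior (N : Type) [TopologicalSpace N] : Set N :=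
  {x | ∃ e : OpenPartialHomeomorph N Plane, x ∈ e.source}

/-- A surface has finite topological type if it is homeomorphic to the interior of a compact
(Hausdorff) topological surface with (possibly empty) boundary. -/
def HasFiniteTopologicalType (M : Type) [TopologicalSpace M] : Prop :=
  ∃ (N : Type) (_ : TopologicalSpace N) (_ : ChartedSpace (EuclideanHalfSpace 2) N),
    CompactSpace N ∧ T2Space N ∧ Nonempty (M ≃ₜ surfaceInterior N)

/-! ### Curvature of a metric in local coordinates

Below `G : Plane → Matrix (Fin 2) (Fin 2) ℝ` is the matrix function `G_{ij}` of a Riemannian metric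
in local coordinates. -/

/-- The partial derivative `∂_i F` of a function of the coordinates. -/
def partialDeriv (i : Fin 2) (F : Plane → ℝ) (y : Plane) : ℝ := fderiv ℝ F y (planeBasis i)

/-- The Christoffel symbol `Γ^k_{ij}` of the Levi-Civita connection. -/
def christoffel (G : Plane → Matrix (Fin 2) (Fin 2) ℝ) (k i j : Fin 2) (y : Plane) : ℝ :=
  (1 / 2 : ℝ) * ∑ l : Fin 2, (G y)⁻¹ k l *
    (partialDeriv i (fun z => G z j l) y + partialDeriv j (fun z => G z i l) y
      - partialDeriv l (fun z => G z i j) y)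

/-- The component `R^l_{ijk}` of the Riemann curvature tensor, defined by
`R(∂_i, ∂_j) ∂_k = ∑ l, R^l_{ijk} ∂_l`, where `R(X, Y) = ∇_X ∇_Y - ∇_Y ∇_X - ∇_{[X, Y]}`. -/
def riemannTensor (G : Plane → Matrix (Fin 2) (Fin 2) ℝ) (l i j k : Fin 2) (y : Plane) : ℝ :=
  partialDeriv i (christoffel G l j k) y - partialDeriv j (christoffel G l i k) y
    + ∑ m : Fin 2, (christoffel G l i m y * christoffel G m j k y
      - christoffel G l j m y * christoffel G m i k y)

/-- The sectional curvature of the plane spanned by the coordinate vectors `∂_0`, `∂_1`: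
`⟨R(∂_0, ∂_1) ∂_1, ∂_0⟩ / (|∂_0|² |∂_1|² - ⟨∂_0, ∂_1⟩²)`. -/
def coordCurvature (G : Plane → Matrix (Fin 2) (Fin 2) ℝ) (y : Plane) : ℝ :=
  (∑ l : Fin 2, G y l 0 * riemannTensor G l 0 1 1 y) / (G y).det

/-! ### Riemannian surfaces -/

section Riemannian

variable (M : Type) [TopologicalSpace M] [ChartedSpace Plane M]
  [RiemannianBundle (fun x : M => TangentSpace (𝓡 2) x)]

/-- The matrix `G_{ij} = ⟨∂_i, ∂_j⟩` of the Riemannian metric in the coordinates given by the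
chart `e`, as a function on the target of `e`. -/
def coordMetric (e : OpenPartialHomeomorph M Plane) (y : Plane) : Matrix (Fin 2) (Fin 2) ℝ :=
  letI : ChartedSpace Plane Plane := chartedSpaceSelf Plane
  Matrix.of fun i j : Fin 2 =>
    inner ℝ (mfderiv (𝓡 2) (𝓡 2) e.symm y (planeBasis i) : TangentSpace (𝓡 2) (e.symm y))
      (mfderiv (𝓡 2) (𝓡 2) e.symm y (planeBasis j) : TangentSpace (𝓡 2) (e.symm y))

/-- The sectional curvature `K(P)` of the only `2`-plane `P = T_m M` in the tangent space of a
Riemannian surface at `m`, that is, the Gaussian curvature at `m`, computed in the preferred chart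
at `m`. -/
def gaussCurvature (m : M) : ℝ :=
  coordCurvature (coordMetric M (chartAt Plane m)) (chartAt Plane m m)

/-- `vol` is the Riemannian volume (area) measure: in every chart of the atlas its density with
respect to Lebesgue measure is `√(det G_{ij})`. On a second countable surface this determines the
Borel measure `vol`. -/
def IsRiemannianVolume [MeasurableSpace M] (vol : Measure M) : Prop :=
  ∀ e ∈ atlas Plane M, ∀ A : Set M, MeasurableSet A → A ⊆ e.source →
    vol A = ∫⁻ y in e '' A, ENNReal.ofReal (Real.sqrt (coordMetric M e y).det)

end Riemannian

/-- The distance sphere `S_r(p)`, the topological boundary of the closure of the open ball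
`B_r(p)`. -/
def distSphere {M : Type} [MetricSpace M] (p : M) (r : ℝ) : Set M :=
  frontier (closure (Metric.ball p r))

end

/-! The surface is the hyperelliptic curve w² = θ(z) over the punctured plane, where θ (`theta L`)
is a theta function with simple zeros at -exp(L(n + 1/2)), n ∈ ℤ. Write t = log|z|. The form dz/(zw)
is holomorphic and zero-free on the curve, so |dz/(zw)|² is a flat metric; the metric used is
e^{2U(t)} |dz/(zw)|² with U(t) = log cosh t + t²/(4L). By quasi-periodicity |w| is at most a
multiple of exp(t²/(4L)), and the Gaussian part of U cancels exactly this growth: up to a factor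
invariant under z ↦ e^L z, the metric is cosh²t |dz/z|², lifted to the branched double cover.

Curvature. Since log|z| is harmonic, K = -e^{-2U} U'' |w|² with U'' = 1/cosh²t + 1/(2L). In terms of
the density `dens` = e^U/|w| relative to |dz/z| this says |K| = U''/dens². Conversely the distance
from the basepoint is at most 7 dens + const, with 7 independent of L (`exists_dist_le_dens`):
follow a circle to the positive ray, along which |θ| grows and dens shrinks, then go radially to |z|
= 1, where log-convexity of θ makes dens decay exponentially along the path. Hence r²|K| is
asymptotically bounded by a constant over L, and L is taken large.

Volume. The translations (z, w) ↦ (e^{2Lk} z, e^{Lk²} z^k w) preserve the curve and stretch lengths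
by cosh(t + 2Lk)/cosh t. Away from the waist t = 0 they act, up to constants, as homotheties of
ratio e^{2L|k|}, so quadratic growth and noncollapsing follow from compactness of a fundamental
slab. Completeness holds because sinh t is Lipschitz and z is proper.

Topology. Suppose the curve is the interior of a compact surface. For a branch point a, the pairs
(√(z - a), √(θ/(z - a))) with product w are nonzero and defined up to a common sign, hence give a
map to (ℂ² ∖ 0)/±1. Local lifts over a fixed finite cover differ by signs, and there are finitely
many sign patterns, so two branch points a, a' share one; then √((z - a)(z - a')) exists
continuously on the whole curve (`exists_sqrt_of_hasFiniteTopologicalType`). But a loop around one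
of them and a neighbouring branch point, with the other outside, closes up on the curve and reverses
the sign of this root (`false_of_sq_eq`). -/

noncomputable section

/-! ### The hyperelliptic curve and its flat atlas -/

/-- A holomorphic function on the punctured plane with simple zeros and at least one zero, and a
smooth function of the logarithm of the modulus. -/
class HypData (F : ℂ → ℂ) (U : ℝ → ℝ) : Prop where
  differentiableOn : DifferentiableOn ℂ F {0}ᶜ
  deriv_ne_zero : ∀ z, z ≠ 0 → F z = 0 → deriv F z ≠ 0
  exists_zero : ∃ z, z ≠ 0 ∧ F z = 0
  contDiff : ContDiff ℝ ∞ U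

/-- The hyperelliptic curve `w² = F z` over the punctured plane. The function `U` does not
influence the set of points; it determines the Riemannian metric. -/
def Hyp (F : ℂ → ℂ) (_U : ℝ → ℝ) : Type := {p : ℂ × ℂ // p.1 ≠ 0 ∧ p.2 ^ 2 = F p.1}

instance (F : ℂ → ℂ) (U : ℝ → ℝ) : TopologicalSpace (Hyp F U) :=
  inferInstanceAs (TopologicalSpace {p : ℂ × ℂ // p.1 ≠ 0 ∧ p.2 ^ 2 = F p.1})

/-- The identification of the complex plane with the Euclidean plane. -/
def planeIso : ℂ ≃ₗᵢ[ℝ] Plane := Complex.orthonormalBasisOneI.repr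

/-- The holomorphic vector field dual to the differential `dz / (z w)` on `w² = F z`. -/
def hypField (F : ℂ → ℂ) (p : ℂ × ℂ) : ℂ × ℂ := (p.1 * p.2, p.1 * deriv F p.1 / 2)

namespace Hyp

variable {F : ℂ → ℂ} {U : ℝ → ℝ}

/-- The embedding of the curve into `ℂ²`. -/
def val (x : Hyp F U) : ℂ × ℂ := Subtype.val x

/-- The coordinate `z`. -/
def z (x : Hyp F U) : ℂ := x.val.1

/-- The coordinate `w`. -/
def w (x : Hyp F U) : ℂ := x.val.2

lemma z_ne_zero (x : Hyp F U) : x.z ≠ 0 := x.2.1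

lemma w_sq (x : Hyp F U) : x.w ^ 2 = F x.z := x.2.2

/-- The point of the curve with given coordinates. -/
def mk (z w : ℂ) (hz : z ≠ 0) (hw : w ^ 2 = F z) : Hyp F U := ⟨(z, w), hz, hw⟩

@[simp] lemma z_mk {z w : ℂ} (hz : z ≠ 0) (hw : w ^ 2 = F z) : (mk z w hz hw : Hyp F U).z = z := rfl

@[simp] lemma w_mk {z w : ℂ} (hz : z ≠ 0) (hw : w ^ 2 = F z) : (mk z w hz hw : Hyp F U).w = w := rfl

@[simp] lemma val_mk {z w : ℂ} (hz : z ≠ 0) (hw : w ^ 2 = F z) :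
    (mk z w hz hw : Hyp F U).val = (z, w) := rfl

lemma val_eq (x : Hyp F U) : x.val = (x.z, x.w) := rfl

lemma isEmbedding_val : IsEmbedding (val : Hyp F U → ℂ × ℂ) := IsEmbedding.subtypeVal

lemma val_injective : Function.Injective (val : Hyp F U → ℂ × ℂ) := Subtype.val_injective

@[fun_prop] lemma continuous_val : Continuous (val : Hyp F U → ℂ × ℂ) := continuous_subtype_val

@[fun_prop] lemma continuous_z : Continuous (z : Hyp F U → ℂ) := continuous_val.fst

@[fun_prop] lemma continuous_w : Continuous (w : Hyp F U → ℂ) := continuous_val.snd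

@[ext] lemma ext {x y : Hyp F U} (h : x.z = y.z) (h' : x.w = y.w) : x = y :=
  val_injective (Prod.ext h h')

lemma continuousAt_iff {X : Type*} [TopologicalSpace X] {f : X → Hyp F U} {a : X} :
    ContinuousAt f a ↔ ContinuousAt (fun t => (f t).val) a :=
  isEmbedding_val.isInducing.continuousAt_iff

lemma continuousOn_iff {X : Type*} [TopologicalSpace X] {f : X → Hyp F U} {s : Set X} :
    ContinuousOn f s ↔ ContinuousOn (fun t => (f t).val) s :=
  isEmbedding_val.isInducing.continuousOn_iff

lemma continuous_iff {X : Type*} [TopologicalSpace X] {f : X → Hyp F U} :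
    Continuous f ↔ Continuous (fun t => (f t).val) :=
  isEmbedding_val.isInducing.continuous_iff

instance : T3Space (Hyp F U) := inferInstanceAs (T3Space {p : ℂ × ℂ // p.1 ≠ 0 ∧ p.2 ^ 2 = F p.1})

instance : SecondCountableTopology (Hyp F U) :=
  inferInstanceAs (SecondCountableTopology {p : ℂ × ℂ // p.1 ≠ 0 ∧ p.2 ^ 2 = F p.1})

/-- A flat chart: its inverse is an integral curve of `hypField` in complex time. -/
structure IsFlatChart (e : OpenPartialHomeomorph (Hyp F U) Plane) : Prop where
  hasDerivAt_symm : ∀ ζ : ℂ, planeIso ζ ∈ e.target →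
    HasDerivAt (fun ξ => (e.symm (planeIso ξ)).val) (hypField F (e.symm (planeIso ζ)).val) ζ
  -- The extension to ℂ² reduces smoothness of transition maps, and of maps into the curve, to the
  -- chain rule in the ambient space.
  exists_extension : ∃ E : ℂ × ℂ → Plane, ∀ x ∈ e.source, e x = E x.val ∧ ContDiffAt ℝ ∞ E x.val ∧
    ∀ c : ℂ, fderiv ℝ E x.val (c • hypField F x.val) = planeIso c

/-- Local parametrizations by a coordinate give flat charts. -/
lemma exists_isFlatChart_of_parametrization (x₀ : Hyp F U) (α : ℂ → Hyp F U) (pr : ℂ × ℂ →L[ℂ] ℂ)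
    (k : ℂ → ℂ) {ρ : ℝ} (hρ : 0 < ρ)
    (hα : ∀ τ ∈ Metric.ball (pr x₀.val) ρ,
      HasDerivAt (fun ξ => (α ξ).val) (k τ • hypField F (α τ).val) τ)
    (hprα : ∀ τ ∈ Metric.ball (pr x₀.val) ρ, pr (α τ).val = τ)
    (hk : DifferentiableOn ℂ k (Metric.ball (pr x₀.val) ρ))
    (hk0 : ∀ τ ∈ Metric.ball (pr x₀.val) ρ, k τ ≠ 0)
    (hO : IsOpen {x : Hyp F U | pr x.val ∈ Metric.ball (pr x₀.val) ρ ∧ α (pr x.val) = x})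
    (hx₀ : α (pr x₀.val) = x₀) :
    ∃ e : OpenPartialHomeomorph (Hyp F U) Plane, IsFlatChart e ∧ x₀ ∈ e.source := by
  set τ₀ := pr x₀.val
  set B := Metric.ball τ₀ ρ
  have hB : IsOpen B := Metric.isOpen_ball
  have hτ₀ : τ₀ ∈ B := Metric.mem_ball_self hρ
  -- The parametrization moves with velocity `k` times the field, so the complex time elapsed along
  -- the field is a primitive `K` of `k`. The chart is `K` composed with the coordinate `pr`.
  obtain ⟨K, hK⟩ := hk.isExactOn_ball
  have hKd : DifferentiableOn ℂ K B := fun τ hτ => (hK τ hτ).differentiableAt.differentiableWithinAt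
  have hKc : ∀ τ ∈ B, ContDiffAt ℂ ∞ K τ := fun τ hτ =>
    (hKd.contDiffOn hB).contDiffAt (hB.mem_nhds hτ)
  have hKs : HasStrictDerivAt K (k τ₀) τ₀ :=
    (hKc τ₀ hτ₀).hasStrictDerivAt' (hK τ₀ hτ₀) (by simp)
  let κ₀ := (hKs.hasStrictFDerivAt_equiv (hk0 τ₀ hτ₀)).toOpenPartialHomeomorph K
  have hκ₀ : τ₀ ∈ κ₀.source := HasStrictFDerivAt.mem_toOpenPartialHomeomorph_source _
  let κ := κ₀.restrOpen B hB
  have hκK : ∀ τ, κ τ = K τ := fun τ => rfl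
  have hκs : κ.source ⊆ B := fun τ hτ => hτ.2
  have hκ₁ : τ₀ ∈ κ.source := ⟨hκ₀, hτ₀⟩
  have hαc : ContinuousOn α B := continuousOn_iff.2 fun τ hτ =>
    (hα τ hτ).continuousAt.continuousWithinAt
  let e : OpenPartialHomeomorph (Hyp F U) Plane :=
    { toFun := fun x => planeIso (K (pr x.val))
      invFun := fun y => α (κ.symm (planeIso.symm y))
      source := {x : Hyp F U | pr x.val ∈ B ∧ α (pr x.val) = x} ∩ (fun x => pr x.val) ⁻¹' κ.source
      target := planeIso.symm ⁻¹' κ.target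
      map_source' := by
        rintro x ⟨-, hx⟩
        simp only [Set.mem_preimage, LinearIsometryEquiv.symm_apply_apply]
        exact κ.map_source hx
      map_target' := by
        intro y hy
        have h1 := κ.map_target hy
        have h2 := hκs h1
        have h3 := hprα _ h2
        refine ⟨⟨?_, ?_⟩, ?_⟩
        · simpa only [h3] using h2
        · rw [h3]
        · simpa only [Set.mem_preimage, h3] using h1
      left_inv' := by
        rintro x ⟨⟨hx, hx'⟩, hx''⟩
        simp only [LinearIsometryEquiv.symm_apply_apply]
        rw [← hκK, κ.left_inv hx'', hx']
      right_inv' := by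
        intro y hy
        have h2 := hκs (κ.map_target hy)
        rw [hprα _ h2, ← hκK, κ.right_inv hy, LinearIsometryEquiv.apply_symm_apply]
      open_source := hO.inter (κ.open_source.preimage (by fun_prop))
      open_target := κ.open_target.preimage planeIso.symm.continuous
      continuousOn_toFun := by
        refine planeIso.continuous.comp_continuousOn ?_
        refine hKd.continuousOn.comp (Continuous.continuousOn (by fun_prop)) ?_
        rintro x ⟨⟨hx, -⟩, -⟩
        exact hx
      continuousOn_invFun := by
        refine hαc.comp (κ.continuousOn_symm.comp planeIso.symm.continuous.continuousOn
          fun y hy => hy) ?_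
        intro y hy
        exact hκs (κ.map_target hy) }
  refine ⟨e, ⟨?_, ?_⟩, ⟨hτ₀, hx₀⟩, hκ₁⟩
  · intro ζ hζ
    have hζ' : ζ ∈ κ.target := by simpa [e] using hζ
    have h1 := hκs (κ.map_target hζ')
    have h2 : HasDerivAt κ (k (κ.symm ζ)) (κ.symm ζ) := hK _ h1
    have h3 := κ.hasDerivAt_symm hζ' (hk0 _ h1) h2
    have h4 := HasDerivAt.scomp ζ (hα _ h1) h3
    rw [smul_smul, inv_mul_cancel₀ (hk0 _ h1), one_smul] at h4
    have h5 : ∀ ξ, e.symm (planeIso ξ) = α (κ.symm ξ) := fun ξ => by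
      change α (κ.symm (planeIso.symm (planeIso ξ))) = _
      simp
    simp only [h5]
    exact h4
  · refine ⟨fun p => planeIso (K (pr p)), ?_⟩
    rintro x ⟨⟨hx, hx'⟩, -⟩
    have hc : ContDiffAt ℝ ∞ K (pr x.val) := (hKc _ hx).restrict_scalars ℝ
    refine ⟨rfl, ?_, ?_⟩
    · exact planeIso.contDiff.contDiffAt.comp _
        (hc.comp _ (pr.restrictScalars ℝ).contDiff.contDiffAt)
    · intro c
      have h1 : HasFDerivAt (fun p => K (pr p)) _ x.val :=
        HasFDerivAt.comp x.val (hK _ hx).hasFDerivAt pr.hasFDerivAt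
      have h2 : HasFDerivAt (fun p => planeIso (K (pr p))) _ x.val :=
        (planeIso.toContinuousLinearEquiv.hasFDerivAt).comp x.val (h1.restrictScalars ℝ)
      rw [h2.fderiv]
      have h3 : HasDerivAt (fun ξ => pr (α ξ).val) (pr (k (pr x.val) • hypField F (α (pr x.val)).val))
        (pr x.val) := (pr.hasFDerivAt.comp_hasDerivAt _ (hα _ hx))
      have h4 : HasDerivAt (fun ξ => pr (α ξ).val) 1 (pr x.val) :=
        (hasDerivAt_id (pr x.val)).congr_of_eventuallyEq
          (by filter_upwards [hB.mem_nhds hx] with ξ hξ using hprα _ hξ)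
      have h5 := h3.unique h4
      rw [hx', map_smul, smul_eq_mul] at h5
      have h6 : k (pr x.val) * pr (hypField F x.val) = 1 := h5
      simp [mul_comm (pr (hypField F x.val)), h6]

lemma isOpen_punctured : IsOpen ({0}ᶜ : Set ℂ) := isOpen_compl_singleton

lemma hasDerivAt_F [h : HypData F U] {z : ℂ} (hz : z ≠ 0) : HasDerivAt F (deriv F z) z :=
  ((HypData.differentiableOn U z hz).differentiableAt (isOpen_punctured.mem_nhds hz)).hasDerivAt

lemma differentiableOn_deriv_F [h : HypData F U] : DifferentiableOn ℂ (deriv F) {0}ᶜ :=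
  (HypData.differentiableOn (F := F) U).deriv isOpen_punctured

/-- A flat chart at a point which is not a branch point. -/
lemma exists_isFlatChart_of_w_ne_zero [HypData F U] (x₀ : Hyp F U) (h₀ : x₀.w ≠ 0) :
    ∃ e : OpenPartialHomeomorph (Hyp F U) Plane, IsFlatChart e ∧ x₀ ∈ e.source := by
  classical
  have hF₀ : F x₀.z ≠ 0 := by rw [← w_sq x₀]; exact pow_ne_zero 2 h₀
  -- A branch of √F with value `x₀.w` at `x₀.z`: the principal root is applied to a quotient close
  -- to 1, away from its cut.
  let s : ℂ → ℂ := fun τ => x₀.w * (F τ / F x₀.z) ^ ((2 : ℕ) : ℂ)⁻¹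
  have hs2 : ∀ τ, s τ ^ 2 = F τ := fun τ => by
    simp only [s]
    rw [mul_pow, Complex.cpow_nat_inv_pow _ two_ne_zero, w_sq, mul_div_cancel₀ _ hF₀]
  have hs₀ : s x₀.z = x₀.w := by simp [s, div_self hF₀]
  have hFc : ContinuousAt F x₀.z := (hasDerivAt_F (U := U) x₀.z_ne_zero).continuousAt
  have hev : ∀ᶠ τ in 𝓝 x₀.z, τ ≠ 0 ∧ F τ / F x₀.z ∈ Complex.slitPlane := by
    refine (isOpen_punctured.eventually_mem x₀.z_ne_zero).and ?_
    refine (hFc.div_const _).eventually_mem (Complex.isOpen_slitPlane.mem_nhds ?_)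
    simp [div_self hF₀]
  obtain ⟨ρ, hρ, hball⟩ := Metric.eventually_nhds_iff_ball.1 hev
  have hFne : ∀ τ ∈ Metric.ball x₀.z ρ, F τ ≠ 0 := fun τ hτ h0 => by
    have := (hball τ hτ).2
    simp [h0] at this
  have hsne : ∀ τ ∈ Metric.ball x₀.z ρ, s τ ≠ 0 := fun τ hτ h0 => by
    apply hFne τ hτ; rw [← hs2, h0]; simp
  have hsd : ∀ τ ∈ Metric.ball x₀.z ρ, HasDerivAt s (deriv F τ / (2 * s τ)) τ := by
    intro τ hτ
    have h1 : DifferentiableAt ℂ s τ := by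
      refine DifferentiableAt.const_mul ?_ _
      refine DifferentiableAt.cpow ?_ (differentiableAt_const _) (hball τ hτ).2
      exact (hasDerivAt_F (U := U) (hball τ hτ).1).differentiableAt.div_const _
    have h2 := h1.hasDerivAt.pow 2
    have h3 : HasDerivAt (fun τ => s τ ^ 2) (deriv F τ) τ := by
      simp only [hs2]; exact hasDerivAt_F (U := U) (hball τ hτ).1
    have h4 := h3.unique h2
    have h5 : deriv F τ / (2 * s τ) = deriv s τ := by
      rw [h4]; have := hsne τ hτ; simp; field_simp
    rw [h5]; exact h1.hasDerivAt
  let α : ℂ → Hyp F U := fun τ => if h : τ ≠ 0 then mk τ (s τ) h (hs2 τ) else x₀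
  have hα : ∀ τ ∈ Metric.ball x₀.z ρ, (α τ).val = (τ, s τ) := fun τ hτ => by
    simp only [α]; rw [dif_pos (hball τ hτ).1, val_mk]
  refine exists_isFlatChart_of_parametrization x₀ α (ContinuousLinearMap.fst ℂ ℂ ℂ)
    (fun τ => 1 / (τ * s τ)) hρ ?_ ?_ ?_ ?_ ?_ ?_
  · intro τ hτ
    change τ ∈ Metric.ball x₀.z ρ at hτ
    have h1 : (fun ξ => (α ξ).val) =ᶠ[𝓝 τ] fun ξ => (ξ, s ξ) := by
      filter_upwards [Metric.isOpen_ball.mem_nhds hτ] with ξ hξ using hα ξ hξ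
    have h2 : HasDerivAt (fun ξ => (ξ, s ξ)) (1, deriv F τ / (2 * s τ)) τ :=
      (hasDerivAt_id τ).prodMk (hsd τ hτ)
    refine (h2.congr_of_eventuallyEq h1).congr_deriv ?_
    rw [hα τ hτ, hypField]
    have := hsne τ hτ
    have := (hball τ hτ).1
    ext <;> simp <;> field_simp
  · intro τ hτ
    change τ ∈ Metric.ball x₀.z ρ at hτ
    rw [hα τ hτ]; rfl
  · intro τ hτ
    change τ ∈ Metric.ball x₀.z ρ at hτ
    refine DifferentiableAt.differentiableWithinAt ?_
    exact (differentiableAt_const _).div (differentiableAt_id.mul (hsd τ hτ).differentiableAt)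
      (mul_ne_zero (hball τ hτ).1 (hsne τ hτ))
  · intro τ hτ
    change τ ∈ Metric.ball x₀.z ρ at hτ
    exact one_div_ne_zero (mul_ne_zero (hball τ hτ).1 (hsne τ hτ))
  -- The only alternative to w = s(z) is w = -s(z), so the graph of the branch is cut out by a
  -- strict norm inequality and is open.
  · have : {x : Hyp F U | (ContinuousLinearMap.fst ℂ ℂ ℂ) x.val ∈
        Metric.ball ((ContinuousLinearMap.fst ℂ ℂ ℂ) x₀.val) ρ ∧
        α ((ContinuousLinearMap.fst ℂ ℂ ℂ) x.val) = x} =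
        {x : Hyp F U | x.z ∈ Metric.ball x₀.z ρ ∩ {τ | True} ∧ ‖x.w - s x.z‖ < ‖x.w + s x.z‖} := by
      ext x
      change (x.z ∈ Metric.ball x₀.z ρ ∧ α x.z = x) ↔ _
      simp only [Set.mem_ofPred_eq, Set.mem_inter_iff, and_true]
      refine and_congr_right fun hx => ?_
      have h1 : α x.z = x ↔ x.w = s x.z := by
        rw [← val_injective.eq_iff, hα _ hx, val_eq, Prod.mk.injEq]
        simp [eq_comm]
      rw [h1]
      have h2 : x.w ^ 2 = s x.z ^ 2 := by rw [hs2, w_sq]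
      rcases sq_eq_sq_iff_eq_or_eq_neg.1 h2 with h | h
      · have := hsne _ hx
        simp [h, ← two_mul, this]
      · rw [h]
        have : ¬ (-s x.z = s x.z) := by
          rw [neg_eq_iff_add_eq_zero, ← two_mul]; simp [hsne _ hx]
        simp [this]
    rw [this]
    have hsc : ContinuousOn (fun x : Hyp F U => s x.z) (z ⁻¹' Metric.ball x₀.z ρ) := by
      intro x hx
      exact ((hsd x.z hx).continuousAt.comp continuous_z.continuousAt).continuousWithinAt
    have h1 := ContinuousOn.isOpen_inter_preimage
      (f := fun x : Hyp F U => ‖x.w + s x.z‖ - ‖x.w - s x.z‖) (t := Set.Ioi 0)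
      (s := z ⁻¹' Metric.ball x₀.z ρ)
      ((continuous_w.continuousOn.add hsc).norm.sub (continuous_w.continuousOn.sub hsc).norm)
      (Metric.isOpen_ball.preimage continuous_z) isOpen_Ioi
    convert h1 using 1
    ext x; simp
  · change α x₀.z = x₀
    rw [← val_injective.eq_iff, hα _ (Metric.mem_ball_self hρ), hs₀]; rfl

/-- A flat chart at a branch point. -/
lemma exists_isFlatChart_of_w_eq_zero [HypData F U] (x₀ : Hyp F U) (h₀ : x₀.w = 0) :
    ∃ e : OpenPartialHomeomorph (Hyp F U) Plane, IsFlatChart e ∧ x₀ ∈ e.source := by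
  classical
  have hF₀ : F x₀.z = 0 := by rw [← w_sq x₀, h₀]; simp
  have hd₀ := HypData.deriv_ne_zero (F := F) U x₀.z x₀.z_ne_zero hF₀
  have hFs : HasStrictDerivAt F (deriv F x₀.z) x₀.z := by
    have h1 : ContDiffAt ℂ ∞ F x₀.z :=
      ((HypData.differentiableOn (F := F) U).contDiffOn isOpen_punctured).contDiffAt
        (isOpen_punctured.mem_nhds x₀.z_ne_zero)
    exact h1.hasStrictDerivAt' (hasDerivAt_F (U := U) x₀.z_ne_zero) (by simp)
  -- At a simple zero `F` is locally biholomorphic, so `w` is a coordinate and z = F⁻¹(w²).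
  let G := (hFs.hasStrictFDerivAt_equiv hd₀).toOpenPartialHomeomorph F
  have hG : x₀.z ∈ G.source := HasStrictFDerivAt.mem_toOpenPartialHomeomorph_source _
  have hGF : ∀ τ, G τ = F τ := fun τ => rfl
  have h0t : (0 : ℂ) ∈ G.target := by rw [← hF₀]; exact G.map_source hG
  have hG0 : G.symm 0 = x₀.z := by
    rw [← hF₀]; exact G.left_inv hG
  have hsymm : ContinuousAt (fun τ : ℂ => G.symm (τ ^ 2)) 0 := by
    refine ContinuousAt.comp (f := fun τ : ℂ => τ ^ 2) (g := G.symm) ?_ (by fun_prop)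
    simpa using G.continuousAt_symm h0t
  have hev : ∀ᶠ τ in 𝓝 (0 : ℂ), (τ ^ 2 ∈ G.target ∧ G.symm (τ ^ 2) ≠ 0) ∧
      deriv F (G.symm (τ ^ 2)) ≠ 0 := by
    refine ((?_ : ∀ᶠ τ in 𝓝 (0 : ℂ), τ ^ 2 ∈ G.target).and ?_).and ?_
    · have : ContinuousAt (fun τ : ℂ => τ ^ 2) 0 := by fun_prop
      exact this.eventually_mem (G.open_target.mem_nhds (by simpa using h0t))
    · refine hsymm.eventually_mem (isOpen_punctured.mem_nhds ?_)
      simpa [hG0] using x₀.z_ne_zero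
    · have h1 : ContinuousAt (deriv F) x₀.z :=
        ((differentiableOn_deriv_F (U := U)).differentiableAt
          (isOpen_punctured.mem_nhds x₀.z_ne_zero)).continuousAt
      have h2 : ContinuousAt (fun τ : ℂ => deriv F (G.symm (τ ^ 2))) 0 := by
        refine ContinuousAt.comp (g := deriv F) ?_ hsymm
        simpa [hG0] using h1
      refine h2.eventually_ne ?_
      simpa [hG0] using hd₀
  obtain ⟨ρ, hρ, hball⟩ := Metric.eventually_nhds_iff_ball.1 hev
  let g : ℂ → ℂ := fun τ => G.symm (τ ^ 2)
  have hg : ∀ τ ∈ Metric.ball (0 : ℂ) ρ, τ ^ 2 = F (g τ) := fun τ hτ =>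
    (G.right_inv (hball τ hτ).1.1).symm
  have hgd : ∀ τ ∈ Metric.ball (0 : ℂ) ρ, HasDerivAt g (2 * τ / deriv F (g τ)) τ := by
    intro τ hτ
    have h1 := G.hasDerivAt_symm (hball τ hτ).1.1 (hball τ hτ).2
      (hasDerivAt_F (F := F) (U := U) (hball τ hτ).1.2)
    have h2 := h1.comp τ (hasDerivAt_pow 2 τ)
    refine h2.congr_deriv ?_
    simp only [g]; rw [div_eq_mul_inv, mul_comm]; simp
  let α : ℂ → Hyp F U := fun τ => if h : τ ∈ Metric.ball 0 ρ then
    mk (g τ) τ (hball τ h).1.2 (hg τ h) else x₀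
  have hα : ∀ τ ∈ Metric.ball (0 : ℂ) ρ, (α τ).val = (g τ, τ) := fun τ hτ => by
    simp only [α]; rw [dif_pos hτ, val_mk]
  have hpr : (ContinuousLinearMap.snd ℂ ℂ ℂ) x₀.val = 0 := h₀
  refine exists_isFlatChart_of_parametrization x₀ α (ContinuousLinearMap.snd ℂ ℂ ℂ)
    (fun τ => 2 / (g τ * deriv F (g τ))) hρ ?_ ?_ ?_ ?_ ?_ ?_ <;> rw [hpr]
  · intro τ hτ
    have h1 : (fun ξ => (α ξ).val) =ᶠ[𝓝 τ] fun ξ => (g ξ, ξ) := by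
      filter_upwards [Metric.isOpen_ball.mem_nhds hτ] with ξ hξ using hα ξ hξ
    have h2 : HasDerivAt (fun ξ => (g ξ, ξ)) (2 * τ / deriv F (g τ), 1) τ :=
      (hgd τ hτ).prodMk (hasDerivAt_id τ)
    refine (h2.congr_of_eventuallyEq h1).congr_deriv ?_
    rw [hα τ hτ, hypField]
    have h3 := (hball τ hτ).2
    have h4 := (hball τ hτ).1.2
    change deriv F (g τ) ≠ 0 at h3
    change g τ ≠ 0 at h4
    ext <;> simp <;> field_simp
  · intro τ hτ
    rw [hα τ hτ]; rfl
  · intro τ hτ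
    refine DifferentiableAt.differentiableWithinAt ?_
    refine (differentiableAt_const _).div ((hgd τ hτ).differentiableAt.mul ?_)
      (mul_ne_zero (hball τ hτ).1.2 (hball τ hτ).2)
    refine DifferentiableAt.comp (g := deriv F) τ ?_ (hgd τ hτ).differentiableAt
    exact (differentiableOn_deriv_F (U := U)).differentiableAt
      (isOpen_punctured.mem_nhds (hball τ hτ).1.2)
  · intro τ hτ
    exact div_ne_zero two_ne_zero (mul_ne_zero (hball τ hτ).1.2 (hball τ hτ).2)
  · have : {x : Hyp F U | (ContinuousLinearMap.snd ℂ ℂ ℂ) x.val ∈ Metric.ball (0 : ℂ) ρ ∧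
        α ((ContinuousLinearMap.snd ℂ ℂ ℂ) x.val) = x} =
        {x : Hyp F U | x.w ∈ Metric.ball (0 : ℂ) ρ ∧ x.z ∈ G.source} := by
      ext x
      change (x.w ∈ Metric.ball 0 ρ ∧ α x.w = x) ↔ (x.w ∈ Metric.ball 0 ρ ∧ _)
      refine and_congr_right fun hx => ?_
      rw [← val_injective.eq_iff, hα _ hx, val_eq, Prod.mk.injEq]
      simp only [and_true]
      constructor
      · rintro h
        rw [← h]
        exact G.map_target (hball _ hx).1.1
      · intro h
        simp only [g]
        rw [w_sq, ← hGF, G.left_inv h]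
    rw [this]
    exact (Metric.isOpen_ball.preimage continuous_w).inter (G.open_source.preimage continuous_z)
  · rw [← val_injective.eq_iff, hα _ (Metric.mem_ball_self hρ), val_eq, h₀]
    simp [g, hG0]

lemma exists_isFlatChart [HypData F U] (x₀ : Hyp F U) :
    ∃ e : OpenPartialHomeomorph (Hyp F U) Plane, IsFlatChart e ∧ x₀ ∈ e.source := by
  by_cases h : x₀.w = 0
  · exact exists_isFlatChart_of_w_eq_zero x₀ h
  · exact exists_isFlatChart_of_w_ne_zero x₀ h

instance [HypData F U] : ChartedSpace Plane (Hyp F U) where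
  atlas := {e | IsFlatChart e}
  chartAt x := (exists_isFlatChart x).choose
  mem_chart_source x := (exists_isFlatChart x).choose_spec.2
  chart_mem_atlas x := (exists_isFlatChart x).choose_spec.1

lemma isFlatChart_of_mem_atlas [HypData F U] {e : OpenPartialHomeomorph (Hyp F U) Plane}
    (he : e ∈ atlas Plane (Hyp F U)) : IsFlatChart e := he

lemma isFlatChart_chartAt [HypData F U] (x : Hyp F U) : IsFlatChart (chartAt Plane x) :=
  isFlatChart_of_mem_atlas (chart_mem_atlas Plane x)

lemma IsFlatChart.hasFDerivAt_val_symm {e : OpenPartialHomeomorph (Hyp F U) Plane}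
    (he : IsFlatChart e) {y : Plane} (hy : y ∈ e.target) :
    HasFDerivAt (fun y => (e.symm y).val)
      (((ContinuousLinearMap.toSpanSingleton ℂ (hypField F (e.symm y).val)).restrictScalars ℝ).comp
        (planeIso.symm.toContinuousLinearEquiv : Plane →L[ℝ] ℂ)) y := by
  have h1 := he.hasDerivAt_symm (planeIso.symm y) (by simpa using hy)
  simp only [LinearIsometryEquiv.apply_symm_apply] at h1
  have h2 := (h1.hasFDerivAt.restrictScalars ℝ).comp y
    (planeIso.symm.toContinuousLinearEquiv.hasFDerivAt (x := y))
  simp only [Function.comp_def] at h2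
  refine (h2.congr_of_eventuallyEq ?_)
  filter_upwards with y
  simp

/-- Both charts straighten the same vector field, so they differ locally by a translation. -/
lemma hasFDerivAt_transition {e e' : OpenPartialHomeomorph (Hyp F U) Plane}
    (he : IsFlatChart e) (he' : IsFlatChart e') {y : Plane} (hy : y ∈ e.target)
    (hy' : e.symm y ∈ e'.source) :
    HasFDerivAt (fun y => e' (e.symm y)) (ContinuousLinearMap.id ℝ Plane) y := by
  obtain ⟨E, hE⟩ := he'.exists_extension
  obtain ⟨-, h2, h3⟩ := hE _ hy'
  have h4 := HasFDerivAt.comp y (h2.differentiableAt (by simp)).hasFDerivAt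
    (he.hasFDerivAt_val_symm hy)
  have h5 : (fun y => e' (e.symm y)) =ᶠ[𝓝 y] E ∘ fun y => (e.symm y).val := by
    filter_upwards [(e.continuousAt_symm hy).eventually_mem (e'.open_source.mem_nhds hy')]
      with y' hy'
    exact (hE _ hy').1
  refine (h4.congr_of_eventuallyEq h5).congr_fderiv ?_
  ext1 v
  simp only [ContinuousLinearMap.comp_apply]
  have := h3 (planeIso.symm v)
  simpa using this

lemma contDiffOn_of_hasFDerivAt_const {E E' : Type*} [NormedAddCommGroup E] [NormedSpace ℝ E]
    [NormedAddCommGroup E'] [NormedSpace ℝ E'] {f : E → E'} {f' : E →L[ℝ] E'} {s : Set E}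
    (hs : IsOpen s) (h : ∀ x ∈ s, HasFDerivAt f f' x) : ContDiffOn ℝ ∞ f s := by
  rw [contDiffOn_infty_iff_fderiv_of_isOpen hs]
  refine ⟨fun x hx => (h x hx).differentiableAt.differentiableWithinAt, ?_⟩
  exact (contDiffOn_const (c := f')).congr fun x hx => (h x hx).fderiv

instance [HypData F U] : IsManifold (𝓡 2) ∞ (Hyp F U) := by
  refine isManifold_of_contDiffOn (𝓡 2) ∞ (Hyp F U) fun e e' he he' => ?_
  simp only [modelWithCornersSelf_coe, modelWithCornersSelf_coe_symm, Set.range_id,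
    Set.inter_univ, Set.preimage_id_eq, id_eq, Function.id_comp, Function.comp_id]
  refine contDiffOn_of_hasFDerivAt_const (f' := ContinuousLinearMap.id ℝ Plane)
    (e.symm.trans e').open_source fun y hy => ?_
  simp only [OpenPartialHomeomorph.trans_source, OpenPartialHomeomorph.symm_source,
    Set.mem_inter_iff, Set.mem_preimage] at hy
  exact hasFDerivAt_transition he he' hy.1 hy.2

end Hyp

end

/-! ### The conformal Riemannian metric -/

noncomputable section

namespace Hyp
variable {F : ℂ → ℂ} {U : ℝ → ℝ}

/-- The logarithm of the modulus of the coordinate `z`. -/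
def logMod (x : Hyp F U) : ℝ := Real.log ‖x.z‖

/-- The conformal factor of the Riemannian metric with respect to the flat metric. -/
def conf (x : Hyp F U) : ℝ := Real.exp (2 * U x.logMod)

lemma conf_pos (x : Hyp F U) : 0 < x.conf := Real.exp_pos _

/-- The flat charts trivialize the tangent bundle, so a metric can be prescribed fibrewise as a
multiple of one fixed inner product. -/
lemma tangentCoordChange_eq [HypData F U] (x y : Hyp F U) {q : Hyp F U}
    (hx : q ∈ (chartAt Plane x).source) (hy : q ∈ (chartAt Plane y).source) :
    (tangentBundleCore (𝓡 2) (Hyp F U)).coordChange (achart Plane x) (achart Plane y) q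
      = ContinuousLinearMap.id ℝ Plane := by
  rw [tangentBundleCore_coordChange_achart]
  simp only [mfld_simps, fderivWithin_univ]
  refine (hasFDerivAt_transition (isFlatChart_chartAt x) (isFlatChart_chartAt y)
    ((chartAt Plane x).map_source hx) ?_).fderiv
  rwa [(chartAt Plane x).left_inv hx]

/-- Multiplication by a complex number, as a linear form on the Euclidean plane. -/
def mulForm (a : ℂ) : Plane →L[ℝ] ℂ :=
  ((ContinuousLinearMap.toSpanSingleton ℂ a).restrictScalars ℝ).comp
    (planeIso.symm.toContinuousLinearEquiv : Plane →L[ℝ] ℂ)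

@[simp] lemma mulForm_apply (a : ℂ) (v : Plane) : mulForm a v = planeIso.symm v * a := by
  simp [mulForm]

lemma IsFlatChart.hasFDerivAt_z_symm {e : OpenPartialHomeomorph (Hyp F U) Plane}
    (he : IsFlatChart e) {y : Plane} (hy : y ∈ e.target) :
    HasFDerivAt (fun y => (e.symm y).z) (mulForm ((e.symm y).z * (e.symm y).w)) y := by
  refine ((ContinuousLinearMap.fst ℝ ℂ ℂ).hasFDerivAt.comp y
    (he.hasFDerivAt_val_symm hy)).congr_fderiv ?_
  ext1 v
  simp only [mulForm_apply]
  simp [hypField, z, w]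

lemma IsFlatChart.hasFDerivAt_w_symm {e : OpenPartialHomeomorph (Hyp F U) Plane}
    (he : IsFlatChart e) {y : Plane} (hy : y ∈ e.target) :
    HasFDerivAt (fun y => (e.symm y).w) (mulForm ((e.symm y).z * deriv F (e.symm y).z / 2)) y := by
  refine ((ContinuousLinearMap.snd ℝ ℂ ℂ).hasFDerivAt.comp y
    (he.hasFDerivAt_val_symm hy)).congr_fderiv ?_
  ext1 v
  simp only [mulForm_apply]
  simp [hypField, z]

lemma IsFlatChart.contDiffOn_val_symm {e : OpenPartialHomeomorph (Hyp F U) Plane}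
    (he : IsFlatChart e) : ContDiffOn ℝ ∞ (fun y => (e.symm y).val) e.target := by
  have h1 : DifferentiableOn ℂ (fun ξ => (e.symm (planeIso ξ)).val) (planeIso ⁻¹' e.target) :=
    fun ζ hζ => (he.hasDerivAt_symm ζ hζ).differentiableAt.differentiableWithinAt
  have h2 : ContDiffOn ℂ ∞ (fun ξ => (e.symm (planeIso ξ)).val) (planeIso ⁻¹' e.target) :=
    h1.contDiffOn (e.open_target.preimage planeIso.continuous)
  have h3 := (h2.restrict_scalars ℝ).comp (s := e.target) planeIso.symm.contDiff.contDiffOn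
    (fun y hy => by simpa using hy)
  refine h3.congr fun y _ => ?_
  simp

lemma contMDiff_z [HypData F U] : ContMDiff (𝓡 2) 𝓘(ℝ, ℂ) ∞ (z : Hyp F U → ℂ) := by
  intro x
  rw [contMDiffAt_iff]
  refine ⟨continuous_z.continuousAt, ?_⟩
  simp only [mfld_simps, contDiffWithinAt_univ]
  have he := isFlatChart_chartAt x
  exact ((he.contDiffOn_val_symm.contDiffAt ((chartAt Plane x).open_target.mem_nhds
    (mem_chart_target Plane x)))).fst

lemma contMDiff_w [HypData F U] : ContMDiff (𝓡 2) 𝓘(ℝ, ℂ) ∞ (w : Hyp F U → ℂ) := by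
  intro x
  rw [contMDiffAt_iff]
  refine ⟨continuous_w.continuousAt, ?_⟩
  simp only [mfld_simps, contDiffWithinAt_univ]
  have he := isFlatChart_chartAt x
  exact ((he.contDiffOn_val_symm.contDiffAt ((chartAt Plane x).open_target.mem_nhds
    (mem_chart_target Plane x)))).snd

lemma hasMFDerivAt_z [HypData F U] (x : Hyp F U) :
    HasMFDerivAt (𝓡 2) 𝓘(ℝ, ℂ) (z : Hyp F U → ℂ) x (mulForm (x.z * x.w)) := by
  refine ⟨continuous_z.continuousAt, ?_⟩
  simp only [mfld_simps]
  have := (isFlatChart_chartAt x).hasFDerivAt_z_symm (mem_chart_target Plane x)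
  rw [(chartAt Plane x).left_inv (mem_chart_source Plane x)] at this
  exact this.hasFDerivWithinAt

lemma hasMFDerivAt_w [HypData F U] (x : Hyp F U) :
    HasMFDerivAt (𝓡 2) 𝓘(ℝ, ℂ) (w : Hyp F U → ℂ) x (mulForm (x.z * deriv F x.z / 2)) := by
  refine ⟨continuous_w.continuousAt, ?_⟩
  simp only [mfld_simps]
  have := (isFlatChart_chartAt x).hasFDerivAt_w_symm (mem_chart_target Plane x)
  rw [(chartAt Plane x).left_inv (mem_chart_source Plane x)] at this
  exact this.hasFDerivWithinAt

/-- A map into the curve is smooth if its coordinates are. -/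
lemma contMDiffWithinAt_of_val {E H N : Type*} [NormedAddCommGroup E] [NormedSpace ℝ E]
    [TopologicalSpace H] {I : ModelWithCorners ℝ E H} [TopologicalSpace N] [ChartedSpace H N]
    [HypData F U] {n : ℕ∞ω} (hn : n ≤ (∞ : ℕ∞ω)) {f : N → Hyp F U} {s : Set N} {a : N}
    (hz : ContMDiffWithinAt I 𝓘(ℝ, ℂ) n (fun t => (f t).z) s a)
    (hw : ContMDiffWithinAt I 𝓘(ℝ, ℂ) n (fun t => (f t).w) s a) :
    ContMDiffWithinAt I (𝓡 2) n f s a := by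
  have hc : ContinuousWithinAt f s a :=
    isEmbedding_val.isInducing.continuousWithinAt_iff.2 (hz.continuousWithinAt.prodMk
      hw.continuousWithinAt)
  rw [contMDiffWithinAt_iff_target]
  refine ⟨hc, ?_⟩
  obtain ⟨E, hE⟩ := (isFlatChart_chartAt (f a)).exists_extension
  have h1 := (hE _ (mem_chart_source Plane (f a))).2.1
  have h2 : ContMDiffWithinAt I 𝓘(ℝ, Plane) n (fun t => E ((f t).z, (f t).w)) s a := by
    have h3 : ContMDiffAt 𝓘(ℝ, ℂ × ℂ) 𝓘(ℝ, Plane) n E ((f a).z, (f a).w) :=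
      (h1.of_le hn).contMDiffAt
    exact ContMDiffAt.comp_contMDiffWithinAt (f := fun t => ((f t).z, (f t).w)) a h3
      (hz.prodMk_space hw)
  refine h2.congr_of_eventuallyEq ?_ ?_
  · have := hc.preimage_mem_nhdsWithin ((chartAt Plane (f a)).open_source.mem_nhds
      (mem_chart_source Plane (f a)))
    filter_upwards [this] with t ht
    exact (hE _ ht).1
  · exact (hE _ (mem_chart_source Plane (f a))).1

/-- The complex number representing a tangent vector in flat coordinates. -/
def flatCoord [HypData F U] {x : Hyp F U} (v : TangentSpace (𝓡 2) x) : ℂ := planeIso.symm v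

/-- The derivative of a map into the curve is determined by that of its coordinates. -/
lemma mfderivWithin_mul {E H N : Type*} [NormedAddCommGroup E] [NormedSpace ℝ E]
    [TopologicalSpace H] {I : ModelWithCorners ℝ E H} [TopologicalSpace N] [ChartedSpace H N]
    [HypData F U] {f : N → Hyp F U} {s : Set N} {a : N}
    (hf : MDifferentiableWithinAt I (𝓡 2) f s a) (hs : UniqueMDiffWithinAt I s a)
    (v : TangentSpace I a) :
    (mfderivWithin I 𝓘(ℝ, ℂ) (fun t => (f t).z) s a v : ℂ) =
      flatCoord (mfderivWithin I (𝓡 2) f s a v) * ((f a).z * (f a).w) := by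
  have h1 := (hasMFDerivAt_z (f a)).comp_hasMFDerivWithinAt a hf.hasMFDerivWithinAt
  have h2 : mfderivWithin I 𝓘(ℝ, ℂ) (fun t => (f t).z) s a = _ := h1.mfderivWithin hs
  rw [h2]
  exact mulForm_apply _ _

lemma mfderiv_symm [HypData F U] {e : OpenPartialHomeomorph (Hyp F U) Plane} (he : IsFlatChart e)
    {y : Plane} (hy : y ∈ e.target) :
    letI : ChartedSpace Plane Plane := chartedSpaceSelf Plane
    mfderiv (𝓡 2) (𝓡 2) e.symm y = ContinuousLinearMap.id ℝ Plane := by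
  let : ChartedSpace Plane Plane := chartedSpaceSelf Plane
  have h : HasMFDerivAt (𝓡 2) (𝓡 2) e.symm y (ContinuousLinearMap.id ℝ Plane) := by
    refine ⟨e.continuousAt_symm hy, ?_⟩
    have h1 := (hasFDerivAt_transition he (isFlatChart_chartAt (e.symm y)) hy
      (mem_chart_source Plane (e.symm y))).hasFDerivWithinAt (s := Set.univ)
    simp only [mfld_simps]
    exact h1
  exact h.mfderiv

lemma contMDiff_logMod [HypData F U] : ContMDiff (𝓡 2) 𝓘(ℝ, ℝ) ∞ (logMod : Hyp F U → ℝ) := by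
  intro x
  have h : ContDiffAt ℝ ∞ (fun z : ℂ => Real.log ‖z‖) x.z :=
    (contDiffAt_norm ℂ x.z_ne_zero).log (by simpa using x.z_ne_zero)
  exact h.contMDiffAt.comp x (contMDiff_z x)

lemma contMDiff_conf [HypData F U] : ContMDiff (𝓡 2) 𝓘(ℝ, ℝ) ∞ (conf : Hyp F U → ℝ) := by
  have h : ContDiff ℝ ∞ (fun t : ℝ => Real.exp (2 * U t)) :=
    Real.contDiff_exp.comp (contDiff_const.mul (HypData.contDiff F))
  exact h.contMDiff.comp contMDiff_logMod

lemma continuous_conf [HypData F U] : Continuous (conf : Hyp F U → ℝ) := contMDiff_conf.continuous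

/-- The scalar product of the Euclidean plane as a bilinear form. -/
def planeInner : Plane →L[ℝ] Plane →L[ℝ] ℝ := innerSL ℝ (E := Plane)

/-- A multiple of the scalar product of the Euclidean plane. -/
def scaledInner (c : ℝ) : Plane →L[ℝ] Plane →L[ℝ] ℝ := c • planeInner

lemma scaledInner_apply (c : ℝ) (v w : Plane) : scaledInner c v w = c * inner ℝ v w := rfl

lemma scaledInner_symm (c : ℝ) (v w : Plane) : scaledInner c v w = scaledInner c w v := by
  rw [scaledInner_apply, scaledInner_apply, real_inner_comm]

lemma scaledInner_pos {c : ℝ} (hc : 0 < c) (v : Plane) (hv : v ≠ 0) : 0 < scaledInner c v v :=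
  mul_pos hc (real_inner_self_pos.2 hv)

lemma isVonNBounded_scaledInner {c : ℝ} (hc : 0 < c) :
    Bornology.IsVonNBounded ℝ {v : Plane | scaledInner c v v < 1} := by
  refine (NormedSpace.isVonNBounded_ball ℝ Plane (1 / √c)).subset fun v hv => ?_
  have h0 : 0 < √c := Real.sqrt_pos.2 hc
  rw [Set.mem_ofPred_eq, scaledInner_apply, real_inner_self_eq_norm_sq] at hv
  rw [mem_ball_zero_iff, lt_div_iff₀ h0]
  refine lt_of_pow_lt_pow_left₀ 2 zero_le_one ?_
  rw [mul_pow, Real.sq_sqrt hc.le, mul_comm]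
  simpa using hv

/-- The scalar product on the tangent space at `x`. -/
def tangentInner (x : Hyp F U) [HypData F U] :
    TangentSpace (𝓡 2) x →L[ℝ] TangentSpace (𝓡 2) x →L[ℝ] ℝ := scaledInner x.conf

/-- The Riemannian metric `e^{2 U (log |z|)} |dz / (z w)|²`. -/
def riemannianMetric (F : ℂ → ℂ) (U : ℝ → ℝ) [HypData F U] :
    ContMDiffRiemannianMetric (𝓡 2) ∞ Plane (fun x : Hyp F U => TangentSpace (𝓡 2) x) where
  inner x := tangentInner x
  symm x v w := scaledInner_symm _ v w
  pos x v hv := scaledInner_pos x.conf_pos v hv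
  isVonNBounded x := isVonNBounded_scaledInner x.conf_pos
  contMDiff := by
    intro x
    rw [contMDiffAt_section]
    -- All coordinate changes are the identity, so in the trivialization the metric is literally the
    -- scalar `conf` times a constant form.
    have h : ContMDiffAt (𝓡 2) 𝓘(ℝ, Plane →L[ℝ] Plane →L[ℝ] ℝ) ∞
        (fun y : Hyp F U => y.conf • planeInner) x :=
      (contMDiff_conf x).smul contMDiffAt_const
    refine h.congr_of_eventuallyEq ?_
    filter_upwards [(chartAt Plane x).open_source.mem_nhds (mem_chart_source Plane x)] with y hy
    ext v w
    have h1 := TangentBundle.symmL_trivializationAt_eq_core (I := 𝓡 2) hy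
    have h2 := tangentCoordChange_eq x y hy (mem_chart_source Plane y)
    have hb : y ∈ (trivializationAt Plane (TangentSpace (𝓡 2)) x).baseSet := by simpa using hy
    have h3 : ∀ v : Plane, Bundle.Trivialization.symm (trivializationAt Plane
        (TangentSpace (𝓡 2) : Hyp F U → Type) x) y v = (v : TangentSpace (𝓡 2) y) := fun v =>
      (Bundle.Trivialization.symmL_apply (R := ℝ) _ hb v).symm.trans
        (congrArg (fun f : Plane →L[ℝ] Plane => f v) (h1.trans h2) :)
    rw [hom_trivializationAt_apply]
    refine (inCoordinates_apply_eq₂ (F₁ := Plane) (F₂ := Plane) (F₃ := ℝ)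
      (E₁ := TangentSpace (𝓡 2)) (E₂ := TangentSpace (𝓡 2)) (E₃ := fun _ : Hyp F U => ℝ)
      hb hb (Set.mem_univ _)).trans ?_
    rw [h3, h3]
    simp
    rfl

instance (F : ℂ → ℂ) (U : ℝ → ℝ) [HypData F U] :
    RiemannianBundle (fun x : Hyp F U => TangentSpace (𝓡 2) x) :=
  ⟨(riemannianMetric F U).toRiemannianMetric⟩

instance (F : ℂ → ℂ) (U : ℝ → ℝ) [HypData F U] :
    IsContMDiffRiemannianBundle (𝓡 2) ∞ Plane (fun x : Hyp F U => TangentSpace (𝓡 2) x) :=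
  inferInstance

instance (F : ℂ → ℂ) (U : ℝ → ℝ) [HypData F U] :
    IsContinuousRiemannianBundle Plane (fun x : Hyp F U => TangentSpace (𝓡 2) x) :=
  ⟨_, (riemannianMetric F U).toContinuousRiemannianMetric.continuous, fun _ _ _ => rfl⟩

lemma inner_tangent [HypData F U] (x : Hyp F U) (v w : TangentSpace (𝓡 2) x) :
    inner ℝ v w = scaledInner x.conf v w := rfl

lemma norm_tangent [HypData F U] (x : Hyp F U) (v : TangentSpace (𝓡 2) x) :
    ‖v‖ = Real.exp (U x.logMod) * ‖flatCoord v‖ := by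
  have h1 : ‖v‖ ^ 2 = scaledInner x.conf v v := by
    rw [← real_inner_self_eq_norm_sq, inner_tangent]
  have h2 : ∀ v : Plane, scaledInner x.conf v v =
      (Real.exp (U x.logMod) * ‖planeIso.symm v‖) ^ 2 := fun v => by
    rw [scaledInner_apply, real_inner_self_eq_norm_sq, mul_pow, LinearIsometryEquiv.norm_map, conf,
      two_mul, Real.exp_add, sq (Real.exp _)]
  exact (pow_left_inj₀ (norm_nonneg _) (by positivity) two_ne_zero).1 (h1.trans (h2 v))

end Hyp

end

/-! ### Connectedness of the curve -/

noncomputable section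

/-- Continuity at a single point suffices later, so no global branch is needed: off zero the
principal root is rotated so that its cut avoids the point, and at zero the principal root is
continuous anyway. -/
lemma exists_sqrt_continuousAt (w₀ : ℂ) :
    ∃ r : ℂ → ℂ, (∀ a, r a ^ 2 = a) ∧ r (w₀ ^ 2) = w₀ ∧ ContinuousAt r (w₀ ^ 2) := by
  by_cases h : w₀ = 0
  · refine ⟨fun a => a ^ ((2 : ℕ) : ℂ)⁻¹, fun a => Complex.cpow_nat_inv_pow a two_ne_zero,
      by simp [h], ?_⟩
    subst h
    have h1 := Complex.continuousAt_cpow_zero_of_re_pos (z := ((2 : ℕ) : ℂ)⁻¹) (by norm_num)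
    have h2 : ContinuousAt (fun a : ℂ => (a, ((2 : ℕ) : ℂ)⁻¹)) (0 ^ 2) := by fun_prop
    refine ContinuousAt.comp (g := fun x : ℂ × ℂ => x.1 ^ x.2) (f := fun a : ℂ =>
      (a, ((2 : ℕ) : ℂ)⁻¹)) ?_ h2
    simpa using h1
  · have h' : w₀ ^ 2 ≠ 0 := pow_ne_zero 2 h
    refine ⟨fun a => w₀ * (a / w₀ ^ 2) ^ ((2 : ℕ) : ℂ)⁻¹, fun a => ?_, ?_, ?_⟩
    · rw [mul_pow, Complex.cpow_nat_inv_pow _ two_ne_zero, mul_div_cancel₀ _ h']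
    · simp [div_self h']
    · refine continuousAt_const.mul ?_
      refine ContinuousAt.cpow (by fun_prop) continuousAt_const ?_
      simp [div_self h']

namespace Hyp
variable {F : ℂ → ℂ} {U : ℝ → ℝ}

lemma continuousOn_F [HypData F U] : ContinuousOn F {0}ᶜ :=
  (HypData.differentiableOn (F := F) U).continuousOn

/-- Through every point, branch points included, there is a section of `z` continuous at the image
of that point. -/
lemma isOpenMap_z [HypData F U] : IsOpenMap (z : Hyp F U → ℂ) := by
  classical
  rw [isOpenMap_iff_nhds_le]
  intro x
  obtain ⟨r, hr, hr1, hr2⟩ := exists_sqrt_continuousAt x.w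
  rw [w_sq] at hr1 hr2
  let s : ℂ → Hyp F U := fun ζ => if h : ζ ≠ 0 then mk ζ (r (F ζ)) h (hr _) else x
  have hs : s x.z = x := by
    simp only [s, dif_pos x.z_ne_zero]
    ext <;> simp [hr1]
  have hev : ∀ᶠ ζ in 𝓝 x.z, ζ ≠ 0 := isOpen_punctured.eventually_mem x.z_ne_zero
  have hF : ContinuousAt F x.z := (hasDerivAt_F (U := U) x.z_ne_zero).continuousAt
  have hsc : ContinuousAt s x.z := by
    rw [continuousAt_iff]
    refine ContinuousAt.congr (f := fun ζ => (ζ, r (F ζ))) ?_ ?_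
    · exact continuousAt_id.prodMk (ContinuousAt.comp (g := r) hr2 hF)
    · filter_upwards [hev] with ζ hζ
      simp only [s, dif_pos hζ, val_mk]
  have h1 : Tendsto s (𝓝 x.z) (𝓝 x) := by simpa [ContinuousAt, hs] using hsc
  have h2 : map (z ∘ s) (𝓝 x.z) = map id (𝓝 x.z) := by
    refine Filter.map_congr ?_
    filter_upwards [hev] with ζ hζ
    simp [s, hζ]
  rw [← map_map, map_id] at h2
  exact h2.symm.le.trans (map_mono h1)

/-- The coordinate `z` is proper as a map to the punctured plane. -/
lemma isCompact_preimage_z [HypData F U] {K : Set ℂ} (hK : IsCompact K) (h0 : K ⊆ {0}ᶜ) :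
    IsCompact (z ⁻¹' K : Set (Hyp F U)) := by
  rw [isEmbedding_val.isCompact_iff]
  have h1 : (val '' (z ⁻¹' K : Set (Hyp F U))) = {p : ℂ × ℂ | p.1 ∈ K ∧ p.2 ^ 2 - F p.1 = 0} := by
    ext p
    constructor
    · rintro ⟨x, hx, rfl⟩
      exact ⟨hx, sub_eq_zero.2 x.w_sq⟩
    · rintro ⟨h1, h2⟩
      exact ⟨mk p.1 p.2 (h0 h1) (sub_eq_zero.1 h2), h1, rfl⟩
  rw [h1]
  have hFK : ContinuousOn F K := (continuousOn_F (U := U)).mono h0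
  obtain ⟨C, hC⟩ := hK.exists_bound_of_continuousOn hFK
  have h2 : ContinuousOn (fun p : ℂ × ℂ => p.2 ^ 2 - F p.1)
      (K ×ˢ Metric.closedBall (0 : ℂ) (√C)) :=
    (continuous_snd.pow 2).continuousOn.sub
      (hFK.comp continuous_fst.continuousOn fun p hp => hp.1)
  have hKB : IsCompact (K ×ˢ Metric.closedBall (0 : ℂ) (√C)) := hK.prod (isCompact_closedBall _ _)
  have h3 := h2.preimage_isClosed_of_isClosed hKB.isClosed isClosed_singleton (t := {0})
  refine hKB.of_isClosed_subset (s := _) ?_ ?_ (t := {p : ℂ × ℂ | p.1 ∈ K ∧ p.2 ^ 2 - F p.1 = 0})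
  · convert h3 using 1
    ext p
    simp only [Set.mem_ofPred_eq, Set.mem_inter_iff, Set.mem_prod, Metric.mem_closedBall,
      dist_zero_right, Set.mem_preimage, Set.mem_singleton_iff]
    constructor
    · rintro ⟨h, h'⟩
      refine ⟨⟨h, ?_⟩, h'⟩
      refine Real.le_sqrt_of_sq_le ?_
      rw [← norm_pow, sub_eq_zero.1 h']
      exact hC _ h
    · rintro ⟨⟨h, -⟩, h'⟩; exact ⟨h, h'⟩
  · rintro p ⟨h, h'⟩
    refine ⟨h, ?_⟩
    rw [mem_closedBall_zero_iff]
    refine Real.le_sqrt_of_sq_le ?_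
    rw [← norm_pow, sub_eq_zero.1 h']
    exact hC _ h

/-- Since `z` is open and proper over the punctured plane, the image is open and closed there, and
the punctured plane is connected. -/
lemma image_z_eq_of_isClopen [HypData F U] {C : Set (Hyp F U)} (hC : IsClopen C)
    (hne : C.Nonempty) : z '' C = {0}ᶜ := by
  refine Set.Subset.antisymm ?_ ?_
  · rintro _ ⟨x, -, rfl⟩; exact x.z_ne_zero
  · have hconn : IsPreconnected ({0}ᶜ : Set ℂ) :=
      (isConnected_compl_singleton_of_one_lt_rank (by simp) 0).isPreconnected
    refine hconn.subset_of_closure_inter_subset (isOpenMap_z C hC.isOpen) ?_ ?_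
    · obtain ⟨x, hx⟩ := hne
      exact ⟨x.z, x.z_ne_zero, x, hx, rfl⟩
    · rintro ζ ⟨h1, h2⟩
      obtain ⟨r, hr, hr'⟩ := Metric.nhds_basis_closedBall.mem_iff.1 (isOpen_punctured.mem_nhds h2)
      have h3 : IsCompact (C ∩ z ⁻¹' (Metric.closedBall ζ r)) :=
        (isCompact_preimage_z (isCompact_closedBall ζ r) hr').inter_left hC.isClosed
      have h4 : IsClosed (z '' (C ∩ z ⁻¹' (Metric.closedBall ζ r))) :=
        (h3.image continuous_z).isClosed
      have h5 : ζ ∈ closure (z '' (C ∩ z ⁻¹' (Metric.closedBall ζ r))) := by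
        rw [Set.image_inter_preimage]
        rw [mem_closure_iff_nhds] at h1 ⊢
        intro t ht
        obtain ⟨y, hy, hy'⟩ := h1 _ (inter_mem ht (Metric.closedBall_mem_nhds ζ hr))
        exact ⟨y, hy.1, hy', hy.2⟩
      rw [h4.closure_eq] at h5
      exact Set.image_mono Set.inter_subset_left h5

/-- The fibre over a zero of `F` is a single point. Two complementary nonempty clopen sets would
both surject onto the punctured plane and hence both contain it. -/
instance [HypData F U] : ConnectedSpace (Hyp F U) := by
  obtain ⟨ζ, hζ, hF⟩ := HypData.exists_zero (F := F) U
  have : Nonempty (Hyp F U) := ⟨mk ζ 0 hζ (by simp [hF])⟩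
  have huniq : ∀ x : Hyp F U, x.z = ζ → x = mk ζ 0 hζ (by simp [hF]) := fun x hx => by
    ext
    · simpa using hx
    · have := w_sq x
      rw [hx, hF] at this
      simpa using this
  have : PreconnectedSpace (Hyp F U) := by
    rw [preconnectedSpace_iff_clopen]
    intro C hC
    by_contra! hne
    rw [Set.nonempty_iff_ne_empty.symm.symm] at hne
    have h1 := image_z_eq_of_isClopen hC (Set.nonempty_iff_ne_empty.2 hne.1)
    have h2 := image_z_eq_of_isClopen hC.compl (Set.nonempty_compl.2 hne.2)
    obtain ⟨x, hx, hx'⟩ := h1.symm ▸ (show ζ ∈ ({0}ᶜ : Set ℂ) from hζ)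
    obtain ⟨y, hy, hy'⟩ := h2.symm ▸ (show ζ ∈ ({0}ᶜ : Set ℂ) from hζ)
    rw [huniq x hx'] at hx
    rw [huniq y hy'] at hy
    exact hy hx
  exact ⟨‹_›⟩

end Hyp

end

/-! ### The Riemannian distance and gradient estimates -/

noncomputable section

namespace Hyp
variable {F : ℂ → ℂ} {U : ℝ → ℝ}

/-- The Riemannian distance, as an extended metric. -/
abbrev emetric (F : ℂ → ℂ) (U : ℝ → ℝ) [HypData F U] : EMetricSpace (Hyp F U) :=
  EMetricSpace.ofRiemannianMetric (𝓡 2) (Hyp F U)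

/-- The points at finite distance from a given one form a clopen set, and the curve is connected. -/
lemma emetric_edist_ne_top [HypData F U] (x y : Hyp F U) : (emetric F U).edist x y ≠ ⊤ := by
  let : EMetricSpace (Hyp F U) := emetric F U
  have h1 : IsClopen (Metric.eball x ⊤) := ⟨Metric.isClosed_eball_top, Metric.isOpen_eball⟩
  have h2 : Metric.eball x ⊤ = Set.univ := h1.eq_univ ⟨x, Metric.mem_eball_self (by simp)⟩
  have h3 : y ∈ Metric.eball x ⊤ := h2 ▸ Set.mem_univ y
  rw [Metric.mem_eball'] at h3
  exact h3.ne

instance [HypData F U] : MetricSpace (Hyp F U) :=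
  letI : EMetricSpace (Hyp F U) := emetric F U
  EMetricSpace.toMetricSpace emetric_edist_ne_top

lemma edist_eq [HypData F U] (x y : Hyp F U) : edist x y = riemannianEDist (𝓡 2) x y := rfl

instance [HypData F U] : IsRiemannianManifold (𝓡 2) (Hyp F U) := ⟨fun _ _ => rfl⟩


lemma derivWithin_z [HypData F U] {γ : ℝ → Hyp F U} {a b s : ℝ} (hab : a < b)
    (hγ : ContMDiffOn 𝓘(ℝ, ℝ) (𝓡 2) 1 γ (Set.Icc a b)) (hs : s ∈ Set.Icc a b) :
    derivWithin (fun s => (γ s).z) (Set.Icc a b) s =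
      flatCoord (mfderivWithin 𝓘(ℝ, ℝ) (𝓡 2) γ (Set.Icc a b) s 1) * ((γ s).z * (γ s).w) := by
  rw [← mfderivWithin_mul ((hγ.mdifferentiableOn one_ne_zero) s hs)
    (uniqueMDiffWithinAt_iff_uniqueDiffWithinAt.2 (uniqueDiffOn_Icc hab s hs)),
    mfderivWithin_eq_fderivWithin]
  rfl

lemma derivWithin_w [HypData F U] {γ : ℝ → Hyp F U} {a b s : ℝ} (hab : a < b)
    (hγ : ContMDiffOn 𝓘(ℝ, ℝ) (𝓡 2) 1 γ (Set.Icc a b)) (hs : s ∈ Set.Icc a b) :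
    derivWithin (fun s => (γ s).w) (Set.Icc a b) s =
      flatCoord (mfderivWithin 𝓘(ℝ, ℝ) (𝓡 2) γ (Set.Icc a b) s 1) *
        ((γ s).z * deriv F (γ s).z / 2) := by
  have hu := uniqueMDiffWithinAt_iff_uniqueDiffWithinAt.2 (uniqueDiffOn_Icc hab s hs)
  have h1 := (hasMFDerivAt_w (γ s)).comp_hasMFDerivWithinAt s
    ((hγ.mdifferentiableOn one_ne_zero) s hs).hasMFDerivWithinAt
  have h2 : mfderivWithin 𝓘(ℝ, ℝ) 𝓘(ℝ, ℂ) (fun s => (γ s).w) (Set.Icc a b) s = _ :=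
    h1.mfderivWithin hu
  have h3 : derivWithin (fun s => (γ s).w) (Set.Icc a b) s =
      mfderivWithin 𝓘(ℝ, ℝ) 𝓘(ℝ, ℂ) (fun s => (γ s).w) (Set.Icc a b) s 1 := by
    rw [mfderivWithin_eq_fderivWithin]
    rfl
  rw [h3, h2]
  exact mulForm_apply _ _

lemma contDiffOn_z [HypData F U] {γ : ℝ → Hyp F U} {S : Set ℝ}
    (hγ : ContMDiffOn 𝓘(ℝ, ℝ) (𝓡 2) 1 γ S) : ContDiffOn ℝ 1 (fun s => (γ s).z) S := by
  rw [← contMDiffOn_iff_contDiffOn]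
  exact (contMDiff_z.of_le (by simp)).comp_contMDiffOn hγ

lemma contDiffOn_w [HypData F U] {γ : ℝ → Hyp F U} {S : Set ℝ}
    (hγ : ContMDiffOn 𝓘(ℝ, ℝ) (𝓡 2) 1 γ S) : ContDiffOn ℝ 1 (fun s => (γ s).w) S := by
  rw [← contMDiffOn_iff_contDiffOn]
  exact (contMDiff_w.of_le (by simp)).comp_contMDiffOn hγ

lemma enorm_tangent [HypData F U] (x : Hyp F U) (v : TangentSpace (𝓡 2) x) :
    ‖v‖ₑ = ENNReal.ofReal (Real.exp (U x.logMod) * ‖flatCoord v‖) := by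
  rw [← ofReal_norm, norm_tangent]


lemma exists_path_length_le [HypData F U] (x y : Hyp F U) {ε : ℝ} (hε : 0 < ε) :
    ∃ γ : ℝ → Hyp F U, γ 0 = x ∧ γ 1 = y ∧ ContMDiffOn 𝓘(ℝ, ℝ) (𝓡 2) 1 γ (Set.Icc 0 1) ∧
      ∫⁻ s in Set.Icc (0 : ℝ) 1, ‖mfderivWithin 𝓘(ℝ, ℝ) (𝓡 2) γ (Set.Icc 0 1) s 1‖ₑ ≤
        ENNReal.ofReal (dist x y + ε) := by
  have h : riemannianEDist (𝓡 2) x y < ENNReal.ofReal (dist x y + ε) := by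
    rw [← edist_eq, edist_dist]
    exact (ENNReal.ofReal_lt_ofReal_iff (by positivity)).2 (by linarith)
  obtain ⟨γ, h0, h1, hγ, hl⟩ := exists_lt_of_riemannianEDist_lt h
  rw [pathELength_eq_lintegral_mfderivWithin_Icc] at hl
  exact ⟨γ, h0, h1, hγ, hl.le⟩

lemma le_mul_of_forall_le_mul_add {a C d : ℝ} (h : ∀ ε > 0, a ≤ C * (d + ε)) : a ≤ C * d := by
  have h1 : Tendsto (fun ε => C * (d + ε)) (𝓝[>] 0) (𝓝 (C * (d + 0))) :=
    ((by fun_prop : Continuous fun ε => C * (d + ε)).tendsto 0).mono_left nhdsWithin_le_nhds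
  rw [add_zero] at h1
  exact ge_of_tendsto h1 (eventually_mem_nhdsWithin.mono h)

/-- A function of the modulus whose gradient is bounded by `C` is `C`-Lipschitz. -/
lemma abs_sub_le_mul_dist [HypData F U] {f : ℝ → ℝ} {C : ℝ} (hC : 0 ≤ C) (hf : ContDiff ℝ 1 f)
    (h : ∀ x : Hyp F U, |deriv f x.logMod| * ‖x.w‖ ≤ C * Real.exp (U x.logMod)) (x y : Hyp F U) :
    |f y.logMod - f x.logMod| ≤ C * dist x y := by
  refine le_mul_of_forall_le_mul_add fun ε hε => ?_
  obtain ⟨γ, h0, h1, hγ, hl⟩ := exists_path_length_le x y hε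
  have hz := contDiffOn_z hγ
  have hl0 : ContDiffOn ℝ 1 (fun s => (γ s).logMod) (Set.Icc 0 1) := fun s hs =>
    ((hz s hs).norm ℂ (γ s).z_ne_zero).log (by simpa using (γ s).z_ne_zero)
  have hu : ContDiffOn ℝ 1 (fun s => f (γ s).logMod) (Set.Icc 0 1) := hf.comp_contDiffOn hl0
  have h2 := enorm_sub_le_lintegral_derivWithin_Icc_of_contDiffOn_Icc hu zero_le_one
  rw [h0, h1] at h2
  have h3 : ∫⁻ s in Set.Icc (0 : ℝ) 1, ‖derivWithin (fun s => f (γ s).logMod) (Set.Icc 0 1) s‖ₑ ≤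
      ∫⁻ s in Set.Icc (0 : ℝ) 1, ENNReal.ofReal C *
        ‖mfderivWithin 𝓘(ℝ, ℝ) (𝓡 2) γ (Set.Icc 0 1) s 1‖ₑ := by
    refine setLIntegral_mono' measurableSet_Icc fun s hs => ?_
    have hz1 := ((hz.differentiableOn one_ne_zero) s hs).hasDerivWithinAt
    have hne : ‖(γ s).z‖ ^ 2 ≠ 0 := by simpa using (γ s).z_ne_zero
    have hd := (hz1.norm_sq.log hne).div_const 2
    have hd' := ((hf.differentiable one_ne_zero) (γ s).logMod).hasDerivAt
    have heq : ∀ s, (γ s).logMod = Real.log (‖(γ s).z‖ ^ 2) / 2 := fun s => by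
      rw [Real.log_pow, logMod]; push_cast; ring
    have hd2 := hd'.comp_hasDerivWithinAt s (hd.congr_of_mem (fun s _ => heq s) hs)
    have hd3 : derivWithin (fun s => f (γ s).logMod) (Set.Icc 0 1) s = _ :=
      hd2.derivWithin (uniqueDiffOn_Icc zero_lt_one s hs)
    rw [hd3, enorm_tangent, ← ENNReal.ofReal_mul hC, ← ofReal_norm]
    refine ENNReal.ofReal_le_ofReal ?_
    rw [derivWithin_z zero_lt_one hγ hs]
    generalize flatCoord (mfderivWithin 𝓘(ℝ, ℝ) (𝓡 2) γ (Set.Icc 0 1) s 1) = c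
    have hzp : 0 < ‖(γ s).z‖ := norm_pos_iff.2 (γ s).z_ne_zero
    -- With flat velocity `c` one has z'/z = c w, so log|z| changes at rate at most ‖c‖‖w‖, while
    -- the Riemannian speed is e^U ‖c‖.
    have h4 : ‖2 * inner ℝ (γ s).z (c * ((γ s).z * (γ s).w)) / ‖(γ s).z‖ ^ 2 / 2‖ ≤
        ‖c‖ * ‖(γ s).w‖ := by
      have h5 := norm_inner_le_norm (𝕜 := ℝ) (γ s).z (c * ((γ s).z * (γ s).w))
      rw [norm_mul, norm_mul] at h5
      rw [norm_div, norm_div, norm_mul]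
      simp only [norm_pow, norm_norm, Real.norm_ofNat]
      rw [div_div, div_le_iff₀ (by positivity)]
      linarith
    rw [norm_mul]
    calc _ ≤ ‖deriv f (γ s).logMod‖ * (‖c‖ * ‖(γ s).w‖) := by gcongr
      _ = |deriv f (γ s).logMod| * ‖(γ s).w‖ * ‖c‖ := by rw [Real.norm_eq_abs]; ring
      _ ≤ C * Real.exp (U (γ s).logMod) * ‖c‖ :=
        mul_le_mul_of_nonneg_right (h _) (norm_nonneg _)
      _ = _ := by ring
  have h6 := h2.trans h3
  rw [lintegral_const_mul' _ _ ENNReal.ofReal_ne_top] at h6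
  have h7 := h6.trans (mul_le_mul_right hl _)
  rw [← ENNReal.ofReal_mul hC, ← ofReal_norm, Real.norm_eq_abs] at h7
  exact (ENNReal.ofReal_le_ofReal_iff (by positivity)).1 h7

/-- The scaling `(z, w) ↦ (a z, b z w)`, for a holomorphic function `b` without zeros, stretches
distances by at most a constant factor if it does so with the metric. -/
lemma dist_le_mul_dist [HypData F U] {a : ℂ} {b : ℂ → ℂ} {C : ℝ} (hC : 0 ≤ C) (ha : a ≠ 0)
    (hb : DifferentiableOn ℂ b {0}ᶜ) (hb0 : ∀ z ≠ 0, b z ≠ 0)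
    (hF : ∀ z ≠ 0, F (a * z) = b z ^ 2 * F z) {σ : Hyp F U → Hyp F U}
    (hσz : ∀ x, (σ x).z = a * x.z) (hσw : ∀ x, (σ x).w = b x.z * x.w)
    (h : ∀ x : Hyp F U, Real.exp (U (σ x).logMod) ≤ C * ‖b x.z‖ * Real.exp (U x.logMod))
    (x y : Hyp F U) : dist (σ x) (σ y) ≤ C * dist x y := by
  refine le_mul_of_forall_le_mul_add fun ε hε => ?_
  obtain ⟨γ, h0, h1, hγ, hl⟩ := exists_path_length_le x y hε
  have hz := contDiffOn_z hγ
  have hw := contDiffOn_w hγ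
  have hbd : ContDiffOn ℝ 1 b {0}ᶜ := fun z hz =>
    ((hb.contDiffOn isOpen_punctured).contDiffAt (isOpen_punctured.mem_nhds hz)).restrict_scalars ℝ
      |>.contDiffWithinAt
  have hσγ : ContMDiffOn 𝓘(ℝ, ℝ) (𝓡 2) 1 (fun s => σ (γ s)) (Set.Icc 0 1) := fun s hs => by
    refine contMDiffWithinAt_of_val (by simp) ?_ ?_
    · simp only [hσz]
      exact (contDiffWithinAt_const.mul (hz s hs)).contMDiffWithinAt
    · simp only [hσw]
      refine (ContDiffWithinAt.mul ?_ (hw s hs)).contMDiffWithinAt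
      exact (hbd.contDiffAt (isOpen_punctured.mem_nhds (γ s).z_ne_zero)).comp_contDiffWithinAt s
        (hz s hs)
  have h2 := riemannianEDist_le_pathELength hσγ rfl rfl zero_le_one
  rw [← edist_eq, h0, h1, pathELength_eq_lintegral_mfderivWithin_Icc] at h2
  have h3 : ∫⁻ s in Set.Icc (0 : ℝ) 1,
        ‖mfderivWithin 𝓘(ℝ, ℝ) (𝓡 2) (fun s => σ (γ s)) (Set.Icc 0 1) s 1‖ₑ ≤
      ∫⁻ s in Set.Icc (0 : ℝ) 1, ENNReal.ofReal C *
        ‖mfderivWithin 𝓘(ℝ, ℝ) (𝓡 2) γ (Set.Icc 0 1) s 1‖ₑ := by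
    refine setLIntegral_mono' measurableSet_Icc fun s hs => ?_
    rw [enorm_tangent, enorm_tangent, ← ENNReal.ofReal_mul hC]
    refine ENNReal.ofReal_le_ofReal ?_
    have hu := uniqueDiffOn_Icc (zero_lt_one (α := ℝ)) s hs
    have hz1 := ((hz.differentiableOn one_ne_zero) s hs).hasDerivWithinAt
    have hw1 := ((hw.differentiableOn one_ne_zero) s hs).hasDerivWithinAt
    have e1 := derivWithin_z zero_lt_one hγ hs
    have e2 := derivWithin_w zero_lt_one hγ hs
    have e3 := derivWithin_z zero_lt_one hσγ hs
    have e4 := derivWithin_w zero_lt_one hσγ hs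
    have hb1 := (hb.differentiableAt (isOpen_punctured.mem_nhds (γ s).z_ne_zero)).hasDerivAt
    have e5 := (hz1.const_mul a).derivWithin hu
    have e6 := ((hb1.comp_hasDerivWithinAt s hz1).mul hw1).derivWithin hu
    simp only [hσz, hσw] at e3 e4
    rw [e5, e1] at e3
    have e7 : derivWithin (fun s => b (γ s).z * (γ s).w) (Set.Icc 0 1) s = _ := e6
    rw [e7, e1, e2] at e4
    have hF1 : a * deriv F (a * (γ s).z) = 2 * b (γ s).z * deriv b (γ s).z * F (γ s).z +
        b (γ s).z ^ 2 * deriv F (γ s).z := by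
      have hz0 := (γ s).z_ne_zero
      have k1 : HasDerivAt (fun z => F (a * z)) (deriv F (a * (γ s).z) * (a * 1)) (γ s).z :=
        (hasDerivAt_F (U := U) (mul_ne_zero ha hz0)).comp _ ((hasDerivAt_id _).const_mul a)
      have k2 := ((hb1.pow 2).mul (hasDerivAt_F (F := F) (U := U) hz0))
      have k3 := k1.unique (k2.congr_of_eventuallyEq
        (by filter_upwards [isOpen_punctured.mem_nhds hz0] with z hz using hF z hz))
      simp only [Pi.pow_apply] at k3
      linear_combination k3
    -- The form dz/(zw) pulls back under the scaling to itself divided by `b`. Away from branch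
    -- points this is read off from dz; where w = 0 that equation is void, and dw together with the
    -- differentiated functional equation `hF1` decides.
    have key : flatCoord (mfderivWithin 𝓘(ℝ, ℝ) (𝓡 2) γ (Set.Icc 0 1) s 1) =
        flatCoord (mfderivWithin 𝓘(ℝ, ℝ) (𝓡 2) (fun s => σ (γ s)) (Set.Icc 0 1) s 1) *
          b (γ s).z := by
      generalize flatCoord (mfderivWithin 𝓘(ℝ, ℝ) (𝓡 2) γ (Set.Icc 0 1) s 1) = c at *
      generalize flatCoord (mfderivWithin 𝓘(ℝ, ℝ) (𝓡 2) (fun s => σ (γ s)) (Set.Icc 0 1) s 1) = c'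
        at *
      have hz0 := (γ s).z_ne_zero
      by_cases hw0 : (γ s).w = 0
      · have hF0 : F (γ s).z = 0 := by rw [← w_sq (γ s), hw0]; ring
        have hne := HypData.deriv_ne_zero (F := F) U _ hz0 hF0
        have hbz := hb0 _ hz0
        rw [hw0] at e4
        simp only [Function.comp_apply] at e4
        rw [hF0] at hF1
        have : (b (γ s).z * (γ s).z * deriv F (γ s).z) * (c - c' * b (γ s).z) = 0 := by
          linear_combination 2 * e4 + c' * (γ s).z * hF1
        have h8 := (mul_eq_zero.1 this).resolve_left (by positivity)
        exact sub_eq_zero.1 h8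
      · have : (a * (γ s).z * (γ s).w) * (c - c' * b (γ s).z) = 0 := by
          linear_combination e3
        have h8 := (mul_eq_zero.1 this).resolve_left (by positivity)
        exact sub_eq_zero.1 h8
    rw [key, norm_mul]
    have := h (γ s)
    calc _ ≤ C * ‖b (γ s).z‖ * Real.exp (U (γ s).logMod) * _ := by gcongr
      _ = _ := by ring
  have h6 := h2.trans h3
  rw [lintegral_const_mul' _ _ ENNReal.ofReal_ne_top] at h6
  have h7 := h6.trans (mul_le_mul_right hl _)
  rw [← ENNReal.ofReal_mul hC, edist_dist] at h7
  exact (ENNReal.ofReal_le_ofReal_iff (by positivity)).1 h7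

end Hyp

end

/-! ### Lifted paths and properness -/

noncomputable section

namespace Hyp
variable {F : ℂ → ℂ} {U : ℝ → ℝ}

/-- Continuous differentiable square roots along paths. -/
lemma exists_sqrt_path {h h' : ℝ → ℂ} {w₀ : ℂ} (hh : ∀ s ∈ Set.Icc (0 : ℝ) 1, HasDerivAt h (h' s) s)
    (hc : ContinuousOn h' (Set.Icc 0 1)) (h0 : ∀ s ∈ Set.Icc (0 : ℝ) 1, h s ≠ 0)
    (hw : w₀ ^ 2 = h 0) :
    ∃ W : ℝ → ℂ, W 0 = w₀ ∧ ContDiff ℝ 1 W ∧ ∀ s ∈ Set.Icc (0 : ℝ) 1, W s ^ 2 = h s := by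
  have hhc : ContinuousOn h (Set.Icc 0 1) := fun s hs => (hh s hs).continuousAt.continuousWithinAt
  have hq : ContinuousOn (fun s => h' s / h s) (Set.Icc 0 1) := hc.div hhc h0
  -- The root is w₀ exp(½ ∫ h'/h). Extending the integrand by constants beyond the interval makes it
  -- C¹ on the whole line.
  set k : ℝ → ℂ := Set.IccExtend zero_le_one (fun s : Set.Icc (0 : ℝ) 1 => h' s / h s) with hk
  have hkc : Continuous k := (continuousOn_iff_continuous_domRestrict.1 hq).Icc_extend'
  have hks : ∀ s ∈ Set.Icc (0 : ℝ) 1, k s = h' s / h s := fun s hs => by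
    rw [hk, Set.IccExtend_of_mem _ _ hs]
  set I : ℝ → ℂ := fun s => ∫ u in (0 : ℝ)..s, k u
  have hI : ∀ s, HasDerivAt I (k s) s := fun s =>
    intervalIntegral.integral_hasDerivAt_right (hkc.intervalIntegrable _ _)
      (hkc.stronglyMeasurableAtFilter _ _) hkc.continuousAt
  have hI0 : I 0 = 0 := by simp [I]
  have hW : ∀ s, HasDerivAt (fun s => w₀ * Complex.exp (I s / 2))
      (w₀ * (Complex.exp (I s / 2) * (k s / 2))) s := fun s =>
    (((hI s).div_const 2).cexp).const_mul w₀
  refine ⟨fun s => w₀ * Complex.exp (I s / 2), by simp [hI0], ?_, ?_⟩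
  · have hIc : ContDiff ℝ 1 I := by
      refine contDiff_one_iff_deriv.2 ⟨fun s => (hI s).differentiableAt, ?_⟩
      rwa [show deriv I = k from funext fun s => (hI s).deriv]
    exact contDiff_const.mul (hIc.div_const 2).cexp
  · have hcst : ∀ s ∈ Set.Icc (0 : ℝ) 1,
        (w₀ * Complex.exp (I s / 2)) ^ 2 / h s = (w₀ * Complex.exp (I 0 / 2)) ^ 2 / h 0 := by
      refine constant_of_has_deriv_right_zero (f := fun s => (w₀ * Complex.exp (I s / 2)) ^ 2 / h s)
        ?_ ?_
      · exact fun s hs => (((hW s).continuousAt.pow 2).div (hh s hs).continuousAt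
          (h0 s hs)).continuousWithinAt
      · intro s hs
        have hs' := Set.Ico_subset_Icc_self hs
        have h1 := ((hW s).pow 2).div (hh s hs') (h0 s hs')
        refine (h1.congr_deriv ?_).hasDerivWithinAt
        have := h0 s hs'
        simp only [Pi.pow_apply, hks s hs']
        field_simp
        ring
    intro s hs
    have h1 := hcst s hs
    have h2 : (w₀ * Complex.exp (I 0 / 2)) ^ 2 / h 0 = 1 := by
      rw [hI0]
      simp only [zero_div, Complex.exp_zero, mul_one, hw]
      exact div_self (h0 0 (by simp))
    rw [h2, div_eq_one_iff_eq (h0 s hs)] at h1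
    exact h1

/-- The density of the metric with respect to the logarithmic metric `|dz / z|`. -/
def dens (F : ℂ → ℂ) (U : ℝ → ℝ) (z : ℂ) : ℝ := Real.exp (U (Real.log ‖z‖)) / √‖F z‖

/-- An upper bound for distances: lifts of paths that are straight in the coordinate `log z`. -/
lemma exists_dist_le [HypData F U] (x : Hyp F U) {c d : ℂ} (hc : Complex.exp c = x.z)
    (hF : ∀ s ∈ Set.Icc (0 : ℝ) 1, F (Complex.exp (c + s * d)) ≠ 0) {g G : ℝ → ℝ}
    (hG : ∀ s, HasDerivAt G (g s) s) (hgc : Continuous g)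
    (hg : ∀ s ∈ Set.Icc (0 : ℝ) 1, dens F U (Complex.exp (c + s * d)) * ‖d‖ ≤ g s) :
    ∃ y : Hyp F U, y.z = Complex.exp (c + d) ∧ dist x y ≤ G 1 - G 0 := by
  set zz : ℝ → ℂ := fun s => Complex.exp (c + s * d)
  have hzz : ∀ s, HasDerivAt zz (zz s * d) s := fun s => by
    have h1 : HasDerivAt (fun s : ℝ => c + (s : ℂ) * d) (1 * d) s :=
      ((Complex.ofRealCLM.hasDerivAt (x := s)).mul_const d).const_add c
    rw [one_mul] at h1
    exact h1.cexp
  have hz0 : ∀ s, zz s ≠ 0 := fun s => Complex.exp_ne_zero _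
  have hzc : ContDiff ℝ ∞ zz := by
    have : ContDiff ℝ ∞ (fun s : ℝ => (s : ℂ)) := Complex.ofRealCLM.contDiff
    exact (contDiff_const.add (this.mul contDiff_const)).cexp
  have hh : ∀ s, HasDerivAt (fun s => F (zz s)) (deriv F (zz s) * (zz s * d)) s := fun s =>
    (hasDerivAt_F (F := F) (U := U) (hz0 s)).comp s (hzz s)
  have hhc : Continuous fun s => deriv F (zz s) * (zz s * d) := by
    have h1 : Continuous fun s => deriv F (zz s) :=
      (differentiableOn_deriv_F (U := U)).continuousOn.comp_continuous hzc.continuous hz0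
    exact h1.mul (hzc.continuous.mul continuous_const)
  obtain ⟨W, hW0, hWc, hW⟩ := exists_sqrt_path (w₀ := x.w) (fun s _ => hh s) hhc.continuousOn hF
    (by simp [zz, hc, w_sq])
  -- The parameter is clamped to the unit interval, since outside it `W` need not be a root of `F`
  -- along the path.
  let γ : ℝ → Hyp F U := fun s =>
    mk (zz (Set.projIcc 0 1 zero_le_one s)) (W (Set.projIcc 0 1 zero_le_one s)) (hz0 _)
      (hW _ (Subtype.prop _))
  have hγz : ∀ s ∈ Set.Icc (0 : ℝ) 1, (γ s).z = zz s := fun s hs => by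
    simp [γ, Set.projIcc_of_mem zero_le_one hs]
  have hγw : ∀ s ∈ Set.Icc (0 : ℝ) 1, (γ s).w = W s := fun s hs => by
    simp [γ, Set.projIcc_of_mem zero_le_one hs]
  have hγ : ContMDiffOn 𝓘(ℝ, ℝ) (𝓡 2) 1 γ (Set.Icc 0 1) := fun s hs => by
    refine contMDiffWithinAt_of_val (by simp) ?_ ?_
    · refine ContDiffWithinAt.contMDiffWithinAt ?_
      exact (((hzc.of_le (by simp)).contDiffWithinAt (s := Set.Icc 0 1)).congr hγz (hγz s hs))
    · refine ContDiffWithinAt.contMDiffWithinAt ?_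
      exact ((hWc.contDiffWithinAt (s := Set.Icc 0 1)).congr hγw (hγw s hs))
  have hx : γ 0 = x := Hyp.ext (by rw [hγz 0 (by simp)]; simp [zz, hc])
    (by rw [hγw 0 (by simp), hW0])
  refine ⟨γ 1, by rw [hγz 1 (by simp)]; simp [zz], ?_⟩
  have h2 := riemannianEDist_le_pathELength hγ hx rfl zero_le_one
  rw [← edist_eq, pathELength_eq_lintegral_mfderivWithin_Icc] at h2
  have hg0 : ∀ s ∈ Set.Icc (0 : ℝ) 1, 0 ≤ g s := fun s hs =>
    le_trans (by unfold dens; positivity) (hg s hs)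
  have h3 : ∫⁻ s in Set.Icc (0 : ℝ) 1, ‖mfderivWithin 𝓘(ℝ, ℝ) (𝓡 2) γ (Set.Icc 0 1) s 1‖ₑ ≤
      ∫⁻ s in Set.Icc (0 : ℝ) 1, ENNReal.ofReal (g s) := by
    refine setLIntegral_mono' measurableSet_Icc fun s hs => ?_
    rw [enorm_tangent]
    refine ENNReal.ofReal_le_ofReal (le_trans (le_of_eq ?_) (hg s hs))
    have e1 := derivWithin_z zero_lt_one hγ hs
    have e2 : derivWithin (fun s => (γ s).z) (Set.Icc 0 1) s = zz s * d :=
      (((hzz s).hasDerivWithinAt).congr hγz (hγz s hs)).derivWithin (uniqueDiffOn_Icc zero_lt_one s hs)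
    rw [e2, hγz s hs] at e1
    have hnw : ‖(γ s).w‖ ^ 2 = ‖F (zz s)‖ := by rw [← norm_pow, w_sq, hγz s hs]
    have hnw' : √‖F (zz s)‖ = ‖(γ s).w‖ := by rw [← hnw, Real.sqrt_sq (norm_nonneg _)]
    have hw0 : ‖(γ s).w‖ ≠ 0 := by
      intro h
      rw [h] at hnw
      exact hF s hs (norm_eq_zero.1 (by rw [← hnw]; ring))
    have e3 : d = flatCoord (mfderivWithin 𝓘(ℝ, ℝ) (𝓡 2) γ (Set.Icc 0 1) s 1) * (γ s).w :=
      mul_left_cancel₀ (hz0 s) (by rw [e1]; ring)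
    have e4 := congrArg norm e3
    rw [norm_mul] at e4
    rw [e4]
    change _ = dens F U (zz s) * _
    rw [dens, hnw', logMod, hγz s hs]
    field_simp
  have h4 : ∫⁻ s in Set.Icc (0 : ℝ) 1, ENNReal.ofReal (g s) = ENNReal.ofReal (G 1 - G 0) := by
    rw [← ofReal_integral_eq_lintegral_ofReal (hgc.continuousOn.integrableOn_Icc)
      ((ae_restrict_iff' measurableSet_Icc).2 (Eventually.of_forall hg0)),
      integral_Icc_eq_integral_Ioc, ← intervalIntegral.integral_of_le zero_le_one,
      intervalIntegral.integral_eq_sub_of_hasDerivAt (fun s _ => hG s) (hgc.intervalIntegrable _ _)]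
  have h5 := h2.trans (h3.trans_eq h4)
  have h6 : 0 ≤ G 1 - G 0 := by
    rw [← intervalIntegral.integral_eq_sub_of_hasDerivAt (fun s _ => hG s)
      (hgc.intervalIntegrable _ _)]
    exact intervalIntegral.integral_nonneg zero_le_one hg0
  rw [edist_dist] at h5
  exact (ENNReal.ofReal_le_ofReal_iff h6).1 h5

lemma isCompact_logMod_le [HypData F U] (T : ℝ) : IsCompact {x : Hyp F U | |x.logMod| ≤ T} := by
  have hK : IsCompact (Metric.closedBall (0 : ℂ) (Real.exp T) ∩ {z | Real.exp (-T) ≤ ‖z‖}) :=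
    (isCompact_closedBall _ _).inter_right (isClosed_le continuous_const continuous_norm)
  have h0 : Metric.closedBall (0 : ℂ) (Real.exp T) ∩ {z | Real.exp (-T) ≤ ‖z‖} ⊆ {0}ᶜ := by
    rintro z ⟨-, hz⟩ (rfl : z = 0)
    rw [Set.mem_ofPred_eq, norm_zero] at hz
    exact (Real.exp_pos _).not_ge hz
  convert! isCompact_preimage_z (F := F) (U := U) hK h0 using 1
  ext x
  have hx : 0 < ‖x.z‖ := norm_pos_iff.2 x.z_ne_zero
  simp only [Set.mem_ofPred_eq, Set.mem_preimage, Set.mem_inter_iff, mem_closedBall_zero_iff, abs_le,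
    logMod, Real.le_log_iff_exp_le hx, Real.log_le_iff_le_exp hx]
  tauto

/-- A metric with at most exponential decay is proper. -/
lemma properSpace_of_le [HypData F U] {C : ℝ} (hC : 0 ≤ C)
    (h : ∀ x : Hyp F U, Real.cosh x.logMod * ‖x.w‖ ≤ C * Real.exp (U x.logMod)) :
    ProperSpace (Hyp F U) := by
  refine ⟨fun p r => ?_⟩
  refine (isCompact_logMod_le (|Real.sinh p.logMod| + C * r)).of_isClosed_subset
    Metric.isClosed_closedBall fun x hx => ?_
  -- The hypothesis says that sinh(log|z|) is `C`-Lipschitz, so a ball has bounded log|z| and lies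
  -- in a compact set.
  have h1 := abs_sub_le_mul_dist hC Real.contDiff_sinh
    (fun x : Hyp F U => by rw [Real.deriv_sinh, abs_of_pos (Real.cosh_pos _)]; exact h x) p x
  rw [Metric.mem_closedBall'] at hx
  have h2 : |Real.sinh x.logMod| ≤ |Real.sinh p.logMod| + C * r := by
    have h3 := abs_sub_abs_le_abs_sub (Real.sinh x.logMod) (Real.sinh p.logMod)
    have : C * dist p x ≤ C * r := by gcongr
    linarith
  refine le_trans ?_ h2
  rw [Real.abs_sinh]
  exact Real.self_le_sinh_iff.2 (abs_nonneg _)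

end Hyp

end

/-! ### The Gaussian curvature -/

noncomputable section

namespace Hyp
variable {F : ℂ → ℂ} {U : ℝ → ℝ}

lemma coordMetric_eq [HypData F U] {e : OpenPartialHomeomorph (Hyp F U) Plane} (he : IsFlatChart e)
    {y : Plane} (hy : y ∈ e.target) :
    coordMetric (Hyp F U) e y = Real.exp (2 * U (e.symm y).logMod) • 1 := by
  ext i j
  simp only [coordMetric, Matrix.of_apply, mfderiv_symm he hy, inner_tangent]
  change scaledInner _ (planeBasis i) (planeBasis j) = _
  rw [scaledInner_apply, planeBasis, planeBasis, EuclideanSpace.inner_single_left, conf]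
  simp [Matrix.one_apply]

lemma partialDeriv_congr {f g : Plane → ℝ} {y : Plane} (h : f =ᶠ[𝓝 y] g) (i : Fin 2) :
    partialDeriv i f y = partialDeriv i g y := by
  rw [partialDeriv, partialDeriv, h.fderiv_eq]

lemma christoffel_conformal {G : Plane → Matrix (Fin 2) (Fin 2) ℝ} {φ : Plane → ℝ} {y : Plane}
    (hG : ∀ᶠ x in 𝓝 y, G x = Real.exp (2 * φ x) • 1) (hφ : DifferentiableAt ℝ φ y)
    (k i j : Fin 2) :
    christoffel G k i j y = (if j = k then partialDeriv i φ y else 0) +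
      (if i = k then partialDeriv j φ y else 0) - (if i = j then partialDeriv k φ y else 0) := by
  have h1 : ∀ i j l, partialDeriv i (fun x => G x j l) y =
      if j = l then 2 * Real.exp (2 * φ y) * partialDeriv i φ y else 0 := by
    intro i j l
    have h2 : (fun x => G x j l) =ᶠ[𝓝 y] fun x => if j = l then Real.exp (2 * φ x) else 0 := by
      filter_upwards [hG] with x hx
      rw [hx]
      simp [Matrix.one_apply]
    rw [partialDeriv_congr h2]
    split_ifs with h
    · have h3 := (hφ.hasFDerivAt.const_mul 2).exp.fderiv
      rw [partialDeriv, h3]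
      simp [partialDeriv]
      ring
    · simp [partialDeriv]
  have h4 : (G y)⁻¹ = (Real.exp (2 * φ y))⁻¹ • 1 := by
    rw [hG.self_of_nhds]
    refine Matrix.inv_eq_left_inv ?_
    simp [smul_smul, (Real.exp_pos _).ne']
  have hne := (Real.exp_pos (2 * φ y)).ne'
  simp only [christoffel, h1, h4]
  fin_cases k <;> fin_cases i <;> fin_cases j <;>
    simp [Matrix.one_apply] <;> field_simp

/-- In dimension two the terms quadratic in the Christoffel symbols of a conformal metric cancel,
and only the Laplacian of φ remains. -/
lemma coordCurvature_conformal {G : Plane → Matrix (Fin 2) (Fin 2) ℝ} {φ : Plane → ℝ} {y : Plane}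
    (hG : ∀ᶠ x in 𝓝 y, G x = Real.exp (2 * φ x) • 1)
    (hφ : ∀ᶠ x in 𝓝 y, DifferentiableAt ℝ φ x) :
    coordCurvature G y = -Real.exp (-(2 * φ y)) *
      (partialDeriv 0 (partialDeriv 0 φ) y + partialDeriv 1 (partialDeriv 1 φ) y) := by
  have h1 : ∀ k i j, christoffel G k i j =ᶠ[𝓝 y] fun x => (if j = k then partialDeriv i φ x else 0) +
      (if i = k then partialDeriv j φ x else 0) - (if i = j then partialDeriv k φ x else 0) := by
    intro k i j
    filter_upwards [hG.eventually_nhds, hφ] with x hx hx' using christoffel_conformal hx hx' k i j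
  have h2 : riemannTensor G 0 0 1 1 y =
      -(partialDeriv 0 (partialDeriv 0 φ) y + partialDeriv 1 (partialDeriv 1 φ) y) := by
    have h3 : partialDeriv 0 (christoffel G 0 1 1) y = -partialDeriv 0 (partialDeriv 0 φ) y := by
      rw [partialDeriv_congr (h1 0 1 1)]
      simp only [partialDeriv, fderiv_fun_neg, one_ne_zero, if_false, if_true, add_zero, zero_sub,
        Fin.isValue, neg_apply]
      rfl
    have h4 : partialDeriv 1 (christoffel G 0 0 1) y = partialDeriv 1 (partialDeriv 1 φ) y := by
      rw [partialDeriv_congr (h1 0 0 1)]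
      simp
    rw [riemannTensor, h3, h4]
    simp only [(h1 _ _ _).self_of_nhds, Fin.sum_univ_two]
    simp
    ring
  have hG0 := hG.self_of_nhds
  have hE : Real.exp (-(2 * φ y)) = (Real.exp (2 * φ y))⁻¹ := Real.exp_neg _
  have hne := (Real.exp_pos (2 * φ y)).ne'
  rw [coordCurvature, hG0, Fin.sum_univ_two, h2, hE]
  simp
  field_simp
  ring

/-- Near y the quotient Z / Z(y) is close to 1, so log‖Z‖ is, up to a constant, the real part of its
principal logarithm. -/
lemma hasFDerivAt_log_norm {E : Type*} [NormedAddCommGroup E] [NormedSpace ℝ E] {Z : E → ℂ}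
    {Z' : E →L[ℝ] ℂ} {y : E} (h : HasFDerivAt Z Z' y) (h0 : Z y ≠ 0) :
    HasFDerivAt (fun x => Real.log ‖Z x‖) (Complex.reCLM ∘L ((Z y)⁻¹ • Z')) y := by
  have h1 : HasFDerivAt (fun x => Complex.log (Z x * (Z y)⁻¹)) ((Z y)⁻¹ • Z') y := by
    have h2 : Z y * (Z y)⁻¹ = 1 := mul_inv_cancel₀ h0
    have h3 := ((Complex.hasDerivAt_log (z := Z y * (Z y)⁻¹)
      (by rw [h2]; exact Complex.one_mem_slitPlane)).hasFDerivAt.restrictScalars ℝ).comp y (h.mul_const (Z y)⁻¹)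
    refine h3.congr_fderiv ?_
    ext v
    simp [h2]
  have h2 := (Complex.reCLM.hasFDerivAt.comp y h1).add_const (Real.log ‖Z y‖)
  refine h2.congr_of_eventuallyEq ?_
  filter_upwards [h.continuousAt.eventually_ne h0] with x hx
  simp only [Function.comp_apply, Complex.reCLM_apply, Complex.log_re, norm_mul, norm_inv]
  rw [Real.log_mul (by simpa using hx) (by simpa using h0), Real.log_inv]
  ring

lemma planeIso_symm_basis_zero : planeIso.symm (planeBasis 0) = 1 := by
  rw [LinearIsometryEquiv.symm_apply_eq]
  ext i
  fin_cases i <;> simp [planeIso, planeBasis]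

lemma planeIso_symm_basis_one : planeIso.symm (planeBasis 1) = Complex.I := by
  rw [LinearIsometryEquiv.symm_apply_eq]
  ext i
  fin_cases i <;> simp [planeIso, planeBasis]

/-- The Gaussian curvature of the metric `e^{2 U (log |z|)} |dz / (z w)|²`. -/
lemma gaussCurvature_eq [HypData F U] (x : Hyp F U) :
    gaussCurvature (Hyp F U) x =
      -Real.exp (-(2 * U x.logMod)) * (deriv (deriv U) x.logMod * ‖x.w‖ ^ 2) := by
  set e := chartAt Plane x
  have he : IsFlatChart e := isFlatChart_chartAt x
  have hx : e.symm (e x) = x := e.left_inv (mem_chart_source Plane x)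
  have hy : e x ∈ e.target := mem_chart_target Plane x
  have hnhds := e.open_target.mem_nhds hy
  have hU : ContDiff ℝ ∞ U := HypData.contDiff F
  have hU1 : ∀ t, HasDerivAt U (deriv U t) t := fun t =>
    (hU.differentiable (by simp)).differentiableAt.hasDerivAt
  have hU2 : ∀ t, HasDerivAt (deriv U) (deriv (deriv U) t) t := fun t =>
    ((contDiff_infty_iff_deriv.1 hU).2.differentiable (by simp)).differentiableAt.hasDerivAt
  have ht : ∀ y ∈ e.target, HasFDerivAt (fun y => (e.symm y).logMod)
      (Complex.reCLM ∘L mulForm (e.symm y).w) y := fun y hy => by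
    have h1 := hasFDerivAt_log_norm (he.hasFDerivAt_z_symm hy) (e.symm y).z_ne_zero
    refine h1.congr_fderiv ?_
    ext v
    have := (e.symm y).z_ne_zero
    simp only [ContinuousLinearMap.comp_apply, smul_apply, mulForm_apply,
      smul_eq_mul]
    congr 1
    field_simp
  have hφ : ∀ y ∈ e.target, HasFDerivAt (fun y => U (e.symm y).logMod)
      (deriv U (e.symm y).logMod • (Complex.reCLM ∘L mulForm (e.symm y).w)) y := fun y hy =>
    (hU1 _).comp_hasFDerivAt y (ht y hy)
  have hp : ∀ i, partialDeriv i (fun y => U (e.symm y).logMod) =ᶠ[𝓝 (e x)] fun y =>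
      deriv U (e.symm y).logMod * (planeIso.symm (planeBasis i) * (e.symm y).w).re := fun i => by
    filter_upwards [hnhds] with y hy
    rw [partialDeriv, (hφ y hy).fderiv]
    simp [mulForm_apply]
  -- Used for c = 1 and c = i. As 1² + i² = 0, the terms with U' cancel in the sum (log|z| is
  -- harmonic), and Re(w)² + Re(iw)² = ‖w‖² is left as the factor of U''.
  have hp2 : ∀ c : ℂ, HasFDerivAt (fun y => deriv U (e.symm y).logMod * (c * (e.symm y).w).re)
      (deriv U x.logMod • (Complex.reCLM ∘L (c • mulForm (x.z * deriv F x.z / 2))) +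
        (c * x.w).re • (deriv (deriv U) x.logMod • (Complex.reCLM ∘L mulForm x.w))) (e x) := by
    intro c
    have h1 := (hU2 _).comp_hasFDerivAt (e x) (ht _ hy)
    have h2 := Complex.reCLM.hasFDerivAt.comp (e x) ((he.hasFDerivAt_w_symm hy).const_mul c)
    have h3 := h1.mul h2
    simp only [Function.comp_apply, hx] at h3
    exact h3
  rw [gaussCurvature, coordCurvature_conformal (φ := fun y => U (e.symm y).logMod)]
  · rw [partialDeriv_congr (hp 0), partialDeriv_congr (hp 1), partialDeriv, partialDeriv,
      (hp2 _).fderiv, (hp2 _).fderiv, planeIso_symm_basis_zero, planeIso_symm_basis_one, hx,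
      ← Complex.normSq_eq_norm_sq, Complex.normSq_apply]
    simp only [add_apply, smul_apply,
      ContinuousLinearMap.comp_apply, mulForm_apply, planeIso_symm_basis_zero,
      planeIso_symm_basis_one, Complex.reCLM_apply, smul_eq_mul, Complex.mul_re, Complex.mul_im,
      Complex.I_re, Complex.I_im, Complex.one_re, Complex.one_im]
    ring
  · filter_upwards [hnhds] with y hy using coordMetric_eq he hy
  · filter_upwards [hnhds] with y hy using (hφ y hy).differentiableAt

end Hyp

end

/-! ### The area measure as a sum over two sheets -/

noncomputable section

namespace Hyp
variable {F : ℂ → ℂ} {U : ℝ → ℝ}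

instance : MeasurableSpace (Hyp F U) :=
  inferInstanceAs (MeasurableSpace {p : ℂ × ℂ // p.1 ≠ 0 ∧ p.2 ^ 2 = F p.1})

instance : BorelSpace (Hyp F U) :=
  inferInstanceAs (BorelSpace {p : ℂ × ℂ // p.1 ≠ 0 ∧ p.2 ^ 2 = F p.1})

/-- The principal square root of `F`. -/
def rootF (F : ℂ → ℂ) (z : ℂ) : ℂ := F z ^ ((2 : ℕ) : ℂ)⁻¹

lemma rootF_sq (z : ℂ) : rootF F z ^ 2 = F z := Complex.cpow_nat_inv_pow _ two_ne_zero

/-- A section of the projection to the `z`-plane; its value at `0` is irrelevant. -/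
def sheet (F : ℂ → ℂ) (U : ℝ → ℝ) (δ : ℤˣ) (z : ℂ) : Hyp F U :=
  if h : z = 0 then mk 1 ((δ : ℤ) * rootF F 1) one_ne_zero
      (by rw [mul_pow, rootF_sq]; obtain rfl | rfl := Int.units_eq_one_or δ <;> simp)
    else mk z ((δ : ℤ) * rootF F z) h
      (by rw [mul_pow, rootF_sq]; obtain rfl | rfl := Int.units_eq_one_or δ <;> simp)

lemma sheet_of_ne {δ : ℤˣ} {z : ℂ} (h : z ≠ 0) :
    (sheet F U δ z).z = z ∧ (sheet F U δ z).w = (δ : ℤ) * rootF F z := by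
  rw [sheet, dif_neg h]
  exact ⟨rfl, rfl⟩

lemma eq_sheet (x : Hyp F U) : ∃ δ : ℤˣ, x = sheet F U δ x.z := by
  have h : x.w ^ 2 = rootF F x.z ^ 2 := by rw [w_sq, rootF_sq]
  obtain h | h := sq_eq_sq_iff_eq_or_eq_neg.1 h
  · exact ⟨1, Hyp.ext (sheet_of_ne x.z_ne_zero).1.symm
      (by rw [(sheet_of_ne x.z_ne_zero).2, h]; simp)⟩
  · exact ⟨-1, Hyp.ext (sheet_of_ne x.z_ne_zero).1.symm
      (by rw [(sheet_of_ne x.z_ne_zero).2, h]; simp)⟩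

lemma measurable_sheet [HypData F U] (δ : ℤˣ) : Measurable (sheet F U δ) := by
  have h1 : Measurable fun z : ℂ => if z = 0 then (1 : ℂ) else z :=
    Measurable.ite (measurableSet_singleton 0) measurable_const measurable_id
  have h2 : Measurable fun z : ℂ => if z = 0 then F 1 else F z := by
    have := ContinuousOn.measurable_piecewise (s := {0}ᶜ) (continuousOn_F (F := F) (U := U))
      (continuousOn_const (c := F 1)) (measurableSet_singleton (0 : ℂ)).compl
    convert! this using 1
    ext z
    by_cases hz : z = 0 <;> simp [Set.piecewise, hz]
  have h3 : Measurable fun z : ℂ => ((δ : ℤ) : ℂ) * (if z = 0 then F 1 else F z) ^ ((2 : ℕ) : ℂ)⁻¹ :=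
    measurable_const.mul (h2.pow_const _)
  have h4 : Measurable fun z => (sheet F U δ z).val := by
    convert! h1.prodMk h3 using 1
    ext1 z
    by_cases hz : z = 0 <;> simp [sheet, hz, rootF]
  exact h4.subtype_mk

/-- The density of the area of one sheet in the `z`-plane. -/
def sheetDensity (F : ℂ → ℂ) (U : ℝ → ℝ) (z : ℂ) : ℝ≥0∞ := ENNReal.ofReal (dens F U z ^ 2 / ‖z‖ ^ 2)

/-- The area measure. -/
def area (F : ℂ → ℂ) (U : ℝ → ℝ) : Measure (Hyp F U) :=
  ∑ δ : ℤˣ, (volume.withDensity (sheetDensity F U)).map (sheet F U δ)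

lemma area_apply [HypData F U] {A : Set (Hyp F U)} (hA : MeasurableSet A) :
    area F U A = ∑ δ : ℤˣ, ∫⁻ z in sheet F U δ ⁻¹' A, sheetDensity F U z := by
  rw [area, Measure.coe_finsetSum, Finset.sum_apply]
  refine Finset.sum_congr rfl fun δ _ => ?_
  rw [Measure.map_apply (measurable_sheet δ) hA, withDensity_apply _ (measurable_sheet δ hA)]

/-- Simple zeros are isolated, and a discrete subset of the plane is countable. -/
lemma countable_zeros [HypData F U] : {z : ℂ | z ≠ 0 ∧ F z = 0}.Countable := by
  refine IsLindelof.countable (HereditarilyLindelofSpace.isLindelof _) ?_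
  refine discreteTopology_subtype_iff.2 fun z hz => ?_
  have h := (hasDerivAt_F (F := F) (U := U) hz.1).eventually_ne (c := 0) (HypData.deriv_ne_zero U z hz.1 hz.2)
  rw [Filter.inf_principal_eq_bot]
  filter_upwards [h] with u hu hu' using hu hu'.2

lemma det_mul (c : ℂ) :
    (((ContinuousLinearMap.toSpanSingleton ℂ c).restrictScalars ℝ : ℂ →L[ℝ] ℂ)).det = ‖c‖ ^ 2 := by
  rw [← Complex.normSq_eq_norm_sq, ← Algebra.norm_complex_apply, Algebra.norm_apply]
  refine congrArg LinearMap.det ?_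
  ext x
  all_goals simp [mul_comm]

lemma sqrt_det_coordMetric [HypData F U] {e : OpenPartialHomeomorph (Hyp F U) Plane}
    (he : IsFlatChart e) {y : Plane} (hy : y ∈ e.target) :
    √(coordMetric (Hyp F U) e y).det = (e.symm y).conf := by
  rw [coordMetric_eq he hy, Matrix.det_smul, Matrix.det_one, mul_one, Fintype.card_fin,
    Real.sqrt_sq (Real.exp_pos _).le, conf]

lemma measurableSet_image_chart {e : OpenPartialHomeomorph (Hyp F U) Plane} {A : Set (Hyp F U)}
    (hA : MeasurableSet A) (h : A ⊆ e.source) : MeasurableSet (e '' A) := by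
  rw [e.image_eq_target_inter_inv_preimage h]
  have h1 : Measurable (e.target.domRestrict e.symm) :=
    (continuousOn_iff_continuous_domRestrict.1 e.continuousOn_symm).measurable
  convert! (MeasurableEmbedding.subtype_coe e.open_target.measurableSet).measurableSet_image.2
    (h1 hA) using 1
  ext y
  simp [and_comm]

lemma volume_image_zeros [HypData F U] {e : OpenPartialHomeomorph (Hyp F U) Plane} {A : Set (Hyp F U)}
    (hA : ∀ x ∈ A, x.w = 0) : volume (e '' A) = 0 := by
  refine Set.Countable.measure_zero (Set.Countable.image ?_ _) _
  refine Set.MapsTo.countable_of_injOn (f := z) (t := {z : ℂ | z ≠ 0 ∧ F z = 0}) ?_ ?_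
    (countable_zeros (U := U))
  · exact fun x hx => ⟨x.z_ne_zero, by rw [← w_sq x, hA x hx]; ring⟩
  · exact fun x hx y hy h => Hyp.ext h ((hA x hx).trans (hA y hy).symm)

/-- The points of the sheet `δ` away from the branch points. -/
def sheetSet (F : ℂ → ℂ) (U : ℝ → ℝ) (δ : ℤˣ) : Set (Hyp F U) :=
  {x | x.w ≠ 0 ∧ sheet F U δ x.z = x}

lemma measurableSet_sheetSet [HypData F U] (δ : ℤˣ) : MeasurableSet (sheetSet F U δ) :=
  (measurableSet_eq_fun continuous_w.measurable measurable_const).compl.inter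
    (measurableSet_eq_fun ((measurable_sheet δ).comp continuous_z.measurable) measurable_id)

/-- The area of a part of one sheet, in a flat chart. -/
lemma lintegral_sheet_eq [HypData F U] {e : OpenPartialHomeomorph (Hyp F U) Plane}
    (he : IsFlatChart e) {A : Set (Hyp F U)} (hA : MeasurableSet A) (h : A ⊆ e.source) (δ : ℤˣ) :
    ∫⁻ z in sheet F U δ ⁻¹' A, sheetDensity F U z =
      ∫⁻ y in e '' (A ∩ sheetSet F U δ), ENNReal.ofReal (e.symm y).conf := by
  set B := A ∩ sheetSet F U δ
  have hB : MeasurableSet B := hA.inter (measurableSet_sheetSet δ)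
  have hBe : B ⊆ e.source := Set.inter_subset_left.trans h
  -- The sheets are discontinuous and meet at branch points; only the countable set of zeros of `F`
  -- and the origin must be discarded.
  have h1 : sheet F U δ ⁻¹' A =ᵐ[volume] (z '' B : Set ℂ) := by
    have hN : volume (insert 0 {z : ℂ | z ≠ 0 ∧ F z = 0}) = 0 :=
      ((countable_zeros (U := U)).insert 0).measure_zero _
    filter_upwards [measure_eq_zero_iff_ae_notMem.1 hN] with u hu
    rw [Set.mem_insert_iff, not_or] at hu
    have hFu : F u ≠ 0 := fun hF => hu.2 ⟨hu.1, hF⟩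
    obtain ⟨e1, e2⟩ := sheet_of_ne (F := F) (U := U) (δ := δ) hu.1
    refine propext ⟨fun hx => ⟨sheet F U δ u, ⟨hx, ?_, by rw [e1]⟩, e1⟩, ?_⟩
    · intro h0
      have := w_sq (sheet F U δ u)
      rw [h0, e1] at this
      exact hFu (by rw [← this]; ring)
    · rintro ⟨x, ⟨hxA, -, hx⟩, rfl⟩
      change sheet F U δ x.z ∈ A
      rwa [hx]
  rw [setLIntegral_congr h1]
  set S : Set ℂ := planeIso ⁻¹' (e '' B)
  have hS : MeasurableSet S := planeIso.continuous.measurable (measurableSet_image_chart hB hBe)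
  have hSe : ∀ ζ ∈ S, planeIso ζ ∈ e.target ∧ e.symm (planeIso ζ) ∈ B := by
    rintro ζ ⟨x, hx, hxζ⟩
    rw [← hxζ, e.left_inv (hBe hx)]
    exact ⟨e.map_source (hBe hx), hx⟩
  have h2 : (z '' B : Set ℂ) = (fun ζ => (e.symm (planeIso ζ)).z) '' S := by
    ext u
    constructor
    · rintro ⟨x, hx, rfl⟩
      refine ⟨planeIso.symm (e x), ⟨x, hx, by simp⟩, ?_⟩
      simp [e.left_inv (hBe hx)]
    · rintro ⟨ζ, hζ, rfl⟩
      exact ⟨_, (hSe ζ hζ).2, rfl⟩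
  have h3 : Set.InjOn (fun ζ => (e.symm (planeIso ζ)).z) S := by
    intro ζ hζ ξ hξ hz
    have k1 := (hSe ζ hζ).2.2.2
    have k2 := (hSe ξ hξ).2.2.2
    have k3 : e.symm (planeIso ζ) = e.symm (planeIso ξ) := by
      rw [← k1, ← k2]
      exact congrArg _ hz
    exact planeIso.injective (e.symm.injOn (hSe ζ hζ).1 (hSe ξ hξ).1 k3)
  have h4 : ∀ ζ ∈ S, HasFDerivWithinAt (fun ζ => (e.symm (planeIso ζ)).z)
      ((ContinuousLinearMap.toSpanSingleton ℂ
        ((e.symm (planeIso ζ)).z * (e.symm (planeIso ζ)).w)).restrictScalars ℝ) S ζ := fun ζ hζ => by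
    have := (hasFDerivAt_fst (𝕜 := ℂ) (p := (e.symm (planeIso ζ)).val)).comp_hasDerivAt ζ
      (he.hasDerivAt_symm ζ (hSe ζ hζ).1)
    exact (this.hasFDerivAt.restrictScalars ℝ).hasFDerivWithinAt
  -- The Jacobian of ζ ↦ z is |zw|²; against the density e^{2U}/(|F||z|²), with |F| = |w|², it
  -- leaves e^{2U}, the area density in the flat chart.
  rw [h2, lintegral_image_eq_lintegral_abs_det_fderiv_mul volume hS h4 h3]
  have h5 : ∫⁻ y in e '' B, ENNReal.ofReal (e.symm y).conf =
      ∫⁻ ζ in S, ENNReal.ofReal (e.symm (planeIso ζ)).conf :=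
    ((planeIso.measurePreserving).setLIntegral_comp_preimage_emb
      planeIso.toHomeomorph.measurableEmbedding (fun y => ENNReal.ofReal (e.symm y).conf) _).symm
  rw [h5]
  refine setLIntegral_congr_fun hS fun ζ hζ => ?_
  have hw := (hSe ζ hζ).2.2.1
  rw [det_mul, sheetDensity, ← ENNReal.ofReal_mul (abs_nonneg _)]
  congr 1
  have hz0 := norm_ne_zero_iff.2 (e.symm (planeIso ζ)).z_ne_zero
  have hw0 := norm_ne_zero_iff.2 hw
  rw [dens, ← w_sq (e.symm (planeIso ζ)), norm_pow, Real.sqrt_sq (norm_nonneg _), conf, logMod, two_mul, Real.exp_add,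
    abs_of_nonneg (by positivity), norm_mul]
  field_simp

/-- The area measure is the Riemannian volume. -/
lemma isRiemannianVolume_area [HypData F U] : IsRiemannianVolume (Hyp F U) (area F U) := by
  intro e he A hA h
  have he : IsFlatChart e := isFlatChart_of_mem_atlas he
  have hm := measurableSet_image_chart hA h
  have h0 : ∫⁻ y in e '' A, ENNReal.ofReal √(coordMetric (Hyp F U) e y).det =
      ∫⁻ y in e '' A, ENNReal.ofReal (e.symm y).conf := by
    refine setLIntegral_congr_fun hm fun y hy => ?_
    obtain ⟨x, hx, rfl⟩ := hy
    rw [sqrt_det_coordMetric he (e.map_source (h hx))]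
  have hmeas : ∀ δ, MeasurableSet (e '' (A ∩ sheetSet F U δ)) := fun δ =>
    measurableSet_image_chart (hA.inter (measurableSet_sheetSet δ)) (Set.inter_subset_left.trans h)
  -- Branch points form a null set, and every other point lies on exactly one sheet.
  have h1 : (e '' A : Set Plane) =ᵐ[volume] (⋃ δ : ℤˣ, e '' (A ∩ sheetSet F U δ) : Set Plane) := by
    have hN : volume (e '' (A ∩ {x | x.w = 0})) = 0 := volume_image_zeros fun x hx => hx.2
    filter_upwards [measure_eq_zero_iff_ae_notMem.1 hN] with y hy
    refine propext ⟨?_, fun hy => ?_⟩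
    · rintro ⟨x, hx, rfl⟩
      obtain ⟨δ, hδ⟩ := eq_sheet x
      exact Set.mem_iUnion.2 ⟨δ, x, ⟨hx, fun h0 => hy ⟨x, ⟨hx, h0⟩, rfl⟩, hδ.symm⟩, rfl⟩
    · obtain ⟨δ, x, hx, rfl⟩ := Set.mem_iUnion.1 hy
      exact ⟨x, hx.1, rfl⟩
  have h2 : Pairwise (Function.onFun Disjoint fun δ : ℤˣ => e '' (A ∩ sheetSet F U δ)) := by
    intro δ δ' hne
    refine Set.disjoint_left.2 ?_
    rintro _ ⟨x, hx, rfl⟩ ⟨x', hx', hxx⟩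
    obtain rfl := e.injOn (h hx'.1) (h hx.1) hxx
    apply hne
    have k1 := congrArg w hx.2.2
    have k2 := congrArg w hx'.2.2
    rw [(sheet_of_ne x'.z_ne_zero).2] at k1 k2
    have hr : rootF F x'.z ≠ 0 := fun h0 => hx.2.1 (by rw [← k1, h0, mul_zero])
    have := mul_right_cancel₀ hr (k1.trans k2.symm)
    exact Units.ext (by exact_mod_cast this)
  rw [h0, setLIntegral_congr h1, lintegral_iUnion hmeas h2, tsum_fintype, area_apply hA]
  exact Finset.sum_congr rfl fun δ _ => lintegral_sheet_eq he hA h δ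

end Hyp

end

/-! ### Local finiteness and positivity of the area; its behaviour under scalings -/

noncomputable section

namespace Hyp
variable {F : ℂ → ℂ} {U : ℝ → ℝ}

lemma area_eq_lintegral_chartAt [HypData F U] (x : Hyp F U) {A : Set (Hyp F U)}
    (hA : MeasurableSet A) (h : A ⊆ (chartAt Plane x).source) :
    area F U A = ∫⁻ y in chartAt Plane x '' A, ENNReal.ofReal ((chartAt Plane x).symm y).conf := by
  rw [isRiemannianVolume_area _ (chart_mem_atlas Plane x) A hA h]
  refine setLIntegral_congr_fun (measurableSet_image_chart hA h) fun y hy => ?_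
  obtain ⟨a, ha, rfl⟩ := hy
  rw [sqrt_det_coordMetric (isFlatChart_chartAt x) ((chartAt Plane x).map_source (h ha))]

instance [HypData F U] : (area F U).IsOpenPosMeasure := by
  refine ⟨fun O hO ⟨x, hx⟩ h0 => ?_⟩
  set e := chartAt Plane x
  have hO' : IsOpen (O ∩ e.source) := hO.inter e.open_source
  have h1 := area_eq_lintegral_chartAt x hO'.measurableSet Set.inter_subset_right
  rw [measure_mono_null Set.inter_subset_left h0] at h1
  have hi : IsOpen (e '' (O ∩ e.source)) :=
    e.isOpen_image_of_subset_source hO' Set.inter_subset_right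
  have hpos : 0 < volume (e '' (O ∩ e.source)) :=
    hi.measure_pos volume ⟨e x, x, ⟨hx, mem_chart_source Plane x⟩, rfl⟩
  have hc : ContinuousOn (fun y => ENNReal.ofReal (e.symm y).conf) (e '' (O ∩ e.source)) := by
    refine ENNReal.continuous_ofReal.comp_continuousOn (continuous_conf.comp_continuousOn
      (e.continuousOn_symm.mono ?_))
    rintro _ ⟨a, ha, rfl⟩
    exact e.map_source ha.2
  have h2 := (lintegral_eq_zero_iff' (hc.aemeasurable hi.measurableSet)).1 h1.symm
  have h3 : ∀ᵐ y ∂(volume.restrict (e '' (O ∩ e.source))), False := by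
    filter_upwards [h2] with y hy
    exact (ENNReal.ofReal_pos.2 (e.symm y).conf_pos).ne' hy
  rw [ae_iff] at h3
  simp only [not_false_eq_true, Set.ofPred_true, Measure.restrict_apply_univ] at h3
  exact hpos.ne' h3

instance [HypData F U] : IsLocallyFiniteMeasure (area F U) := by
  refine ⟨fun x => ?_⟩
  set e := chartAt Plane x
  have hx := mem_chart_source Plane x
  have hO : IsOpen (e.source ∩ {y | y.conf < x.conf + 1} ∩ (e.source ∩ e ⁻¹' Metric.ball (e x) 1)) :=
    (e.open_source.inter (isOpen_lt continuous_conf continuous_const)).inter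
      (e.isOpen_inter_preimage Metric.isOpen_ball)
  refine ⟨_, hO.mem_nhds ⟨⟨hx, by simp⟩, hx, Metric.mem_ball_self one_pos⟩, ?_⟩
  rw [area_eq_lintegral_chartAt x hO.measurableSet (fun y hy => hy.1.1)]
  refine (setLIntegral_mono' (measurableSet_image_chart hO.measurableSet fun y hy => hy.1.1)
    (g := fun _ => ENNReal.ofReal (x.conf + 1)) ?_).trans_lt ?_
  · rintro _ ⟨a, ha, rfl⟩
    rw [e.left_inv ha.1.1]
    exact ENNReal.ofReal_le_ofReal ha.1.2.le
  · rw [setLIntegral_const]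
    refine ENNReal.mul_lt_top ENNReal.ofReal_lt_top ((measure_mono ?_).trans_lt
      (Metric.isBounded_ball (x := e x) (r := 1)).measure_lt_top)
    rintro _ ⟨a, ha, rfl⟩
    exact ha.2.2

lemma measurable_sheetDensity [HypData F U] : Measurable (sheetDensity F U) := by
  have h2 : Measurable fun z : ℂ => ‖F z‖ := by
    have hF : Measurable F := by
      have := ContinuousOn.measurable_piecewise (s := {0}ᶜ) (continuousOn_F (F := F) (U := U))
        (continuousOn_const (c := F 0)) (measurableSet_singleton (0 : ℂ)).compl
      convert! this using 1
      ext z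
      by_cases hz : z = 0 <;> simp [Set.piecewise, hz]
    exact hF.norm
  have hU : Measurable U := (HypData.contDiff F (U := U)).continuous.measurable
  unfold sheetDensity dens
  have hl : Measurable fun z : ℂ => U (Real.log ‖z‖) :=
    hU.comp (Real.measurable_log.comp measurable_norm)
  exact ((((Real.measurable_exp.comp hl).div h2.sqrt).pow_const 2).div
    (measurable_norm.pow_const 2)).ennreal_ofReal

lemma area_eq_lintegral_sum [HypData F U] {A : Set (Hyp F U)} (hA : MeasurableSet A) :
    area F U A = ∫⁻ z, ∑ δ : ℤˣ, (sheet F U δ ⁻¹' A).indicator (sheetDensity F U) z := by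
  rw [area_apply hA, lintegral_finsetSum']
  · exact Finset.sum_congr rfl fun δ _ => (lintegral_indicator (measurable_sheet δ hA) _).symm
  · exact fun δ _ => ((measurable_sheetDensity (U := U)).indicator
      (measurable_sheet δ hA)).aemeasurable

/-- The effect of scalings `(z, w) ↦ (a z, b z w)` on the area. -/
lemma area_le_mul_area [HypData F U] {a : ℂ} {b : ℂ → ℂ} {C : ℝ} (ha : a ≠ 0)
    (hF : ∀ z ≠ 0, F (a * z) = b z ^ 2 * F z)
    {σ : Hyp F U → Hyp F U} (hσ : Measurable σ)
    (hσz : ∀ x, (σ x).z = a * x.z) (hσw : ∀ x, (σ x).w = b x.z * x.w) {B : Set (Hyp F U)}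
    (hB : MeasurableSet B)
    (h : ∀ x, σ x ∈ B → dens F U (a * x.z) ≤ C * dens F U x.z) :
    area F U B ≤ ENNReal.ofReal (C ^ 2) * area F U (σ ⁻¹' B) := by
  have hsub : area F U B = ∫⁻ z, ENNReal.ofReal (‖a‖ ^ 2) *
      ∑ δ : ℤˣ, (sheet F U δ ⁻¹' B).indicator (sheetDensity F U) (a * z) := by
    have h1 : ∀ z : ℂ, HasFDerivWithinAt (fun z => a * z)
        ((ContinuousLinearMap.toSpanSingleton ℂ a).restrictScalars ℝ) Set.univ z := fun z => by
      have := ((hasDerivAt_id z).const_mul a).hasFDerivAt.restrictScalars ℝ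
      rw [mul_one] at this
      exact this.hasFDerivWithinAt
    have h2 := lintegral_image_eq_lintegral_abs_det_fderiv_mul volume MeasurableSet.univ
      (fun z _ => h1 z) (mul_right_injective₀ ha).injOn
      (fun u => ∑ δ : ℤˣ, (sheet F U δ ⁻¹' B).indicator (sheetDensity F U) u)
    rw [Set.image_univ, (mul_left_surjective₀ ha).range_eq] at h2
    simp only [setLIntegral_univ, det_mul] at h2
    rw [area_eq_lintegral_sum hB, h2]
    simp
  rw [hsub, area_eq_lintegral_sum (hσ hB), ← lintegral_const_mul' _ _ ENNReal.ofReal_ne_top]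
  refine lintegral_mono_ae ?_
  filter_upwards [measure_eq_zero_iff_ae_notMem.1 (measure_singleton (μ := volume) (0 : ℂ))] with z hz
  have hz : z ≠ 0 := hz
  have haz := mul_ne_zero ha hz
  -- The scaling matches the sheets over `z` with those over `a * z` up to a sign depending on `z`;
  -- summing over both sheets makes this sign immaterial.
  obtain ⟨δ₀, h₀⟩ : ∃ δ₀ : ℤˣ, rootF F (a * z) = (δ₀ : ℤ) * (b z * rootF F z) := by
    have h1 : rootF F (a * z) ^ 2 = (b z * rootF F z) ^ 2 := by
      rw [rootF_sq, mul_pow, rootF_sq, hF z hz]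
    obtain h | h := sq_eq_sq_iff_eq_or_eq_neg.1 h1
    · exact ⟨1, by simp [h]⟩
    · exact ⟨-1, by simp [h]⟩
  have hsq : (((δ₀ : ℤ) : ℂ)) * (δ₀ : ℤ) = 1 := by
    obtain rfl | rfl := Int.units_eq_one_or δ₀ <;> simp
  have hσs : ∀ δ : ℤˣ, σ (sheet F U δ z) = sheet F U (δ * δ₀) (a * z) := fun δ => by
    obtain ⟨e1, e2⟩ := sheet_of_ne (F := F) (U := U) (δ := δ) hz
    obtain ⟨e3, e4⟩ := sheet_of_ne (F := F) (U := U) (δ := δ * δ₀) haz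
    refine Hyp.ext (by rw [hσz, e1, e3]) ?_
    rw [hσw, e1, e2, e4, h₀]
    push_cast
    linear_combination (-(((δ : ℤ) : ℂ)) * b z * rootF F z) * hsq
  rw [← Equiv.sum_comp (Equiv.mulRight δ₀), Finset.mul_sum, Finset.mul_sum]
  refine Finset.sum_le_sum fun δ _ => ?_
  rw [Equiv.coe_mulRight]
  by_cases hx : σ (sheet F U δ z) ∈ B
  · rw [Set.indicator_of_mem (by rw [Set.mem_preimage, ← hσs]; exact hx),
      Set.indicator_of_mem (by exact hx), sheetDensity, sheetDensity,
      ← ENNReal.ofReal_mul (by positivity), ← ENNReal.ofReal_mul (by positivity)]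
    refine ENNReal.ofReal_le_ofReal ?_
    have h1 := h _ hx
    rw [(sheet_of_ne hz).1] at h1
    have h2 : dens F U (a * z) ^ 2 ≤ (C * dens F U z) ^ 2 :=
      pow_le_pow_left₀ (by unfold dens; positivity) h1 2
    have hzn := norm_pos_iff.2 hz
    have han := norm_pos_iff.2 ha
    rw [mul_pow C] at h2
    rw [norm_mul, mul_pow]
    calc _ = dens F U (a * z) ^ 2 / ‖z‖ ^ 2 := by field_simp
      _ ≤ (C ^ 2 * dens F U z ^ 2) / ‖z‖ ^ 2 := by gcongr
      _ = _ := by ring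
  · rw [Set.indicator_of_notMem (by rw [Set.mem_preimage, ← hσs]; exact hx), mul_zero]
    exact zero_le

end Hyp

end

noncomputable section Theta

/-! ### A theta function -/

/-- The reciprocals of the moduli of the zeros of the theta function outside the unit circle. -/
def invNode (L : ℝ) (k : ℕ) : ℝ := Real.exp (-(L * (k + 1 / 2)))

/-- The product over the zeros outside the unit circle. -/
def halfTheta (L : ℝ) (z : ℂ) : ℂ := ∏' k : ℕ, (1 + invNode L k * z)

/-- A theta function, with zeros at the points `-exp (L (k + 1 / 2))`, `k ∈ ℤ`. -/
def theta (L : ℝ) (z : ℂ) : ℂ := halfTheta L z * halfTheta L z⁻¹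

variable {L : ℝ}

lemma invNode_pos (L : ℝ) (k : ℕ) : 0 < invNode L k := Real.exp_pos _

lemma invNode_succ (L : ℝ) (k : ℕ) : invNode L (k + 1) = Real.exp (-L) * invNode L k := by
  rw [invNode, invNode, ← Real.exp_add]
  push_cast
  ring_nf

lemma invNode_le (hL : 0 < L) (k : ℕ) : invNode L k ≤ invNode L 0 := by
  refine Real.exp_le_exp.2 ?_
  push_cast
  nlinarith [mul_nonneg hL.le (Nat.cast_nonneg (α := ℝ) k)]

lemma summable_invNode (hL : 0 < L) : Summable (invNode L) := by
  have h1 : invNode L = fun k : ℕ => invNode L 0 * Real.exp (-L) ^ k := by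
    ext k
    rw [invNode, invNode, ← Real.exp_nat_mul, ← Real.exp_add]
    push_cast
    ring_nf
  rw [h1]
  exact (summable_geometric_of_lt_one (Real.exp_pos _).le (by simpa using hL)).mul_left _

lemma summable_invNode_mul (hL : 0 < L) (z : ℂ) : Summable fun k => ‖(invNode L k : ℂ) * z‖ := by
  simp only [norm_mul, Complex.norm_real, Real.norm_of_nonneg (invNode_pos L _).le]
  exact (summable_invNode hL).mul_right _

lemma multipliable_halfTheta (hL : 0 < L) (z : ℂ) :
    Multipliable fun k => (1 + invNode L k * z) :=
  multipliable_one_add_of_summable (summable_invNode_mul hL z)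

lemma differentiable_halfTheta (hL : 0 < L) : Differentiable ℂ (halfTheta L) := by
  intro z
  have h1 : HasProdLocallyUniformlyOn (fun (k : ℕ) z => 1 + (invNode L k : ℂ) * z) (halfTheta L)
      (Metric.ball 0 (‖z‖ + 1)) := by
    refine Summable.hasProdLocallyUniformlyOn_nat_one_add Metric.isOpen_ball
      ((summable_invNode hL).mul_right (‖z‖ + 1)) (Eventually.of_forall fun k u hu => ?_) ?_
    · rw [norm_mul, Complex.norm_real, Real.norm_of_nonneg (invNode_pos L _).le]
      rw [mem_ball_zero_iff] at hu
      have := (invNode_pos L k).le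
      gcongr
    · exact fun k => by fun_prop
  have h2 := h1.tendstoLocallyUniformlyOn_finsetRange
  have h3 := h2.differentiableOn (Eventually.of_forall fun n => by
    refine DifferentiableOn.fun_finsetProd fun k _ => ?_
    fun_prop) Metric.isOpen_ball
  exact h3.differentiableAt (Metric.isOpen_ball.mem_nhds (by simp))

/-- Removing the first factor shifts the index, which multiplies every node by e^{-L}: the
functional equation of the q-Pochhammer symbol. -/
lemma halfTheta_eq (hL : 0 < L) (z : ℂ) :
    halfTheta L z = (1 + invNode L 0 * z) * halfTheta L (z * Real.exp (-L)) := by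
  have h : ∀ k, (1 + (invNode L (k + 1) : ℂ) * z) = 1 + invNode L k * (z * Real.exp (-L)) := by
    intro k
    rw [invNode_succ]
    push_cast
    ring
  rw [halfTheta, tprod_eq_zero_mul' (f := fun k : ℕ => 1 + (invNode L k : ℂ) * z)]
  · simp only [h, halfTheta]
  · simp only [h]
    exact multipliable_halfTheta hL _

lemma halfTheta_ne_zero (hL : 0 < L) {z : ℂ} (hz : invNode L 0 * ‖z‖ < 1) : halfTheta L z ≠ 0 := by
  refine tprod_one_add_ne_zero_of_summable (fun k h => ?_) (summable_invNode_mul hL z)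
  have h1 : ‖(invNode L k : ℂ) * z‖ = 1 := by
    rw [← neg_eq_of_add_eq_zero_right h, norm_neg, norm_one]
  rw [norm_mul, Complex.norm_real, Real.norm_of_nonneg (invNode_pos L _).le] at h1
  have := invNode_le hL k
  nlinarith [norm_nonneg z]

lemma tendsto_norm_halfTheta (hL : 0 < L) (z : ℂ) :
    Tendsto (fun n => ∏ k ∈ Finset.range n, ‖1 + (invNode L k : ℂ) * z‖) atTop
      (𝓝 ‖halfTheta L z‖) :=
  (multipliable_halfTheta hL z).hasProd.norm.tendsto_prod_nat

/-- For fixed |z| each factor |1 + qz|² = 1 + 2q Re z + q²|z|² increases with Re z, because all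
zeros lie on the negative ray. -/
lemma norm_halfTheta_le (hL : 0 < L) {z z' : ℂ} (h : ‖z‖ = ‖z'‖) (hre : z.re ≤ z'.re) :
    ‖halfTheta L z‖ ≤ ‖halfTheta L z'‖ := by
  refine le_of_tendsto_of_tendsto' (tendsto_norm_halfTheta hL z) (tendsto_norm_halfTheta hL z')
    fun n => Finset.prod_le_prod (fun _ _ => norm_nonneg _) fun k _ => ?_
  have hp := invNode_pos L k
  refine le_of_sq_le_sq ?_ (norm_nonneg _)
  have h2 : z.re * z.re + z.im * z.im = z'.re * z'.re + z'.im * z'.im := by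
    rw [← Complex.normSq_apply, ← Complex.normSq_apply, Complex.normSq_eq_norm_sq,
      Complex.normSq_eq_norm_sq, h]
  rw [← Complex.normSq_eq_norm_sq, ← Complex.normSq_eq_norm_sq, Complex.normSq_apply,
    Complex.normSq_apply]
  simp only [Complex.add_re, Complex.one_re, Complex.re_ofReal_mul, Complex.add_im, Complex.one_im,
    Complex.im_ofReal_mul, zero_add]
  have h3 := mul_le_mul_of_nonneg_left hre hp.le
  have h4 := congrArg (invNode L k * invNode L k * ·) h2
  linarith

lemma norm_theta_le (hL : 0 < L) {z z' : ℂ} (h : ‖z‖ = ‖z'‖) (hre : z.re ≤ z'.re) :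
    ‖theta L z‖ ≤ ‖theta L z'‖ := by
  rw [theta, theta, norm_mul, norm_mul]
  refine mul_le_mul (norm_halfTheta_le hL h hre) (norm_halfTheta_le hL (by simp [h]) ?_)
    (norm_nonneg _) (norm_nonneg _)
  rw [Complex.inv_re, Complex.inv_re, Complex.normSq_eq_norm_sq, Complex.normSq_eq_norm_sq, h]
  gcongr

lemma theta_inv (L : ℝ) (z : ℂ) : theta L z⁻¹ = theta L z := by
  rw [theta, theta, inv_inv, mul_comm]

lemma differentiableOn_theta (hL : 0 < L) : DifferentiableOn ℂ (theta L) {0}ᶜ := fun z hz =>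
  ((differentiable_halfTheta hL z).mul
    ((differentiable_halfTheta hL z⁻¹).comp z (differentiableAt_inv hz))).differentiableWithinAt

/-- The factorization of the theta function at its smallest zero outside the unit circle. -/
lemma theta_eq (hL : 0 < L) (z : ℂ) : theta L z =
    (1 + invNode L 0 * z⁻¹) * (halfTheta L z * halfTheta L (z⁻¹ * Real.exp (-L))) := by
  rw [theta, halfTheta_eq hL z⁻¹]
  ring

/-- Under z ↦ e^L z the outer product gains the factor 1 + e^{L/2} z and the inner one loses 1 +
e^{-L/2}/z; their quotient is e^{L/2} z. -/
lemma theta_mul_exp (hL : 0 < L) {z : ℂ} (hz : z ≠ 0) :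
    theta L (Real.exp L * z) = Real.exp (L / 2) * z * theta L z := by
  have h1 : halfTheta L (Real.exp L * z) = (1 + Real.exp (L / 2) * z) * halfTheta L z := by
    rw [halfTheta_eq hL]
    have e1 : (Real.exp L : ℂ) * Real.exp (-L) = 1 := by
      rw [← Complex.ofReal_mul, ← Real.exp_add]; simp
    have e2 : (invNode L 0 : ℂ) * Real.exp L = Real.exp (L / 2) := by
      rw [← Complex.ofReal_mul, invNode, ← Real.exp_add]
      congr 2
      push_cast
      ring
    congr 2
    · linear_combination z * e2
    · linear_combination z * e1
  have h2 : (1 + Real.exp (L / 2) * z) = Real.exp (L / 2) * z * (1 + invNode L 0 * z⁻¹) := by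
    have e3 : (Real.exp (L / 2) : ℂ) * invNode L 0 = 1 := by
      rw [← Complex.ofReal_mul, invNode, ← Real.exp_add]
      simp
      ring_nf
      simp
    field_simp
    linear_combination -e3
  rw [theta_eq hL z, theta, h1, h2, mul_inv, mul_comm ((Real.exp L : ℂ)⁻¹), Real.exp_neg]
  push_cast
  ring

lemma theta_mul_exp_int (hL : 0 < L) {z : ℂ} (hz : z ≠ 0) (n : ℤ) :
    theta L (Real.exp (L * n) * z) = Real.exp (L * n ^ 2 / 2) * z ^ n * theta L z := by
  -- Stating one step as an equivalence serves both directions of the induction over ℤ.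
  have step : ∀ n : ℤ,
      (theta L (Real.exp (L * n) * z) = Real.exp (L * n ^ 2 / 2) * z ^ n * theta L z) ↔
      (theta L (Real.exp (L * (n + 1 : ℤ)) * z) =
        Real.exp (L * (n + 1 : ℤ) ^ 2 / 2) * z ^ (n + 1) * theta L z) := by
    intro n
    have hne : ∀ x : ℝ, (Real.exp x : ℂ) ≠ 0 := fun x => by exact_mod_cast (Real.exp_pos _).ne'
    have h1 : theta L (Real.exp (L * (n + 1 : ℤ)) * z) =
        Real.exp (L / 2) * (Real.exp (L * n) * z) * theta L (Real.exp (L * n) * z) := by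
      rw [← theta_mul_exp hL (mul_ne_zero (hne _) hz), ← mul_assoc,
        ← Complex.ofReal_mul, ← Real.exp_add]
      push_cast
      ring_nf
    have h2 : (Real.exp (L * (n + 1 : ℤ) ^ 2 / 2) : ℂ) =
        Real.exp (L / 2) * Real.exp (L * n) * Real.exp (L * n ^ 2 / 2) := by
      rw [← Complex.ofReal_mul, ← Complex.ofReal_mul, ← Real.exp_add, ← Real.exp_add]
      congr 2
      push_cast
      ring
    rw [h1, h2, zpow_add_one₀ hz]
    have hc : (Real.exp (L / 2) * (Real.exp (L * n) * z) : ℂ) ≠ 0 :=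
      mul_ne_zero (hne _) (mul_ne_zero (hne _) hz)
    rw [← mul_right_inj' hc]
    ring_nf
  induction n using Int.induction_on with
  | zero => simp
  | succ n ih => exact (step n).1 ih
  | pred n ih => exact (step (-n - 1)).2 (by simpa using ih)

lemma exists_shift (hL : 0 < L) (t a : ℝ) : ∃ n : ℤ, a ≤ t + L * n ∧ t + L * n < a + L := by
  obtain ⟨n, hn, -⟩ := existsUnique_add_zsmul_mem_Ico hL t a
  refine ⟨n, ?_⟩
  simpa [mul_comm] using hn

/-- In this fundamental annulus a zero of `theta` can come only from the factor split off in
`theta_eq`. -/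
lemma halfTheta_mul_ne_zero (hL : 0 < L) {z : ℂ} (hz : z ≠ 0) (h1 : -(L / 2) ≤ Real.log ‖z‖)
    (h2 : Real.log ‖z‖ < L / 2) :
    halfTheta L z * halfTheta L (z⁻¹ * Real.exp (-L)) ≠ 0 := by
  have hzn := norm_pos_iff.2 hz
  have h0 : invNode L 0 = Real.exp (-(L / 2)) := by rw [invNode]; congr 1; push_cast; ring
  have hz1 : ‖z‖ = Real.exp (Real.log ‖z‖) := (Real.exp_log hzn).symm
  refine mul_ne_zero (halfTheta_ne_zero hL ?_) (halfTheta_ne_zero hL ?_)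
  · rw [h0, hz1, ← Real.exp_add, Real.exp_lt_one_iff]
    linarith
  · rw [h0, norm_mul, norm_inv, Complex.norm_real, Real.norm_of_nonneg (Real.exp_pos _).le, hz1,
      ← Real.exp_neg, ← Real.exp_add, ← Real.exp_add, Real.exp_lt_one_iff]
    linarith

/-- The zeros of the theta function, and its factorization there. -/
lemma theta_factorization (hL : 0 < L) {z : ℂ} (hz : z ≠ 0) (h : theta L z = 0) :
    ∃ n : ℤ, z = -Real.exp (L * (n + 1 / 2)) ∧ deriv (theta L) z ≠ 0 := by
  obtain ⟨m, hm1, hm2⟩ := exists_shift hL (Real.log ‖z‖) (-(L / 2))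
  set c : ℂ := ((Real.exp (L * m) : ℝ) : ℂ)
  have hc : c ≠ 0 := Complex.ofReal_ne_zero.2 (Real.exp_pos _).ne'
  have hcz : c * z ≠ 0 := mul_ne_zero hc hz
  have hlog : Real.log ‖c * z‖ = Real.log ‖z‖ + L * m := by
    rw [norm_mul, Complex.norm_real, Real.norm_of_nonneg (Real.exp_pos _).le,
      Real.log_mul (Real.exp_pos _).ne' (norm_ne_zero_iff.2 hz), Real.log_exp]
    ring
  have hH := halfTheta_mul_ne_zero hL hcz (by rw [hlog]; exact hm1) (by rw [hlog]; linarith)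
  have hq : (invNode L 0 : ℂ) ≠ 0 := by exact_mod_cast (invNode_pos L 0).ne'
  have h0 : 1 + invNode L 0 * (c * z)⁻¹ = 0 := by
    have h1 := theta_mul_exp_int hL hz m
    rw [h, mul_zero] at h1
    exact (mul_eq_zero.1 ((theta_eq hL (c * z)).symm.trans h1)).resolve_right hH
  -- The zero in the fundamental annulus is c z = -e^{-L/2}, so log|z| = -Lm - L/2 = L((-m - 1) +
  -- 1/2).
  refine ⟨-m - 1, ?_, ?_⟩
  · have h1 : c * z = -invNode L 0 := by
      field_simp at h0
      linear_combination h0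
    have h2 : (Real.exp (L * ((-m - 1 : ℤ) + 1 / 2)) : ℂ) = c⁻¹ * invNode L 0 := by
      rw [← Complex.ofReal_inv, ← Complex.ofReal_mul, ← Real.exp_neg, invNode, ← Real.exp_add]
      congr 2
      push_cast
      ring
    rw [h2, ← neg_eq_iff_eq_neg.2 h1]
    field_simp
  -- At c z the split-off factor has a simple zero and its cofactor does not vanish; differentiating
  -- the quasi-periodicity relation carries simplicity back to z.
  · have hd : HasDerivAt (theta L) (invNode L 0 * (-((c * z) ^ 2)⁻¹) *
        (halfTheta L (c * z) * halfTheta L ((c * z)⁻¹ * Real.exp (-L)))) (c * z) := by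
      have h1 := (((hasDerivAt_inv hcz).const_mul (invNode L 0 : ℂ)).const_add 1)
      have h2 : DifferentiableAt ℂ (fun u => halfTheta L u * halfTheta L (u⁻¹ * Real.exp (-L)))
          (c * z) := (differentiable_halfTheta hL _).mul ((differentiable_halfTheta hL _).comp _
            ((differentiableAt_inv hcz).mul_const _))
      have h3 := h1.mul h2.hasDerivAt
      rw [h0, zero_mul, add_zero] at h3
      exact h3.congr_of_eventuallyEq (Eventually.of_forall (theta_eq hL))
    have hdz : DifferentiableAt ℂ (theta L) z :=
      (differentiableOn_theta hL).differentiableAt (isOpen_compl_singleton.mem_nhds hz)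
    have hl : HasDerivAt (fun u => theta L (c * u)) _ z := hd.comp z ((hasDerivAt_id z).const_mul c)
    have hr := (((hasDerivAt_zpow m z (Or.inl hz)).const_mul
      (Real.exp (L * m ^ 2 / 2) : ℂ))).mul hdz.hasDerivAt
    rw [h, mul_zero, zero_add] at hr
    have h4 := hl.unique (hr.congr_of_eventuallyEq (by
      filter_upwards [isOpen_compl_singleton.mem_nhds hz] with u hu
      exact theta_mul_exp_int hL hu m))
    intro h5
    rw [h5, mul_zero, mul_one] at h4
    refine mul_ne_zero (mul_ne_zero (mul_ne_zero hq (neg_ne_zero.2 (inv_ne_zero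
      (pow_ne_zero 2 hcz)))) hH) hc h4

lemma theta_node (hL : 0 < L) (n : ℤ) : theta L (-Real.exp (L * (n + 1 / 2))) = 0 := by
  have h1 : theta L (-Real.exp (L / 2)) = 0 := by
    have h2 : (invNode L 0 : ℂ) * Real.exp (L / 2) = 1 := by
      rw [← Complex.ofReal_mul, invNode, ← Real.exp_add]
      norm_num
      ring_nf
      simp
    rw [theta, halfTheta_eq hL, mul_neg, h2]
    ring
  have h2 := theta_mul_exp_int hL (z := -Real.exp (L / 2)) (by simp) n
  rw [h1, mul_zero] at h2
  rw [← h2, mul_neg, ← Complex.ofReal_mul, ← Real.exp_add]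
  ring_nf

/-- The size of the theta function. -/
lemma exists_norm_theta_le (hL : 0 < L) : ∃ C : ℝ, 0 < C ∧ ∀ z ≠ 0,
    ‖theta L z‖ ≤ C * Real.exp (Real.log ‖z‖ ^ 2 / (2 * L)) := by
  have hK : IsCompact (Metric.closedBall (0 : ℂ) (Real.exp L) ∩ {z | 1 ≤ ‖z‖}) :=
    (isCompact_closedBall _ _).inter_right (isClosed_le continuous_const continuous_norm)
  have hK0 : Metric.closedBall (0 : ℂ) (Real.exp L) ∩ {z | 1 ≤ ‖z‖} ⊆ {0}ᶜ := by
    rintro z ⟨-, hz⟩ (rfl : z = 0)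
    rw [Set.mem_ofPred_eq, norm_zero] at hz
    linarith
  obtain ⟨C, hC⟩ := hK.exists_bound_of_continuousOn ((differentiableOn_theta hL).continuousOn.mono hK0)
  refine ⟨max C 1, by positivity, fun z hz => ?_⟩
  -- The point is moved into the compact annulus 1 ≤ |z| ≤ e^L, where the function is bounded.
  obtain ⟨n, hn1, hn2⟩ := exists_shift hL (Real.log ‖z‖) 0
  have hzn := norm_pos_iff.2 hz
  have h1 := congrArg norm (theta_mul_exp_int hL hz n)
  have hu : ‖(Real.exp (L * n) * z : ℂ)‖ = Real.exp (Real.log ‖z‖ + L * n) := by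
    rw [norm_mul, Complex.norm_real, Real.norm_of_nonneg (Real.exp_pos _).le, add_comm, Real.exp_add,
      Real.exp_log hzn]
  have h2 : ‖theta L (Real.exp (L * n) * z)‖ ≤ max C 1 := by
    refine (hC _ ⟨?_, ?_⟩).trans (le_max_left _ _)
    · rw [mem_closedBall_zero_iff, hu]
      exact Real.exp_le_exp.2 (by linarith)
    · rw [Set.mem_ofPred_eq, hu]
      exact Real.one_le_exp hn1
  rw [norm_mul, norm_mul, Complex.norm_real, Real.norm_of_nonneg (Real.exp_pos _).le, norm_zpow,
    ← Real.exp_log hzn, ← Real.rpow_intCast, ← Real.exp_mul, ← Real.exp_add] at h1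
  rw [h1] at h2
  have h3 : 0 < Real.exp (L * n ^ 2 / 2 + Real.log ‖z‖ * n) := Real.exp_pos _
  rw [mul_comm, ← le_div_iff₀ h3] at h2
  refine h2.trans ?_
  rw [div_eq_mul_inv, ← Real.exp_neg]
  refine mul_le_mul_of_nonneg_left (Real.exp_le_exp.2 ?_) (by positivity)
  -- Completing the square: the two exponents differ by (log|z| + Ln)²/(2L).
  rw [le_div_iff₀ (by positivity)]
  nlinarith [sq_nonneg (Real.log ‖z‖ + L * n)]

/-- Hölder's inequality for two terms, from weighted AM–GM applied to each summand over the right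
side. With x = q e^s and y = q e^t it is log-convexity of t ↦ 1 + q e^t. -/
lemma one_add_rpow_mul_rpow_le {x y θ : ℝ} (hx : 0 < x) (hy : 0 < y) (h0 : 0 ≤ θ) (h1 : θ ≤ 1) :
    1 + x ^ (1 - θ) * y ^ θ ≤ (1 + x) ^ (1 - θ) * (1 + y) ^ θ := by
  have hd : 0 < (1 + x) ^ (1 - θ) * (1 + y) ^ θ := by positivity
  have e1 := Real.geom_mean_le_arith_mean2_weighted (by linarith : 0 ≤ 1 - θ) h0
    (by positivity : 0 ≤ 1 / (1 + x)) (by positivity : 0 ≤ 1 / (1 + y)) (by ring)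
  have e2 := Real.geom_mean_le_arith_mean2_weighted (by linarith : 0 ≤ 1 - θ) h0
    (by positivity : 0 ≤ x / (1 + x)) (by positivity : 0 ≤ y / (1 + y)) (by ring)
  rw [Real.div_rpow (by positivity) (by positivity), Real.div_rpow (by positivity) (by positivity),
    div_mul_div_comm] at e1 e2
  rw [Real.one_rpow, Real.one_rpow, one_mul] at e1
  have e3 := add_le_add e1 e2
  rw [← add_div, div_le_iff₀ hd] at e3
  refine e3.trans_eq ?_
  have : (1 - θ) * (1 / (1 + x)) + θ * (1 / (1 + y)) + ((1 - θ) * (x / (1 + x)) + θ * (y / (1 + y))) =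
    1 := by
    field_simp
    ring
  rw [this, one_mul]

/-- On the positive ray every factor is log-convex in log z, and log-convexity survives products and
limits. -/
lemma norm_halfTheta_exp_le (hL : 0 < L) {s t θ : ℝ} (h0 : 0 ≤ θ) (h1 : θ ≤ 1) :
    ‖halfTheta L (Real.exp ((1 - θ) * s + θ * t))‖ ≤
      ‖halfTheta L (Real.exp s)‖ ^ (1 - θ) * ‖halfTheta L (Real.exp t)‖ ^ θ := by
  have hn : ∀ (k : ℕ) (s : ℝ), ‖1 + (invNode L k : ℂ) * Real.exp s‖ = 1 + invNode L k * Real.exp s := by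
    intro k s
    rw [← Complex.ofReal_mul, ← Complex.ofReal_one, ← Complex.ofReal_add, Complex.norm_real,
      Real.norm_of_nonneg]
    have := invNode_pos L k
    positivity
  have h2 := ((tendsto_norm_halfTheta hL (Real.exp s)).rpow_const (p := 1 - θ)
    (Or.inr (by linarith))).mul ((tendsto_norm_halfTheta hL (Real.exp t)).rpow_const (p := θ)
    (Or.inr h0))
  refine le_of_tendsto_of_tendsto' (tendsto_norm_halfTheta hL _) h2 fun n => ?_
  rw [← Real.finsetProd_rpow _ _ (fun _ _ => norm_nonneg _),
    ← Real.finsetProd_rpow _ _ (fun _ _ => norm_nonneg _), ← Finset.prod_mul_distrib]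
  refine Finset.prod_le_prod (fun _ _ => norm_nonneg _) fun k _ => ?_
  have hq := invNode_pos L k
  rw [hn, hn, hn]
  refine le_trans (le_of_eq ?_) (one_add_rpow_mul_rpow_le (by positivity) (by positivity) h0 h1)
  rw [Real.mul_rpow hq.le (Real.exp_pos _).le, Real.mul_rpow hq.le (Real.exp_pos _).le,
    ← Real.exp_mul, ← Real.exp_mul, mul_mul_mul_comm, ← Real.rpow_add hq, ← Real.exp_add,
    sub_add_cancel, Real.rpow_one, mul_comm s, mul_comm t]

/-- Logarithmic convexity of the theta function on the positive half-line. -/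
lemma norm_theta_exp_le (hL : 0 < L) {s t θ : ℝ} (h0 : 0 ≤ θ) (h1 : θ ≤ 1) :
    ‖theta L (Real.exp ((1 - θ) * s + θ * t))‖ ≤
      ‖theta L (Real.exp s)‖ ^ (1 - θ) * ‖theta L (Real.exp t)‖ ^ θ := by
  have hi : ∀ s : ℝ, ((Real.exp s : ℂ))⁻¹ = Real.exp (-s) := fun s => by
    rw [Real.exp_neg, Complex.ofReal_inv]
  rw [theta, theta, theta, hi, hi, hi, norm_mul, norm_mul, norm_mul,
    Real.mul_rpow (norm_nonneg _) (norm_nonneg _), Real.mul_rpow (norm_nonneg _) (norm_nonneg _),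
    mul_mul_mul_comm]
  refine mul_le_mul (norm_halfTheta_exp_le hL h0 h1) ?_ (norm_nonneg _) (by positivity)
  have := norm_halfTheta_exp_le hL (s := -s) (t := -t) h0 h1
  rwa [show (1 - θ) * -s + θ * -t = -((1 - θ) * s + θ * t) by ring] at this

/-- The quotient of the theta function by a Gaussian, on the positive half-line. -/
def reducedTheta (L t : ℝ) : ℝ := ‖theta L (Real.exp t)‖ * Real.exp (-(t ^ 2 / (2 * L)))

lemma norm_theta_exp_add (hL : 0 < L) (t : ℝ) (n : ℤ) : ‖theta L (Real.exp (t + L * n))‖ =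
    Real.exp (L * n ^ 2 / 2 + n * t) * ‖theta L (Real.exp t)‖ := by
  have h := congrArg norm (theta_mul_exp_int hL (z := Real.exp t) (by simp) n)
  rw [norm_mul, norm_mul, Complex.norm_real, Real.norm_of_nonneg (Real.exp_pos _).le, norm_zpow,
    Complex.norm_real, Real.norm_of_nonneg (Real.exp_pos _).le, ← Complex.ofReal_mul,
    ← Real.exp_add, ← Real.rpow_intCast, ← Real.exp_mul, ← Real.exp_add] at h
  rw [add_comm t, h, mul_comm t]

/-- The Gaussian has exactly the multiplier of `theta`, so the quotient is periodic. -/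
lemma reducedTheta_add (hL : 0 < L) (t : ℝ) (n : ℤ) :
    reducedTheta L (t + L * n) = reducedTheta L t := by
  rw [reducedTheta, reducedTheta, norm_theta_exp_add hL, mul_right_comm, ← Real.exp_add, mul_comm]
  congr 2
  field_simp
  ring

/-- By periodicity t may be moved into [s, s + L), which only shortens t - s. Log-convexity between
s and s + L, whose values are related by quasi-periodicity, bounds the growth exponent by (t - s)/2
- (t - s)²/(2L). The rate 1/2 does not depend on L; this is what allows L to be enlarged to flatten
the curvature. -/
lemma reducedTheta_le (hL : 0 < L) {s t : ℝ} (h : s ≤ t) :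
    reducedTheta L t ≤ Real.exp ((t - s) / 2) * reducedTheta L s := by
  obtain ⟨n, hn1, hn2⟩ := exists_shift hL t s
  have hn : n ≤ 0 := by
    by_contra hn
    have : (1 : ℝ) ≤ n := by exact_mod_cast (by omega : 1 ≤ n)
    nlinarith
  have hn' : L * (n : ℝ) ≤ 0 := mul_nonpos_of_nonneg_of_nonpos hL.le (by exact_mod_cast hn)
  rw [← reducedTheta_add hL t n]
  set t' := t + L * n
  have hθ0 : 0 ≤ (t' - s) / L := div_nonneg (by linarith) hL.le
  have hθ1 : (t' - s) / L ≤ 1 := (div_le_one hL).2 (by linarith)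
  have h1 := norm_theta_exp_le hL (s := s) (t := s + L * (1 : ℤ)) hθ0 hθ1
  rw [norm_theta_exp_add hL] at h1
  have hz : 0 ≤ ‖theta L (Real.exp s)‖ := norm_nonneg _
  have e1 : (1 - (t' - s) / L) * s + (t' - s) / L * (s + L * (1 : ℤ)) = t' := by
    field_simp
    push_cast
    ring
  rw [e1, Real.mul_rpow (Real.exp_pos _).le hz, ← Real.exp_mul, mul_left_comm,
    ← Real.rpow_add' hz (by norm_num), sub_add_cancel, Real.rpow_one] at h1
  rw [reducedTheta, reducedTheta]
  calc _ ≤ Real.exp ((L * (1 : ℤ) ^ 2 / 2 + (1 : ℤ) * s) * ((t' - s) / L)) * ‖theta L (Real.exp s)‖ *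
        Real.exp (-(t' ^ 2 / (2 * L))) := by gcongr
    _ = Real.exp ((L * (1 : ℤ) ^ 2 / 2 + (1 : ℤ) * s) * ((t' - s) / L) + -(t' ^ 2 / (2 * L))) *
        ‖theta L (Real.exp s)‖ := by rw [Real.exp_add]; ring
    _ ≤ Real.exp ((t - s) / 2 + -(s ^ 2 / (2 * L))) * ‖theta L (Real.exp s)‖ := by
      refine mul_le_mul_of_nonneg_right (Real.exp_le_exp.2 ?_) hz
      have e2 : (L * (1 : ℤ) ^ 2 / 2 + (1 : ℤ) * s) * ((t' - s) / L) + -(t' ^ 2 / (2 * L)) =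
          (t' - s) / 2 - s ^ 2 / (2 * L) - (t' - s) ^ 2 / (2 * L) := by
        field_simp
        push_cast
        ring
      have : 0 ≤ (t' - s) ^ 2 / (2 * L) := by positivity
      rw [e2]
      linarith
    _ = _ := by rw [Real.exp_add]; ring

end Theta

/-! ### The weight, the theta surface and its distances -/

noncomputable section

/-- The logarithm of the conformal factor. -/
def weight (L t : ℝ) : ℝ := Real.log (Real.cosh t) + t ^ 2 / (4 * L)

lemma exp_weight (L t : ℝ) : Real.exp (weight L t) = Real.cosh t * Real.exp (t ^ 2 / (4 * L)) := by
  rw [weight, Real.exp_add, Real.exp_log (Real.cosh_pos t)]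

/-- The cosh term contributes a part decaying at infinity, the Gaussian the constant 1/(2L), which
is all that survives in the curvature bound. -/
lemma deriv_deriv_weight (L t : ℝ) :
    deriv (deriv (weight L)) t = (1 / Real.cosh t) ^ 2 + 1 / (2 * L) := by
  have h1 : ∀ t, HasDerivAt (weight L) (Real.sinh t / Real.cosh t + 2 * t / (4 * L)) t := fun t => by
    have := ((Real.hasDerivAt_cosh t).log (Real.cosh_pos t).ne').add
      ((hasDerivAt_pow 2 t).div_const (4 * L))
    simpa using! this
  have h2 : deriv (weight L) = fun t => Real.sinh t / Real.cosh t + 2 * t / (4 * L) :=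
    funext fun t => (h1 t).deriv
  have hc := (Real.cosh_pos t).ne'
  have h3 := ((Real.hasDerivAt_sinh t).div (Real.hasDerivAt_cosh t) hc).add
    (((hasDerivAt_id t).const_mul 2).div_const (4 * L))
  rw [h2]
  refine (h3.congr_deriv ?_).deriv
  have := Real.cosh_sq t
  rw [div_pow, one_pow, show Real.cosh t * Real.cosh t - Real.sinh t * Real.sinh t = 1 by linarith]
  congr 1
  rw [mul_one, show 4 * L = 2 * (2 * L) by ring, ← div_div]
  norm_num

lemma cosh_add_le_exp_abs_mul_cosh (t u : ℝ) : Real.cosh (t + u) ≤ Real.exp |u| * Real.cosh t := by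
  rw [Real.cosh_eq, Real.cosh_eq, neg_add, Real.exp_add, Real.exp_add]
  have h1 := mul_le_mul_of_nonneg_left (Real.exp_le_exp.2 (le_abs_self u)) (Real.exp_pos t).le
  have h2 := mul_le_mul_of_nonneg_left (Real.exp_le_exp.2 (neg_le_abs u)) (Real.exp_pos (-t)).le
  linarith

lemma cosh_le_exp_mul_cosh_add {s u : ℝ} (hs : 0 ≤ s) :
    Real.cosh s ≤ 2 * Real.exp (-u) * Real.cosh (s + u) := by
  have h1 : Real.cosh s ≤ Real.exp s := by
    rw [Real.cosh_eq]
    have := Real.exp_le_exp.2 (by linarith : -s ≤ s)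
    linarith
  have h2 : Real.exp s = 2 * Real.exp (-u) * (Real.exp (s + u) / 2) := by
    rw [show s = -u + (s + u) by ring, Real.exp_add]
    ring_nf
  have h3 : Real.exp (s + u) / 2 ≤ Real.cosh (s + u) := by
    rw [Real.cosh_eq]
    have := Real.exp_pos (-(s + u))
    linarith
  rw [h2] at h1
  refine h1.trans (mul_le_mul_of_nonneg_left h3 (by positivity))

lemma exp_abs_le_abs_sinh (t : ℝ) : Real.exp |t| ≤ 2 * |Real.sinh t| + 1 := by
  rw [Real.abs_sinh, Real.sinh_eq]
  have := Real.exp_le_one_iff.2 (neg_nonpos.2 (abs_nonneg t))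
  linarith

variable {L : ℝ}

instance [hL : Fact (0 < L)] : HypData (theta L) (weight L) where
  differentiableOn := differentiableOn_theta hL.out
  deriv_ne_zero _ hz h := (theta_factorization hL.out hz h).choose_spec.2
  exists_zero := ⟨_, neg_ne_zero.2 (Complex.ofReal_ne_zero.2 (Real.exp_pos (L * ((0 : ℤ) + 1 / 2))).ne'),
    theta_node hL.out 0⟩
  contDiff := (Real.contDiff_cosh.log fun t => (Real.cosh_pos t).ne').add
    ((contDiff_id.pow 2).div_const _)

/-- The surface `w² = θ(z)`. -/
abbrev ThetaSurface (L : ℝ) : Type := Hyp (theta L) (weight L)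

namespace ThetaSurface
open Hyp

lemma norm_sq_w (x : ThetaSurface L) : ‖x.w‖ ^ 2 = ‖theta L x.z‖ := by rw [← norm_pow, w_sq]

lemma theta_exp_ne_zero (hL : 0 < L) (t : ℝ) : theta L (Real.exp t) ≠ 0 := by
  intro h
  obtain ⟨n, hn, -⟩ := theta_factorization hL (by simp) h
  have h1 := congrArg Complex.re hn
  rw [Complex.neg_re, Complex.ofReal_re, Complex.ofReal_re] at h1
  have := Real.exp_pos t
  have := Real.exp_pos (L * (n + 1 / 2))
  linarith

/-- The Gaussian in the weight dominates the growth of |w|; the spare factor cosh is what makes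
sinh(log|z|) Lipschitz. -/
lemma exists_norm_w_le [hL : Fact (0 < L)] : ∃ C : ℝ, 0 < C ∧ ∀ x : ThetaSurface L,
    Real.cosh x.logMod * ‖x.w‖ ≤ C * Real.exp (weight L x.logMod) := by
  obtain ⟨C, hC, h⟩ := exists_norm_theta_le hL.out
  refine ⟨√C, by positivity, fun x => ?_⟩
  have h1 : ‖x.w‖ ≤ √C * Real.exp (x.logMod ^ 2 / (4 * L)) := by
    refine le_of_sq_le_sq ?_ (by positivity)
    rw [norm_sq_w, mul_pow, Real.sq_sqrt hC.le, sq (Real.exp _), ← Real.exp_add]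
    refine (h _ x.z_ne_zero).trans_eq ?_
    rw [logMod]
    congr 2
    ring
  rw [exp_weight, mul_left_comm]
  exact mul_le_mul_of_nonneg_left h1 (Real.cosh_pos _).le

instance [hL : Fact (0 < L)] : ProperSpace (ThetaSurface L) :=
  let ⟨_, hC, h⟩ := exists_norm_w_le (L := L)
  properSpace_of_le hC.le h

/-- Lower bound for distances. -/
lemma exists_exp_le [hL : Fact (0 < L)] (p : ThetaSurface L) : ∃ C : ℝ, 0 < C ∧
    ∀ x, Real.exp |x.logMod| ≤ C * (1 + dist p x) := by
  obtain ⟨C, hC, h⟩ := exists_norm_w_le (L := L)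
  refine ⟨2 * |Real.sinh p.logMod| + 1 + 2 * C, by positivity, fun x => ?_⟩
  have h1 := abs_sub_le_mul_dist hC.le Real.contDiff_sinh
    (fun x : ThetaSurface L => by
      rw [Real.deriv_sinh, abs_of_pos (Real.cosh_pos _)]; exact h x) p x
  have h2 := abs_sub_abs_le_abs_sub (Real.sinh x.logMod) (Real.sinh p.logMod)
  have h3 := exp_abs_le_abs_sinh x.logMod
  have h4 := abs_nonneg (Real.sinh p.logMod)
  have h5 := dist_nonneg (x := p) (y := x)
  nlinarith [mul_nonneg h4 h5]

lemma dens_exp (t : ℝ) : dens (theta L) (weight L) (Real.exp t) =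
    Real.cosh t / √(reducedTheta L t) := by
  rw [dens, Complex.norm_real, Real.norm_of_nonneg (Real.exp_pos t).le, Real.log_exp, exp_weight,
    reducedTheta, Real.sqrt_mul (norm_nonneg _), ← Real.exp_half, mul_div_assoc,
    div_eq_mul_inv (Real.cosh t)]
  congr 1
  rw [mul_inv, ← Real.exp_neg, div_eq_mul_inv, mul_comm]
  congr 2
  ring

lemma reducedTheta_pos (hL : 0 < L) (t : ℝ) : 0 < reducedTheta L t :=
  mul_pos (norm_pos_iff.2 (theta_exp_ne_zero hL t)) (Real.exp_pos _)

lemma reducedTheta_abs (t : ℝ) : reducedTheta L |t| = reducedTheta L t := by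
  have h : reducedTheta L (-t) = reducedTheta L t := by
    rw [reducedTheta, reducedTheta, Real.exp_neg t, Complex.ofReal_inv, theta_inv, neg_sq]
  rcases abs_choice t with h1 | h1 <;> rw [h1]
  exact h

/-- Moving inwards from |t| to |s|, the cosh factor gains the rate 1 and the root of `reducedTheta`
loses at most 1/4, a net rate 3/4. The symmetry z ↦ 1/z reduces both signs to |t|. -/
lemma dens_exp_le (hL : 0 < L) {s t : ℝ} (h : |s| ≤ |t|) :
    dens (theta L) (weight L) (Real.exp s) ≤
      2 * Real.exp (-(3 / 4 * (|t| - |s|))) * dens (theta L) (weight L) (Real.exp t) := by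
  rw [dens_exp, dens_exp, ← reducedTheta_abs s, ← reducedTheta_abs t, ← Real.cosh_abs s,
    ← Real.cosh_abs t]
  have h1 : √(reducedTheta L |t|) ≤ Real.exp ((|t| - |s|) / 4) * √(reducedTheta L |s|) := by
    rw [show (|t| - |s|) / 4 = (|t| - |s|) / 2 / 2 by ring, Real.exp_half,
      ← Real.sqrt_mul (Real.exp_pos _).le]
    exact Real.sqrt_le_sqrt (reducedTheta_le hL h)
  have h2 := cosh_le_exp_mul_cosh_add (u := |t| - |s|) (abs_nonneg s)
  rw [add_sub_cancel] at h2
  have hs := Real.sqrt_pos.2 (reducedTheta_pos hL |s|)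
  have ht := Real.sqrt_pos.2 (reducedTheta_pos hL |t|)
  rw [div_le_iff₀ hs, mul_assoc, div_mul_eq_mul_div (Real.cosh |t|), ← mul_div_assoc, le_div_iff₀ ht]
  calc _ ≤ (2 * Real.exp (-(|t| - |s|)) * Real.cosh |t|) *
        (Real.exp ((|t| - |s|) / 4) * √(reducedTheta L |s|)) :=
        mul_le_mul h2 h1 ht.le (by have := Real.cosh_pos |t|; positivity)
    _ = 2 * (Real.exp (-(|t| - |s|)) * Real.exp ((|t| - |s|) / 4)) *
        (Real.cosh |t| * √(reducedTheta L |s|)) := by ring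
    _ = _ := by
      rw [← Real.exp_add]
      ring_nf

/-- Paths on circles around the origin. -/
lemma exists_dist_le_arg [hL : Fact (0 < L)] (x : ThetaSurface L) (hx : x.w ≠ 0) :
    ∃ y : ThetaSurface L, y.z = Real.exp x.logMod ∧
      dist x y ≤ Real.pi * dens (theta L) (weight L) x.z ∧
      dens (theta L) (weight L) y.z ≤ dens (theta L) (weight L) x.z := by
  have hθ : 0 < ‖theta L x.z‖ := by rw [← norm_sq_w]; positivity
  set c : ℂ := (x.logMod : ℂ) + x.z.arg * Complex.I
  set d : ℂ := -(x.z.arg * Complex.I)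
  have hpath : ∀ s : ℝ, Complex.exp (c + s * d) =
      (Real.exp x.logMod : ℂ) * Complex.exp (((1 - s) * x.z.arg : ℝ) * Complex.I) := fun s => by
    rw [Complex.ofReal_exp, ← Complex.exp_add]
    congr 1
    simp only [c, d]
    push_cast
    ring
  have hz : (Real.exp x.logMod : ℂ) * Complex.exp (x.z.arg * Complex.I) = x.z := by
    rw [logMod, Real.exp_log (norm_pos_iff.2 x.z_ne_zero), Complex.norm_mul_exp_arg_mul_I]
  have hn : ∀ s : ℝ, ‖x.z‖ = ‖Complex.exp (c + s * d)‖ := fun s => by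
    rw [hpath, norm_mul, Complex.norm_exp_ofReal_mul_I, mul_one, Complex.norm_real,
      Real.norm_of_nonneg (Real.exp_pos _).le, logMod, Real.exp_log (norm_pos_iff.2 x.z_ne_zero)]
  -- Shrinking the argument at fixed modulus increases Re z, hence |θ|, so the density never exceeds
  -- its value at the starting point and no branch point is met.
  have hre : ∀ s ∈ Set.Icc (0 : ℝ) 1, x.z.re ≤ (Complex.exp (c + s * d)).re := fun s hs => by
    rw [← hz, hpath, Complex.re_ofReal_mul, Complex.re_ofReal_mul, Complex.exp_ofReal_mul_I_re,
      Complex.exp_ofReal_mul_I_re]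
    refine mul_le_mul_of_nonneg_left ?_ (Real.exp_pos _).le
    rw [← Real.cos_abs x.z.arg, ← Real.cos_abs (_ * _)]
    refine Real.cos_le_cos_of_nonneg_of_le_pi (abs_nonneg _) (Complex.abs_arg_le_pi _) ?_
    rw [abs_mul, abs_of_nonneg (by linarith [hs.2])]
    exact mul_le_of_le_one_left (abs_nonneg _) (by linarith [hs.1])
  have hle : ∀ s ∈ Set.Icc (0 : ℝ) 1, ‖theta L x.z‖ ≤ ‖theta L (Complex.exp (c + s * d))‖ :=
    fun s hs => norm_theta_le hL.out (hn s) (hre s hs)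
  have hdens : ∀ s ∈ Set.Icc (0 : ℝ) 1, dens (theta L) (weight L) (Complex.exp (c + s * d)) ≤
      dens (theta L) (weight L) x.z := fun s hs => by
    rw [dens, dens, ← hn s]
    have := hle s hs
    have := Real.sqrt_pos.2 hθ
    gcongr
  have hdn : ‖d‖ ≤ Real.pi := by
    simp only [d, norm_neg, norm_mul, Complex.norm_real, Complex.norm_I, mul_one, Real.norm_eq_abs]
    exact Complex.abs_arg_le_pi _
  obtain ⟨y, hy, hxy⟩ := exists_dist_le x (c := c) (d := d) (by rw [← hz, Complex.ofReal_exp, ← Complex.exp_add])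
    (fun s hs => norm_pos_iff.1 (hθ.trans_le (hle s hs)))
    (G := fun s => s * (dens (theta L) (weight L) x.z * Real.pi))
    (g := fun _ => dens (theta L) (weight L) x.z * Real.pi)
    (fun s => by simpa using (hasDerivAt_id s).mul_const (dens (theta L) (weight L) x.z * Real.pi))
    continuous_const
    (fun s hs => mul_le_mul (hdens s hs) hdn (norm_nonneg _) (by unfold dens; positivity))
  have h1 := hpath 1
  rw [Complex.ofReal_one, one_mul, ← hy] at h1
  refine ⟨y, ?_, ?_, ?_⟩
  · rw [h1]; simp
  · refine hxy.trans_eq ?_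
    ring
  · have := hdens 1 (by simp)
    rwa [Complex.ofReal_one, one_mul, ← hy] at this

/-- Radial paths. -/
lemma exists_dist_le_radial [hL : Fact (0 < L)] (x : ThetaSurface L)
    (hx : x.z = Real.exp x.logMod) :
    ∃ y : ThetaSurface L, y.z = 1 ∧ dist x y ≤ 8 / 3 * dens (theta L) (weight L) x.z := by
  set t := x.logMod
  set D := dens (theta L) (weight L) x.z
  have hD : 0 ≤ D := by simp only [D]; unfold dens; positivity
  have hpath : ∀ s : ℝ, Complex.exp ((t : ℂ) + s * (-t : ℂ)) = (Real.exp ((1 - s) * t) : ℂ) :=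
    fun s => by
      push_cast
      congr 1
      ring
  obtain ⟨y, hy, hxy⟩ := exists_dist_le x (c := t) (d := -t) (by rw [hx]; push_cast; rfl)
    (fun s hs => by rw [hpath]; exact theta_exp_ne_zero hL.out _)
    -- The density decays like 2 D e^{-(3/4)|t|s} along the path of logarithmic length |t|, which
    -- integrates to at most 2 · (4/3) · D.
    (G := fun s => -(8 / 3) * D * Real.exp (-(3 / 4) * |t| * s))
    (g := fun s => 2 * Real.exp (-(3 / 4) * |t| * s) * D * |t|)
    (fun s => by
      have := (((hasDerivAt_id s).const_mul (-(3 / 4) * |t|)).exp).const_mul (-(8 / 3) * D)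
      refine this.congr_deriv ?_
      simp only [id]
      ring)
    (by fun_prop)
    (fun s hs => by
      rw [hpath, norm_neg, Complex.norm_real, Real.norm_eq_abs]
      refine mul_le_mul_of_nonneg_right ?_ (abs_nonneg t)
      have h1 : |(1 - s) * t| = |t| - s * |t| := by
        rw [abs_mul, abs_of_nonneg (by linarith [hs.2])]; ring
      have h2 := dens_exp_le hL.out (s := (1 - s) * t) (t := t) (by
        rw [h1]; have := mul_nonneg hs.1 (abs_nonneg t); linarith)
      rw [h1, ← hx] at h2
      refine h2.trans_eq ?_
      simp only [D]
      ring_nf)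
  refine ⟨y, by rw [hy]; simp, hxy.trans ?_⟩
  have := mul_nonneg hD (Real.exp_pos (-(3 / 4) * |t| * 1)).le
  simp only [mul_zero, Real.exp_zero]
  linarith

/-- Upper bound for distances. -/
lemma exists_dist_le_dens [hL : Fact (0 < L)] (p : ThetaSurface L) : ∃ D : ℝ, 0 ≤ D ∧
    ∀ x, x.w ≠ 0 → dist p x ≤ 7 * dens (theta L) (weight L) x.z + D := by
  obtain ⟨D, hD⟩ := ((isCompact_logMod_le (F := theta L) (U := weight L) 0).isBounded.subset_closedBall p)
  have hD' : ∀ y : ThetaSurface L, y.z = 1 → dist y p ≤ D := fun y hy =>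
    hD (by simp [logMod, hy])
  refine ⟨|D|, abs_nonneg D, fun x hx => ?_⟩
  obtain ⟨y, hyz, hxy, hyd⟩ := exists_dist_le_arg x hx
  have hy : y.logMod = x.logMod := by
    rw [logMod, hyz, Complex.norm_real, Real.norm_of_nonneg (Real.exp_pos _).le, Real.log_exp]
  obtain ⟨u, hu, hyu⟩ := exists_dist_le_radial y (by rw [hyz, hy])
  have h1 := hD' u hu
  have h2 := dist_triangle4 x y u p
  have h3 := le_abs_self D
  have h4 : 0 ≤ dens (theta L) (weight L) x.z := by unfold dens; positivity
  -- The constant 7 covers π + 8/3, the arc plus the radial segment; the remaining distance is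
  -- absorbed in `D`.
  have h5 := mul_le_mul_of_nonneg_right Real.pi_lt_four.le h4
  rw [dist_comm p x]
  linarith

end ThetaSurface

end

/-! ### Curvature decay, translations and the upper volume bound -/

noncomputable section

namespace ThetaSurface
open Hyp
variable {L : ℝ}

lemma dist_eq_of_mem_distSphere {M : Type} [MetricSpace M] {p m : M} {r : ℝ}
    (h : m ∈ distSphere p r) : dist p m = r := by
  rw [dist_comm]
  exact Metric.frontier_ball_subset_sphere (frontier_closure_subset h)

lemma dens_eq (x : ThetaSurface L) : dens (theta L) (weight L) x.z =
    Real.cosh x.logMod * Real.exp (x.logMod ^ 2 / (4 * L)) / ‖x.w‖ := by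
  rw [dens, ← norm_sq_w, Real.sqrt_sq (norm_nonneg _), ← exp_weight, logMod]

/-- The denominator is the square of the same density that bounds distances from above, so in r²|K|
it cancels and only U'' remains. -/
lemma abs_gaussCurvature [hL : Fact (0 < L)] (x : ThetaSurface L) (hx : x.w ≠ 0) :
    |gaussCurvature (ThetaSurface L) x| =
      ((1 / Real.cosh x.logMod) ^ 2 + 1 / (2 * L)) / dens (theta L) (weight L) x.z ^ 2 := by
  have hL' := hL.out
  have hc := Real.cosh_pos x.logMod
  have hw := norm_pos_iff.2 hx
  rw [gaussCurvature_eq, deriv_deriv_weight, abs_mul, abs_neg, abs_of_pos (Real.exp_pos _),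
    abs_of_nonneg (by positivity), dens, ← norm_sq_w, Real.sqrt_sq (norm_nonneg _), ← logMod, Real.exp_neg,
    two_mul, Real.exp_add]
  field_simp

lemma gaussCurvature_eq_zero [hL : Fact (0 < L)] (x : ThetaSurface L) (hx : x.w = 0) :
    gaussCurvature (ThetaSurface L) x = 0 := by
  rw [gaussCurvature_eq, hx]
  simp

lemma tendsto_one_div_cosh : Tendsto (fun t => (1 / Real.cosh t) ^ 2) atTop (𝓝 0) := by
  have h : Tendsto Real.cosh atTop atTop := by
    refine tendsto_atTop_mono (fun t => ?_) ((Real.tendsto_exp_atTop).atTop_div_const two_pos)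
    rw [Real.cosh_eq]
    have := Real.exp_pos (-t)
    linarith
  simpa using (h.inv_tendsto_atTop.pow 2)

/-- Quadratic curvature decay. -/
lemma eventually_curvature_le [hL : Fact (0 < L)] (p : ThetaSurface L) {ε : ℝ} (hε : 0 < ε)
    (h : 196 / L ≤ ε) : ∀ᶠ r : ℝ in atTop, ∀ m ∈ distSphere p r,
      r ^ 2 * |gaussCurvature (ThetaSurface L) m| ≤ ε := by
  have hL' := hL.out
  obtain ⟨D, hD, hd⟩ := exists_dist_le_dens p
  -- For r ≥ 2D the bound r ≤ 7 dens + D gives r ≤ 14 dens, and 14² = 196. The two terms of U'' then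
  -- get ε/392 each.
  obtain ⟨T, hT⟩ := (tendsto_one_div_cosh.eventually (gt_mem_nhds (by positivity : 0 < ε / 392))
    ).exists_forall_of_atTop
  obtain ⟨R, hR⟩ := (isCompact_logMod_le (F := theta L) (U := weight L) T).isBounded.subset_closedBall p
  filter_upwards [eventually_gt_atTop R, eventually_ge_atTop (2 * D), eventually_gt_atTop 0] with
    r h1 h2 h3 m hm
  have hr := dist_eq_of_mem_distSphere hm
  by_cases hw : m.w = 0
  · rw [gaussCurvature_eq_zero m hw]
    simpa using hε.le
  have ht : T ≤ |m.logMod| := by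
    by_contra! hlt
    have := hR (show m ∈ {x : Hyp (theta L) (weight L) | |x.logMod| ≤ T} from hlt.le)
    rw [Metric.mem_closedBall'] at this
    linarith
  have h4 := hT _ ht
  rw [Real.cosh_abs] at h4
  have h5 := hd m hw
  rw [hr] at h5
  have h6 : r ≤ 14 * dens (theta L) (weight L) m.z := by linarith
  have h7 : 0 < dens (theta L) (weight L) m.z := by linarith
  rw [abs_gaussCurvature m hw, mul_div_assoc', div_le_iff₀ (by positivity)]
  have h8 : r ^ 2 ≤ 196 * dens (theta L) (weight L) m.z ^ 2 := by nlinarith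
  have h9 : (1 / Real.cosh m.logMod) ^ 2 + 1 / (2 * L) ≤ ε / 196 := by
    have : 1 / (2 * L) = 196 / L / 392 := by field_simp; norm_num
    rw [this]
    linarith
  calc _ ≤ (196 * dens (theta L) (weight L) m.z ^ 2) * (ε / 196) :=
        mul_le_mul h8 h9 (by positivity) (by positivity)
    _ = _ := by ring

/-- An even number of periods makes the multiplier a perfect square, so the scaling lifts to `w`. -/
lemma theta_shift (hL : 0 < L) (k : ℤ) (z : ℂ) (hz : z ≠ 0) : theta L (Real.exp (2 * L * k) * z) =
    (Real.exp (L * k ^ 2) * z ^ k) ^ 2 * theta L z := by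
  have h := theta_mul_exp_int hL hz (2 * k)
  have e1 : L * ((2 * k : ℤ) : ℝ) = 2 * L * k := by push_cast; ring
  have e2 : (Real.exp (L * ((2 * k : ℤ) : ℝ) ^ 2 / 2) : ℂ) = Real.exp (L * k ^ 2) ^ 2 := by
    rw [← Complex.ofReal_pow, ← Real.exp_nat_mul]
    congr 2
    push_cast
    ring
  rw [e1, e2] at h
  rw [h, mul_comm 2 k, zpow_mul, mul_pow]
  rfl

/-- The translations of the surface. -/
def shift (k : ℤ) [hL : Fact (0 < L)] (x : ThetaSurface L) : ThetaSurface L :=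
  Hyp.mk (Real.exp (2 * L * k) * x.z) (Real.exp (L * k ^ 2) * x.z ^ k * x.w)
    (mul_ne_zero (Complex.ofReal_ne_zero.2 (Real.exp_pos _).ne') x.z_ne_zero) (by
      rw [theta_shift hL.out k _ x.z_ne_zero, mul_pow, w_sq])

lemma norm_shift_factor (k : ℤ) (x : ThetaSurface L) :
    ‖(Real.exp (L * k ^ 2) * x.z ^ k : ℂ)‖ = Real.exp (L * k ^ 2 + x.logMod * k) := by
  rw [norm_mul, norm_zpow, Complex.norm_real, Real.norm_of_nonneg (Real.exp_pos _).le,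
    ← Real.exp_log (norm_pos_iff.2 x.z_ne_zero), ← Real.rpow_intCast, ← Real.exp_mul,
    ← Real.exp_add, logMod]

variable [hL : Fact (0 < L)]

lemma z_shift (k : ℤ) (x : ThetaSurface L) : (shift k x).z = Real.exp (2 * L * k) * x.z := rfl

lemma w_shift (k : ℤ) (x : ThetaSurface L) :
    (shift k x).w = (Real.exp (L * k ^ 2) * x.z ^ k) * x.w := rfl

lemma logMod_shift (k : ℤ) (x : ThetaSurface L) : (shift k x).logMod = x.logMod + 2 * L * k := by
  rw [logMod, z_shift, norm_mul, Complex.norm_real, Real.norm_of_nonneg (Real.exp_pos _).le,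
    Real.log_mul (Real.exp_pos _).ne' (norm_ne_zero_iff.2 x.z_ne_zero), Real.log_exp, logMod, add_comm]

lemma shift_shift (j k : ℤ) (x : ThetaSurface L) : shift j (shift k x) = shift (j + k) x := by
  have hz := x.z_ne_zero
  refine Hyp.ext ?_ ?_
  · rw [z_shift, z_shift, z_shift, ← mul_assoc, ← Complex.ofReal_mul, ← Real.exp_add]
    push_cast
    ring_nf
  · rw [w_shift, w_shift, w_shift, z_shift, mul_zpow, zpow_add₀ hz, ← Complex.ofReal_zpow,
      ← Real.rpow_intCast, ← Real.exp_mul]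
    have : Real.exp (L * ((j + k : ℤ) : ℝ) ^ 2) =
        Real.exp (L * j ^ 2) * Real.exp (2 * L * k * j) * Real.exp (L * k ^ 2) := by
      rw [← Real.exp_add, ← Real.exp_add]
      push_cast
      ring_nf
    rw [this]
    push_cast
    ring

lemma shift_zero (x : ThetaSurface L) : shift 0 x = x :=
  Hyp.ext (by simp [z_shift]) (by simp [w_shift])

lemma shift_shift_neg (k : ℤ) (x : ThetaSurface L) : shift k (shift (-k) x) = x := by
  rw [shift_shift, add_neg_cancel, shift_zero]

lemma continuous_shift (k : ℤ) : Continuous (shift k : ThetaSurface L → ThetaSurface L) := by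
  refine Hyp.continuous_iff.2 ?_
  refine (continuous_const.mul continuous_z).prodMk ((continuous_const.mul ?_).mul continuous_w)
  exact continuous_z.zpow₀ k fun x => Or.inl x.z_ne_zero

lemma shift_exponent (k : ℤ) (t : ℝ) : (t + 2 * L * k) ^ 2 / (4 * L) =
    (L * k ^ 2 + t * k) + t ^ 2 / (4 * L) := by
  have hL' := hL.out
  field_simp
  ring

/-- The Gaussian part of the weight absorbs the multiplier of `w`; only the ratio cosh(t + 2Lk)/cosh
t ≤ e^{2L|k|} remains as the stretch factor. -/
lemma dist_shift_le (k : ℤ) (x y : ThetaSurface L) :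
    dist (shift k x) (shift k y) ≤ Real.exp (2 * L * |(k : ℝ)|) * dist x y := by
  have hL' := hL.out
  refine dist_le_mul_dist (a := Real.exp (2 * L * k)) (b := fun z => Real.exp (L * k ^ 2) * z ^ k)
    (Real.exp_pos _).le (Complex.ofReal_ne_zero.2 (Real.exp_pos _).ne') ?_ ?_
    (theta_shift hL.out k) (z_shift k) (w_shift k) ?_ x y
  · exact (differentiableOn_zpow k _ (Or.inl (by simp))).const_mul _
  · exact fun z hz => mul_ne_zero (Complex.ofReal_ne_zero.2 (Real.exp_pos _).ne') (zpow_ne_zero _ hz)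
  · intro x
    have h1 := cosh_add_le_exp_abs_mul_cosh x.logMod (2 * L * k)
    rw [abs_mul, abs_of_pos (by positivity : 0 < 2 * L)] at h1
    rw [logMod_shift, norm_shift_factor, exp_weight, exp_weight, shift_exponent, Real.exp_add]
    calc _ ≤ (Real.exp (2 * L * |(k : ℝ)|) * Real.cosh x.logMod) * _ :=
          mul_le_mul_of_nonneg_right h1 (by positivity)
      _ = _ := by ring

lemma dens_shift (k : ℤ) (x : ThetaSurface L) :
    dens (theta L) (weight L) (Real.exp (2 * L * k) * x.z) * Real.cosh x.logMod =
      Real.cosh (x.logMod + 2 * L * k) * dens (theta L) (weight L) x.z := by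
  rw [← z_shift, dens_eq, dens_eq, logMod_shift, w_shift, norm_mul, norm_shift_factor,
    shift_exponent, Real.exp_add]
  have := (Real.exp_pos (L * k ^ 2 + x.logMod * k)).ne'
  rw [← mul_div_assoc, div_mul_eq_mul_div]
  rw [show Real.cosh (x.logMod + 2 * L * k) * (Real.exp (L * k ^ 2 + x.logMod * k) *
    Real.exp (x.logMod ^ 2 / (4 * L))) * Real.cosh x.logMod = Real.exp (L * k ^ 2 + x.logMod * k) *
    (Real.cosh (x.logMod + 2 * L * k) * (Real.cosh x.logMod * Real.exp (x.logMod ^ 2 / (4 * L)))) by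
    ring, mul_div_mul_left _ _ this]

lemma area_le_shift (k : ℤ) {B : Set (ThetaSurface L)} (hB : MeasurableSet B) {C : ℝ}
    (h : ∀ x, shift k x ∈ B → Real.cosh (x.logMod + 2 * L * k) ≤ C * Real.cosh x.logMod) :
    area (theta L) (weight L) B ≤
      ENNReal.ofReal (C ^ 2) * area (theta L) (weight L) (shift k ⁻¹' B) := by
  refine area_le_mul_area (a := Real.exp (2 * L * k)) (b := fun z => Real.exp (L * k ^ 2) * z ^ k)
    (Complex.ofReal_ne_zero.2 (Real.exp_pos _).ne') (theta_shift hL.out k)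
    (continuous_shift k).measurable (z_shift k) (w_shift k) hB fun x hx => ?_
  refine le_of_mul_le_mul_right ?_ (Real.cosh_pos x.logMod)
  rw [dens_shift]
  have h1 : 0 ≤ dens (theta L) (weight L) x.z := by unfold dens; positivity
  have := mul_le_mul_of_nonneg_right (h x hx) h1
  linarith

/-- Volume growth, in terms of the logarithm of the modulus. -/
lemma exists_area_le (h1 : 1 ≤ L) : ∃ V : ℝ, 0 < V ∧ ∀ n : ℕ,
    area (theta L) (weight L) {x : ThetaSurface L | |x.logMod| ≤ 2 * L * n} ≤
      ENNReal.ofReal (V * Real.exp (4 * L * n)) := by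
  set V₀ := area (theta L) (weight L) {x : ThetaSurface L | |x.logMod| ≤ 2 * L}
  have hV₀ : V₀ ≠ ⊤ := (isCompact_logMod_le (F := theta L) (U := weight L) (2 * L)).measure_lt_top.ne
  have hcont : Continuous (logMod : ThetaSurface L → ℝ) := contMDiff_logMod.continuous
  -- Each slab is a translate of part of the compact slab |t| ≤ 2L, with areas expanded at most by
  -- e^{4Lj}. The sign `δ` selects the end of the surface.
  have hslab : ∀ (δ : ℤˣ) (j : ℕ), area (theta L) (weight L) {x : ThetaSurface L |
      2 * L * j ≤ (δ : ℤ) * x.logMod ∧ (δ : ℤ) * x.logMod ≤ 2 * L * (j + 1)} ≤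
      ENNReal.ofReal (Real.exp (4 * L * j)) * V₀ := by
    intro δ j
    have hδ : ((δ : ℤ) : ℝ) * (δ : ℤ) = 1 := by
      obtain rfl | rfl := Int.units_eq_one_or δ <;> simp
    have hδ' : |((δ : ℤ) : ℝ)| = 1 := by
      obtain rfl | rfl := Int.units_eq_one_or δ <;> simp
    refine (area_le_shift (δ * j) (C := Real.exp (2 * L * j)) ?_ fun x _ => ?_).trans ?_
    · exact ((isClosed_le continuous_const (continuous_const.mul hcont)).inter
        (isClosed_le (continuous_const.mul hcont) continuous_const)).measurableSet
    · refine (cosh_add_le_exp_abs_mul_cosh _ _).trans_eq ?_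
      push_cast
      rw [abs_mul, abs_mul _ (j : ℝ), hδ', abs_of_pos (by linarith : 0 < 2 * L), Nat.abs_cast, one_mul]
    · rw [← Real.exp_nat_mul]
      refine mul_le_mul' (le_of_eq ?_) (measure_mono ?_)
      · congr 2
        push_cast
        ring
      · rintro x ⟨hx1, hx2⟩
        rw [logMod_shift] at hx1 hx2
        push_cast at hx1 hx2
        have e : ((δ : ℤ) : ℝ) * (x.logMod + 2 * L * ((δ : ℤ) * j)) =
          (δ : ℤ) * x.logMod + 2 * L * j := by linear_combination (2 * L * j) * hδ
        rw [e] at hx1 hx2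
        have e2 : |x.logMod| = |((δ : ℤ) : ℝ) * x.logMod| := by rw [abs_mul, hδ', one_mul]
        rw [Set.mem_ofPred_eq, e2, abs_of_nonneg (by linarith)]
        linarith
  -- The geometric sum is dominated by the next term because e^{4L} ≥ 2.
  have hgeom : ∀ n : ℕ, ∑ j ∈ Finset.range n, Real.exp (4 * L * j) ≤ Real.exp (4 * L * n) := by
    intro n
    induction n with
    | zero => simp
    | succ n ih =>
      rw [Finset.sum_range_succ]
      have e : Real.exp (4 * L * (n + 1 : ℕ)) = Real.exp (4 * L) * Real.exp (4 * L * n) := by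
        rw [← Real.exp_add]; push_cast; ring_nf
      have e2 : 2 ≤ Real.exp (4 * L) := by
        have := Real.add_one_le_exp (4 * L)
        linarith
      rw [e]
      have := Real.exp_pos (4 * L * n)
      nlinarith
  refine ⟨2 * Real.exp (4 * L) * (V₀.toReal + 1), by positivity, fun n => ?_⟩
  have hcover : {x : ThetaSurface L | |x.logMod| ≤ 2 * L * n} ⊆
      ⋃ δ : ℤˣ, ⋃ j ∈ Finset.range (n + 1), {x : ThetaSurface L |
        2 * L * j ≤ (δ : ℤ) * x.logMod ∧ (δ : ℤ) * x.logMod ≤ 2 * L * (j + 1)} := by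
    intro x hx
    obtain ⟨δ, hδ⟩ : ∃ δ : ℤˣ, ((δ : ℤ) : ℝ) * x.logMod = |x.logMod| := by
      rcases abs_choice x.logMod with h | h
      · exact ⟨1, by rw [h]; simp⟩
      · exact ⟨-1, by rw [h]; simp⟩
    have hL2 : 0 < 2 * L := by linarith
    have h0 : 0 ≤ |x.logMod| / (2 * L) := by positivity
    simp only [Set.mem_iUnion, Finset.mem_range]
    refine ⟨δ, ⌊|x.logMod| / (2 * L)⌋₊, ?_, ?_, ?_⟩
    · rw [Nat.lt_succ_iff]
      refine Nat.floor_le_of_le ?_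
      rw [div_le_iff₀ hL2]
      linarith [show |x.logMod| ≤ 2 * L * n from hx]
    · rw [hδ, mul_comm, ← le_div_iff₀ hL2]
      exact Nat.floor_le h0
    · rw [hδ, mul_comm, ← div_le_iff₀ hL2]
      exact (Nat.lt_floor_add_one _).le
  calc _ ≤ ∑ _δ : ℤˣ, ∑ j ∈ Finset.range (n + 1), ENNReal.ofReal (Real.exp (4 * L * j)) * V₀ := by
        refine (measure_mono hcover).trans ((measure_iUnion_fintype_le _ _).trans
          (Finset.sum_le_sum fun δ _ => ?_))
        exact (measure_biUnion_finset_le _ _).trans (Finset.sum_le_sum fun j _ => hslab δ j)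
    _ ≤ ∑ _δ : ℤˣ, ENNReal.ofReal (Real.exp (4 * L * (n + 1 : ℕ))) * V₀ := by
        refine Finset.sum_le_sum fun δ _ => ?_
        rw [← Finset.sum_mul, ← ENNReal.ofReal_sum_of_nonneg fun _ _ => (Real.exp_pos _).le]
        gcongr
        exact hgeom _
    _ ≤ _ := by
        rw [← ENNReal.ofReal_toReal hV₀, ENNReal.toReal_ofReal ENNReal.toReal_nonneg,
          ← ENNReal.ofReal_mul (Real.exp_pos _).le, Finset.sum_const, nsmul_eq_mul,
          ← ENNReal.ofReal_natCast, ← ENNReal.ofReal_mul (Nat.cast_nonneg _)]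
        refine ENNReal.ofReal_le_ofReal ?_
        have e : Real.exp (4 * L * (n + 1 : ℕ)) = Real.exp (4 * L) * Real.exp (4 * L * n) := by
          rw [← Real.exp_add]; push_cast; ring_nf
        have e2 : ((Finset.univ : Finset ℤˣ).card : ℝ) = 2 := by simp
        rw [e, e2]
        have := mul_pos (Real.exp_pos (4 * L)) (Real.exp_pos (4 * L * n))
        nlinarith

/-- The upper bound for the volume growth. -/
lemma eventually_area_ball_le (h1 : 1 ≤ L) (p : ThetaSurface L) : ∃ c : ℝ, 0 < c ∧ ∀ᶠ r : ℝ in atTop,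
    area (theta L) (weight L) (Metric.ball p r) / ENNReal.ofReal (r ^ 2) ≤ ENNReal.ofReal c := by
  obtain ⟨C, hC, hd⟩ := exists_exp_le p
  obtain ⟨V, hV, hv⟩ := exists_area_le h1
  refine ⟨V * Real.exp (4 * L) * (2 * (C + 1)) ^ 2, by positivity, ?_⟩
  filter_upwards [eventually_ge_atTop 1] with r hr
  have hr2 : 0 < r ^ 2 := by positivity
  have hL2 : 0 < 2 * L := by linarith
  have h3 : 1 ≤ (C + 1) * (1 + r) := by nlinarith
  have h4 : 0 ≤ Real.log ((C + 1) * (1 + r)) / (2 * L) := div_nonneg (Real.log_nonneg h3) hL2.le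
  -- Chosen so that e^{2Ln} ≥ (C + 1)(1 + r), which confines the ball to |t| ≤ 2Ln; rounding up
  -- costs at most a factor e^{2L}.
  set n := ⌈Real.log ((C + 1) * (1 + r)) / (2 * L)⌉₊ with hn
  have hn1 := Nat.le_ceil (Real.log ((C + 1) * (1 + r)) / (2 * L))
  have hn2 := Nat.ceil_lt_add_one h4
  rw [div_le_iff₀ hL2, ← hn] at hn1
  rw [← hn] at hn2
  have h5 : Real.exp (4 * L * n) ≤ Real.exp (4 * L) * (2 * (C + 1)) ^ 2 * r ^ 2 := by
    have h6 : 2 * L * n ≤ 2 * L + Real.log ((C + 1) * (1 + r)) := by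
      have := mul_lt_mul_of_pos_left hn2 hL2
      rw [mul_add (2 * L), mul_div_cancel₀ _ hL2.ne'] at this
      linarith
    have h7 : Real.exp (2 * L * n) ≤ Real.exp (2 * L) * ((C + 1) * (1 + r)) := by
      refine (Real.exp_le_exp.2 h6).trans_eq ?_
      rw [Real.exp_add, Real.exp_log (by linarith)]
    have h8 : Real.exp (2 * L * n) ≤ Real.exp (2 * L) * (2 * (C + 1) * r) := by
      refine h7.trans (mul_le_mul_of_nonneg_left ?_ (Real.exp_pos _).le)
      nlinarith
    have h9 := pow_le_pow_left₀ (Real.exp_pos _).le h8 2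
    rw [mul_pow, ← Real.exp_nat_mul, ← Real.exp_nat_mul] at h9
    convert! h9 using 1
    · congr 1; push_cast; ring
    · rw [mul_pow _ r, mul_assoc]; congr 2; push_cast; ring
  rw [ENNReal.div_le_iff (ENNReal.ofReal_pos.2 hr2).ne' ENNReal.ofReal_ne_top,
    ← ENNReal.ofReal_mul (by positivity)]
  refine (measure_mono fun x hx => ?_).trans ((hv n).trans (ENNReal.ofReal_le_ofReal ?_))
  · rw [Metric.mem_ball'] at hx
    have h6 : Real.exp |x.logMod| ≤ (C + 1) * (1 + r) :=
      (hd x).trans (mul_le_mul (by linarith) (by linarith) (by positivity) (by linarith))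
    rw [Set.mem_ofPred_eq, mul_comm]
    exact ((Real.le_log_iff_exp_le (by linarith)).2 h6).trans hn1
  · have := mul_le_mul_of_nonneg_left h5 hV.le
    linarith

/-- Translations move points by distances of at most exponential size. -/
lemma exists_dist_shift_le (h1 : 1 ≤ L) (p : ThetaSurface L) : ∃ D : ℝ, 0 < D ∧ ∀ (δ : ℤˣ) (k : ℕ),
    dist p (shift (δ * k) p) ≤ D * Real.exp (2 * L * k) := by
  refine ⟨dist p (shift 1 p) + dist p (shift (-1) p) + 1, by positivity, fun δ k => ?_⟩
  have hδ : dist p (shift δ p) ≤ dist p (shift 1 p) + dist p (shift (-1) p) + 1 := by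
    have := dist_nonneg (x := p) (y := shift 1 p)
    have := dist_nonneg (x := p) (y := shift (-1) p)
    obtain rfl | rfl := Int.units_eq_one_or δ
    · rw [Units.val_one]; linarith
    · rw [Units.val_neg, Units.val_one]; linarith
  have hδ' : |(((δ : ℤ) : ℝ))| = 1 := by
    obtain rfl | rfl := Int.units_eq_one_or δ <;> simp
  set D := dist p (shift 1 p) + dist p (shift (-1) p) + 1
  have hD : 0 ≤ D := dist_nonneg.trans hδ
  induction k with
  | zero => simpa [shift_zero] using hD
  | succ k ih =>
    -- The k-th jump is the first one stretched by at most e^{2Lk}; as e^{2L} ≥ 2, the jumps sum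
    -- geometrically.
    have h2 : shift (δ * (k + 1 : ℕ)) p = shift (δ * k) (shift δ p) := by
      rw [shift_shift]; push_cast; ring_nf
    have h3 := dist_shift_le (δ * k) p (shift δ p)
    push_cast at h3
    rw [abs_mul, hδ', one_mul, Nat.abs_cast] at h3
    rw [h2]
    have h4 := dist_triangle p (shift (δ * k) p) (shift (δ * k) (shift δ p))
    have e : Real.exp (2 * L * (k + 1 : ℕ)) = Real.exp (2 * L) * Real.exp (2 * L * k) := by
      rw [← Real.exp_add]; push_cast; ring_nf
    have e2 : 2 ≤ Real.exp (2 * L) := by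
      have := Real.add_one_le_exp (2 * L)
      linarith
    have h5 := mul_le_mul_of_nonneg_left hδ (Real.exp_pos (2 * L * k)).le
    have h6 := mul_nonneg hD (Real.exp_pos (2 * L * k)).le
    rw [e]
    nlinarith

/-- Translations away from the waist expand areas. -/
lemma area_le_of_image_subset (δ : ℤˣ) (k : ℕ) {A T : Set (ThetaSurface L)} (hA : MeasurableSet A)
    (h0 : ∀ x ∈ A, 0 ≤ (δ : ℤ) * x.logMod) (hT : ∀ x ∈ A, shift (δ * k) x ∈ T) :
    area (theta L) (weight L) A ≤
      ENNReal.ofReal (4 * Real.exp (-(4 * L * k))) * area (theta L) (weight L) T := by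
  have hδ : ((δ : ℤ) : ℝ) * (δ : ℤ) = 1 := by
    obtain rfl | rfl := Int.units_eq_one_or δ <;> simp
  have hc : ∀ t : ℝ, Real.cosh t = Real.cosh ((δ : ℤ) * t) := fun t => by
    obtain rfl | rfl := Int.units_eq_one_or δ <;> simp
  -- The inverse translation is used: seen from the far set `T`, it contracts lengths by at least
  -- e^{-2Lk} up to the factor 2, provided `A` lies on the side of the waist from which the
  -- translation moves away.
  refine (area_le_shift (-(δ * k)) (C := 2 * Real.exp (-(2 * L * k))) hA fun x hx => ?_).trans ?_
  · have h1 := h0 _ hx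
    rw [logMod_shift] at h1
    have h2 := cosh_le_exp_mul_cosh_add (u := 2 * L * k) h1
    rw [← hc] at h2
    refine h2.trans_eq ?_
    congr 1
    rw [hc x.logMod]
    congr 1
    push_cast
    linear_combination (-(2 * L * k)) * hδ
  · refine mul_le_mul' (le_of_eq ?_) (measure_mono fun x hx => ?_)
    · rw [mul_pow, ← Real.exp_nat_mul]
      congr 2
      · norm_num
      · congr 1; push_cast; ring
    · have := hT _ hx
      rwa [shift_shift_neg] at this

end ThetaSurface

end

/-! ### Lower bounds for areas of balls -/

noncomputable section

namespace ThetaSurface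
open Hyp
variable {L : ℝ}

/-- Compactness leaves finitely many balls of half the radius, each meeting `O` in positive measure;
every ball of radius ρ around a point of `K` contains one of them. -/
lemma exists_pos_le_measure_ball_inter {X : Type*} [PseudoMetricSpace X] [MeasurableSpace X]
    (μ : Measure X) [μ.IsOpenPosMeasure] {K O : Set X} (hK : IsCompact K) (hO : IsOpen O)
    (hKO : K ⊆ O) {ρ : ℝ} (hρ : 0 < ρ) :
    ∃ v : ℝ, 0 < v ∧ ∀ x ∈ K, ENNReal.ofReal v ≤ μ (Metric.ball x ρ ∩ O) := by
  obtain ⟨t, htK, htf, ht⟩ := hK.finite_cover_balls (half_pos hρ)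
  have h1 : ∀ x ∈ t, ∀ᶠ v : ℝ in 𝓝[>] 0, ENNReal.ofReal v ≤ μ (Metric.ball x (ρ / 2) ∩ O) := by
    intro x hx
    have hpos : 0 < μ (Metric.ball x (ρ / 2) ∩ O) :=
      (Metric.isOpen_ball.inter hO).measure_pos μ ⟨x, Metric.mem_ball_self (half_pos hρ), hKO (htK hx)⟩
    have h2 : Tendsto ENNReal.ofReal (𝓝[>] 0) (𝓝 (ENNReal.ofReal 0)) :=
      (ENNReal.continuous_ofReal.tendsto 0).mono_left nhdsWithin_le_nhds
    rw [ENNReal.ofReal_zero] at h2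
    exact (h2.eventually (gt_mem_nhds hpos)).mono fun v hv => hv.le
  obtain ⟨v, hv, hv0⟩ := (((Filter.eventually_all_finite htf).2 h1).and eventually_mem_nhdsWithin).exists
  refine ⟨v, hv0, fun x hx => ?_⟩
  obtain ⟨y, hy, hxy⟩ := Set.mem_iUnion₂.1 (ht hx)
  refine (hv y hy).trans (measure_mono (Set.inter_subset_inter_left _ (Metric.ball_subset_ball' ?_)))
  rw [Metric.mem_ball'] at hxy
  linarith

variable [hL : Fact (0 < L)]

/-- Coarse polar coordinates: every point far from the waist is the translate of a point of a
compact set. -/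
lemma exists_eq_shift {x : ThetaSurface L} (hx : 2 * L ≤ |x.logMod|) :
    ∃ (δ : ℤˣ) (k : ℕ) (y : ThetaSurface L), x = shift (δ * k) y ∧ 2 * L ≤ (δ : ℤ) * y.logMod ∧
      (δ : ℤ) * y.logMod ≤ 4 * L ∧ 2 * L * k ≤ |x.logMod| := by
  have hL2 : 0 < 2 * L := by linarith [hL.out]
  obtain ⟨δ, hδ⟩ : ∃ δ : ℤˣ, ((δ : ℤ) : ℝ) * x.logMod = |x.logMod| := by
    rcases abs_choice x.logMod with h | h
    · exact ⟨1, by rw [h]; simp⟩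
    · exact ⟨-1, by rw [h]; simp⟩
  have hδ2 : ((δ : ℤ) : ℝ) * (δ : ℤ) = 1 := by
    obtain rfl | rfl := Int.units_eq_one_or δ <;> simp
  have h0 : 0 ≤ (|x.logMod| - 2 * L) / (2 * L) := div_nonneg (by linarith) hL2.le
  -- Subtracting 2L before rounding leaves the remainder in [2L, 4L], strictly on one side of the
  -- waist, where outward translations expand areas.
  set k := ⌊(|x.logMod| - 2 * L) / (2 * L)⌋₊ with hk
  have h1 := Nat.floor_le h0
  have h2 := Nat.lt_floor_add_one ((|x.logMod| - 2 * L) / (2 * L))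
  rw [← hk, le_div_iff₀ hL2] at h1
  rw [← hk, div_lt_iff₀ hL2] at h2
  have h3 : ((δ : ℤ) : ℝ) * (shift (-(δ * k)) x).logMod = |x.logMod| - 2 * L * k := by
    rw [logMod_shift, ← hδ]
    push_cast
    linear_combination (-(2 * L * k)) * hδ2
  refine ⟨δ, k, shift (-(δ * k)) x, (shift_shift_neg _ _).symm, ?_, ?_, ?_⟩
  · rw [h3]; linarith
  · rw [h3]; linarith
  · linarith

/-- The lower bounds for the areas of balls. -/
lemma eventually_le_area_ball (h1 : 1 ≤ L) (p : ThetaSurface L) : ∃ c : ℝ, 0 < c ∧ ∀ᶠ r : ℝ in atTop,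
    ∀ m, dist p m = r → ENNReal.ofReal c ≤
      area (theta L) (weight L) (Metric.ball m (r / 2)) / ENNReal.ofReal (r ^ 2) := by
  have hL2 : 0 < 2 * L := by linarith
  obtain ⟨C, hC, hd⟩ := exists_exp_le p
  obtain ⟨D, hD, hs⟩ := exists_dist_shift_le h1 p
  have hcont : Continuous (logMod : ThetaSurface L → ℝ) := contMDiff_logMod.continuous
  obtain ⟨R, hR⟩ := (isCompact_logMod_le (F := theta L) (U := weight L) (4 * L)).isBounded.subset_closedBall p
  have hK : ∀ δ : ℤˣ, IsCompact {x : ThetaSurface L | 2 * L ≤ (δ : ℤ) * x.logMod ∧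
      (δ : ℤ) * x.logMod ≤ 4 * L} := fun δ => by
    refine (isCompact_logMod_le (F := theta L) (U := weight L) (4 * L)).of_isClosed_subset
      ((isClosed_le continuous_const (continuous_const.mul hcont)).inter
        (isClosed_le (continuous_const.mul hcont) continuous_const)) fun x hx => ?_
    have h2 : |((δ : ℤ) : ℝ) * x.logMod| = |x.logMod| := by
      obtain rfl | rfl := Int.units_eq_one_or δ <;> simp
    rw [Set.mem_ofPred_eq, ← h2, abs_of_nonneg (hL2.le.trans hx.1)]
    exact hx.2
  have hO : ∀ δ : ℤˣ, IsOpen {x : ThetaSurface L | 0 < (δ : ℤ) * x.logMod} := fun δ =>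
    isOpen_lt continuous_const (continuous_const.mul hcont)
  -- Since e^{2Lk} ≤ C(1 + r), a ρ-ball translated by k has radius at most (1 + r)/4, which is at
  -- most r/2 once r > 1.
  set ρ : ℝ := 1 / (4 * C)
  have hρ : 0 < ρ := by positivity
  choose v hv0 hv using fun δ : ℤˣ => exists_pos_le_measure_ball_inter (area (theta L) (weight L))
    (hK δ) (hO δ) (fun x hx => hL2.trans_le hx.1) hρ
  -- Controls r from above: the route from p through its own translate to m has length at most (D +
  -- |R|) e^{2Lk}.
  set c₁ := D + |R|
  have hc₁ : 0 < c₁ := by positivity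
  set v₀ := min (v 1) (v (-1))
  have hv₀ : 0 < v₀ := lt_min (hv0 _) (hv0 _)
  have hvv : ∀ δ, v₀ ≤ v δ := fun δ => by
    obtain rfl | rfl := Int.units_eq_one_or δ
    · exact min_le_left _ _
    · exact min_le_right _ _
  refine ⟨v₀ / (4 * c₁ ^ 2), by positivity, ?_⟩
  filter_upwards [eventually_gt_atTop R, eventually_gt_atTop 1] with r hrR hr1 m hm
  have hm2 : 2 * L ≤ |m.logMod| := by
    by_contra! hlt
    have := hR (show m ∈ {x : Hyp (theta L) (weight L) | |x.logMod| ≤ 4 * L} from by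
      rw [Set.mem_ofPred_eq]; linarith)
    rw [Metric.mem_closedBall'] at this
    linarith
  obtain ⟨δ, k, y, hmy, hy1, hy2, hkm⟩ := exists_eq_shift hm2
  have hδ' : |(((δ : ℤ) : ℝ))| = 1 := by
    obtain rfl | rfl := Int.units_eq_one_or δ <;> simp
  have hsh : ∀ a b : ThetaSurface L, dist (shift (δ * k) a) (shift (δ * k) b) ≤
      Real.exp (2 * L * k) * dist a b := fun a b => by
    have h3 := dist_shift_le (δ * k) a b
    push_cast at h3
    rwa [abs_mul, hδ', one_mul, Nat.abs_cast] at h3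
  have hE := Real.exp_pos (2 * L * k)
  have hr_le : r ≤ c₁ * Real.exp (2 * L * k) := by
    have h2 := dist_triangle p (shift (δ * k) p) (shift (δ * k) y)
    have h3 := hs δ k
    have h4 := hsh p y
    have h5 : dist p y ≤ |R| := by
      refine le_trans ?_ (le_abs_self R)
      rw [dist_comm]
      refine hR ?_
      have h2 : |((δ : ℤ) : ℝ) * y.logMod| = |y.logMod| := by rw [abs_mul, hδ', one_mul]
      rw [Set.mem_ofPred_eq, ← h2, abs_of_nonneg (hL2.le.trans hy1)]
      exact hy2
    rw [← hmy, hm] at h2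
    rw [← hmy] at h4
    have h6 := mul_le_mul_of_nonneg_left h5 hE.le
    simp only [c₁]
    linarith
  have hle_r : Real.exp (2 * L * k) * ρ ≤ r / 2 := by
    have h2 := (Real.exp_le_exp.2 hkm).trans (hd m)
    rw [hm] at h2
    rw [mul_one_div, div_le_iff₀ (by positivity)]
    nlinarith
  have hA := area_le_of_image_subset δ k (A := Metric.ball y ρ ∩ {x | 0 < (δ : ℤ) * x.logMod})
    (T := Metric.ball m (r / 2)) (Metric.isOpen_ball.inter (hO δ)).measurableSet
    (fun x hx => hx.2.le) (fun x hx => by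
      rw [Metric.mem_ball, hmy]
      have h2 := mul_lt_mul_of_pos_left (Metric.mem_ball.1 hx.1) hE
      exact (hsh x y).trans_lt (h2.trans_le hle_r))
  have h2 := ((ENNReal.ofReal_le_ofReal (hvv δ)).trans (hv δ y ⟨hy1, hy2⟩)).trans hA
  have hr2 : 0 < r ^ 2 := by positivity
  rw [ENNReal.le_div_iff_mul_le (Or.inl (ENNReal.ofReal_pos.2 hr2).ne') (Or.inl ENNReal.ofReal_ne_top)]
  have hF : 0 < 4 * Real.exp (-(4 * L * k)) := by positivity
  rw [mul_comm (ENNReal.ofReal _), ← ENNReal.div_le_iff_le_mul (Or.inl (ENNReal.ofReal_pos.2 hF).ne') (Or.inl ENNReal.ofReal_ne_top),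
    ← ENNReal.ofReal_div_of_pos hF] at h2
  refine le_trans ?_ h2
  rw [← ENNReal.ofReal_mul (by positivity)]
  refine ENNReal.ofReal_le_ofReal ?_
  have h3 := pow_le_pow_left₀ (by linarith) hr_le 2
  rw [mul_pow, ← Real.exp_nat_mul] at h3
  rw [Real.exp_neg]
  have e : Real.exp ((2 : ℕ) * (2 * L * k)) = Real.exp (4 * L * k) := by
    congr 1; push_cast; ring
  rw [e] at h3
  have h4 : v₀ / (4 * c₁ ^ 2) * r ^ 2 ≤ v₀ / (4 * c₁ ^ 2) * (c₁ ^ 2 * Real.exp (4 * L * k)) := by gcongr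
  refine h4.trans_eq ?_
  field_simp

/-- Translates of `p` escape to infinity, so on the connected surface distances take every
nonnegative value. This lets the bound for balls centred on spheres serve balls around the basepoint
too. -/
lemma exists_dist_eq (p : ThetaSurface L) {r : ℝ} (hr : 0 ≤ r) : ∃ m, dist p m = r := by
  have hL2 : 0 < 2 * L := by linarith [hL.out]
  obtain ⟨C, hC, hd⟩ := exists_exp_le p
  obtain ⟨x, hx⟩ : ∃ x, r ≤ dist p x := by
    obtain ⟨k, hk⟩ := exists_nat_ge ((C * (1 + r) - p.logMod) / (2 * L))
    refine ⟨shift k p, ?_⟩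
    have h1 := hd (shift k p)
    have h2 := Real.add_one_le_exp |(shift k p).logMod|
    have h3 := le_abs_self (shift k p).logMod
    rw [div_le_iff₀ hL2] at hk
    rw [logMod_shift] at h1 h2 h3
    push_cast at h1 h2 h3
    have : C * (1 + r) ≤ C * (1 + dist p (shift k p)) := by linarith
    have := le_of_mul_le_mul_left this hC
    linarith
  have h := intermediate_value_univ p x (f := fun m => dist p m) (by fun_prop)
  obtain ⟨m, hm⟩ := h ⟨by simpa using hr, hx⟩
  exact ⟨m, hm⟩

/-- The lower bound for the volume growth. -/
lemma eventually_le_area_ball_center (h1 : 1 ≤ L) (p : ThetaSurface L) : ∃ c : ℝ, 0 < c ∧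
    ∀ᶠ r : ℝ in atTop, ENNReal.ofReal c ≤
      area (theta L) (weight L) (Metric.ball p r) / ENNReal.ofReal (r ^ 2) := by
  obtain ⟨c, hc, h⟩ := eventually_le_area_ball h1 p
  refine ⟨c / 4, by positivity, ?_⟩
  filter_upwards [(tendsto_id.atTop_div_const two_pos).eventually h, eventually_gt_atTop 0] with
    r hr hr0
  -- The ball of radius r/4 about a point at distance r/2 lies inside the ball of radius r about p.
  obtain ⟨m, hm⟩ := exists_dist_eq p (r := r / 2) (by positivity)
  have h2 := hr m hm
  simp only [id] at h2
  have hr2 : 0 < (r / 2) ^ 2 := by positivity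
  have hr3 : 0 < r ^ 2 := by positivity
  rw [ENNReal.le_div_iff_mul_le (Or.inl (ENNReal.ofReal_pos.2 hr2).ne') (Or.inl ENNReal.ofReal_ne_top),
    ← ENNReal.ofReal_mul hc.le] at h2
  rw [ENNReal.le_div_iff_mul_le (Or.inl (ENNReal.ofReal_pos.2 hr3).ne') (Or.inl ENNReal.ofReal_ne_top),
    ← ENNReal.ofReal_mul (by positivity)]
  rw [show c / 4 * r ^ 2 = c * (r / 2) ^ 2 by ring]
  refine h2.trans (measure_mono (Metric.ball_subset_ball' ?_))
  rw [dist_comm, hm]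
  linarith

end ThetaSurface

end

/-! ### Lifting through coverings on surfaces of finite type -/

noncomputable section

/-- Continuous maps on a star-shaped set lift through surjective covering maps. -/
lemma IsCoveringMap.exists_continuousOn_lift_of_starConvex {E B V : Type*} [TopologicalSpace E]
    [TopologicalSpace B] {p : E → B} (hp : IsCoveringMap p) (hsurj : Function.Surjective p)
    [AddCommGroup V] [Module ℝ V] [TopologicalSpace V] [ContinuousAdd V] [ContinuousSub V]
    [ContinuousSMul ℝ V] {T : Set V} {c : V} (hT : StarConvex ℝ c T)
    {q : V → B} (hq : ContinuousOn q T) :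
    ∃ s : V → E, ContinuousOn s T ∧ ∀ y ∈ T, p (s y) = q y := by
  classical
  obtain ⟨e₀, he₀⟩ := hsurj (q c)
  have hmem (u : unitInterval × T) : c + (u.1 : ℝ) • ((u.2 : V) - c) ∈ T := by
    have := hT u.2.2 (sub_nonneg.2 u.1.2.2) u.1.2.1 (sub_add_cancel _ _)
    convert! this using 1
    rw [smul_sub, sub_smul, one_smul]
    abel
  -- The contraction to the centre is a homotopy starting at a constant map, which lifts; its
  -- time-one value is the required lift.
  let H : C(unitInterval × T, B) :=
    ⟨fun u => q (c + (u.1 : ℝ) • ((u.2 : V) - c)), by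
      refine hq.comp_continuous ?_ hmem
      fun_prop⟩
  have H0 (a : T) : H (0, a) = p (ContinuousMap.const T e₀ a) := by
    simp [H, he₀]
  let S := hp.liftHomotopy H (ContinuousMap.const T e₀) H0
  refine ⟨fun y => if h : y ∈ T then S (1, ⟨y, h⟩) else e₀, ?_, fun y hy => ?_⟩
  · rw [continuousOn_iff_continuous_domRestrict]
    have : Continuous fun y : T => S (1, y) := by fun_prop
    refine this.congr fun y => ?_
    simp [Set.domRestrict]
  · simp only [dif_pos hy]
    have := congr_fun (hp.liftHomotopy_lifts H (ContinuousMap.const T e₀) H0) (1, ⟨y, hy⟩)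
    refine Eq.trans this ?_
    simp [H]

/-- The open upper half plane, as a chart from the closed half plane to the plane. -/
def halfSpaceInteriorChart : OpenPartialHomeomorph (EuclideanHalfSpace 2) Plane where
  toFun y := y.1
  invFun y := if h : 0 ≤ y 0 then ⟨y, h⟩ else default
  source := {y | 0 < y.1 0}
  target := {y | 0 < y 0}
  map_source' _ h := h
  map_target' y h := by
    have h' : 0 < y 0 := h
    simpa [dif_pos h'.le] using h'
  left_inv' y h := by
    simp [y.2]
  right_inv' y h := by
    have h' : 0 < y 0 := h
    simp [dif_pos h'.le]
  open_source := by
    have : Continuous fun y : EuclideanHalfSpace 2 => y.1 0 :=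
      (PiLp.continuous_apply 2 _ 0).comp continuous_subtype_val
    exact isOpen_lt continuous_const this
  open_target := isOpen_lt continuous_const (PiLp.continuous_apply 2 _ 0)
  continuousOn_toFun := continuous_subtype_val.continuousOn
  continuousOn_invFun := by
    have hI : IsInducing (Subtype.val : EuclideanHalfSpace 2 → Plane) := .subtypeVal
    rw [hI.continuousOn_iff]
    refine continuousOn_id.congr fun y hy => ?_
    have h' : 0 < y 0 := hy
    simp [dif_pos h'.le]

section
variable {N : Type} [TopologicalSpace N]

lemma mem_surfaceInterior_of_chart_pos (e : OpenPartialHomeomorph N (EuclideanHalfSpace 2)) {x : N}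
    (hx : x ∈ e.source) (h : 0 < (e x).1 0) : x ∈ surfaceInterior N :=
  ⟨e.trans halfSpaceInteriorChart, by
    rw [OpenPartialHomeomorph.trans_source]
    exact ⟨hx, h⟩⟩

variable [ChartedSpace (EuclideanHalfSpace 2) N]

/-- Every point of a surface with boundary has small open neighbourhoods whose trace on the
interior is connected and simply connected, in the sense that all continuous maps lift through
covering maps. -/
lemma exists_isOpen_lift_surfaceInterior (x : N) {W : Set N} (hW : W ∈ 𝓝 x) :
    ∃ O, IsOpen O ∧ x ∈ O ∧ O ⊆ W ∧ IsPreconnected (O ∩ surfaceInterior N) ∧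
      ∀ {E B : Type} [TopologicalSpace E] [TopologicalSpace B] {p : E → B} (_ : IsCoveringMap p)
        (_ : Function.Surjective p) {q : N → B} (_ : ContinuousOn q (surfaceInterior N)),
        ∃ s : N → E, ContinuousOn s (O ∩ surfaceInterior N) ∧
          ∀ y ∈ O ∩ surfaceInterior N, p (s y) = q y := by
  classical
  let e := chartAt (EuclideanHalfSpace 2) x
  have hxe : x ∈ e.source := mem_chart_source _ x
  have h1 : e.target ∩ e.symm ⁻¹' W ∈ 𝓝 (e x) := by
    refine inter_mem (e.open_target.mem_nhds (e.map_source hxe)) ?_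
    exact (e.continuousAt_symm (e.map_source hxe)).preimage_mem_nhds (by rwa [e.left_inv hxe])
  obtain ⟨B, hB, hBs⟩ := mem_nhds_subtype _ _ _ |>.1 h1
  obtain ⟨r, hr, hrB⟩ := Metric.mem_nhds_iff.1 hB
  set y₀ : Plane := (e x).1 with hy₀
  let O : Set N := e.source ∩ e ⁻¹' (Subtype.val ⁻¹' Metric.ball y₀ r)
  have hOopen : IsOpen O :=
    e.isOpen_inter_preimage (Metric.isOpen_ball.preimage continuous_subtype_val)
  let inv : Plane → N := fun y => if h : 0 ≤ y 0 then e.symm ⟨y, h⟩ else x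
  -- Membership in `surfaceInterior N` is kept as a condition, so boundary points of the half-plane
  -- chart may or may not belong to `T` and invariance of domain is not needed.
  let T : Set Plane := {y | y ∈ Metric.ball y₀ r ∧ 0 ≤ y 0 ∧ inv y ∈ surfaceInterior N}
  have hsub (y : EuclideanHalfSpace 2) (hy : y.1 ∈ Metric.ball y₀ r) :
      y ∈ e.target ∧ e.symm y ∈ W := hBs (hrB hy)
  have hinv (y : EuclideanHalfSpace 2) : inv y.1 = e.symm y := by
    simp [inv, y.2]
  have hpos (y : Plane) (hy : y ∈ Metric.ball y₀ r) (h0 : 0 < y 0) : y ∈ T := by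
    refine ⟨hy, h0.le, ?_⟩
    have h2 := hsub ⟨y, h0.le⟩ hy
    have h3 := hinv ⟨y, h0.le⟩
    simp only at h3
    rw [h3]
    refine mem_surfaceInterior_of_chart_pos e (e.map_target h2.1) ?_
    rw [e.right_inv h2.1]
    exact h0
  set c : Plane := y₀ + EuclideanSpace.single 0 (r / 2) with hcdef
  have hc0 : 0 < c 0 := by
    have : 0 ≤ y₀ 0 := (e x).2
    simp [hcdef]
    positivity
  have hcball : c ∈ Metric.ball y₀ r := by
    simp [hcdef, abs_of_pos hr]
    linarith
  have hcT : c ∈ T := hpos c hcball hc0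
  -- The centre lies in the open half plane, so a segment from it to a point of `T` stays there
  -- except possibly at the endpoint, whichever boundary points `T` contains.
  have hstar : StarConvex ℝ c T := by
    intro y hy a b ha hb hab
    rcases ha.eq_or_lt with rfl | ha
    · have : b = 1 := by linarith
      simpa [this] using hy
    · refine hpos _ ((convex_ball y₀ r) hcball hy.1 ha.le hb hab) ?_
      have : 0 ≤ y 0 := hy.2.1
      simp only [PiLp.add_apply, PiLp.smul_apply, smul_eq_mul]
      positivity
  have hinvT : ContinuousOn inv T := by
    rw [continuousOn_iff_continuous_domRestrict]
    have hι : Continuous fun y : T => (⟨y.1, y.2.2.1⟩ : EuclideanHalfSpace 2) := by fun_prop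
    have : Continuous fun y : T => e.symm ⟨y.1, y.2.2.1⟩ :=
      e.continuousOn_symm.comp_continuous hι fun y => (hsub ⟨y.1, y.2.2.1⟩ y.2.1).1
    refine this.congr fun y => ?_
    exact (hinv ⟨y.1, y.2.2.1⟩).symm
  have hmaps : ∀ n ∈ O ∩ surfaceInterior N, (e n).1 ∈ T ∧ inv (e n).1 = n := by
    rintro n ⟨⟨hn1, hn2⟩, hn3⟩
    have : inv (e n).1 = n := by rw [hinv, e.left_inv hn1]
    exact ⟨⟨hn2, (e n).2, by rwa [this]⟩, this⟩
  have himage : inv '' T = O ∩ surfaceInterior N := by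
    apply Set.Subset.antisymm
    · rintro _ ⟨y, hy, rfl⟩
      have h2 := hsub ⟨y, hy.2.1⟩ hy.1
      have h3 := hinv ⟨y, hy.2.1⟩
      simp only at h3
      refine ⟨?_, hy.2.2⟩
      rw [h3]
      refine ⟨e.map_target h2.1, ?_⟩
      change (e _).1 ∈ Metric.ball y₀ r
      rw [e.right_inv h2.1]
      exact hy.1
    · intro n hn
      exact ⟨_, (hmaps n hn).1, (hmaps n hn).2⟩
  refine ⟨O, hOopen, ⟨hxe, Metric.mem_ball_self hr⟩, ?_, ?_, ?_⟩
  · rintro n ⟨hn1, hn2⟩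
    have := (hsub (e n) hn2).2
    rwa [e.left_inv hn1] at this
  · rw [← himage]
    exact (hstar.isPathConnected hcT).isConnected.isPreconnected.image inv hinvT
  · intro E B _ _ p hp hs q hq
    have hqT : ContinuousOn (fun y => q (inv y)) T := hq.comp hinvT fun y hy => hy.2.2
    obtain ⟨s, hs1, hs2⟩ := hp.exists_continuousOn_lift_of_starConvex hs hstar hqT
    refine ⟨fun n => s (e n).1, ?_, fun n hn => ?_⟩
    · refine hs1.comp ?_ fun n hn => (hmaps n hn).1
      exact continuous_subtype_val.comp_continuousOn
        (e.continuousOn.mono fun n hn => hn.1.1)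
    · rw [hs2 _ (hmaps n hn).1, (hmaps n hn).2]

end

noncomputable section

/-- Two lifts over a connected set differ by an element of the deck group. -/
lemma IsQuotientCoveringMap.exists_smul_eqOn {E B G N : Type*} [TopologicalSpace E]
    [TopologicalSpace B] [Group G] [MulAction G E] [TopologicalSpace N] {p : E → B}
    (hp : IsQuotientCoveringMap p G) {S : Set N} (hS : IsPreconnected S) {s t : N → E}
    (hs : ContinuousOn s S) (ht : ContinuousOn t S) (h : ∀ n ∈ S, p (s n) = p (t n)) :
    ∃ g : G, ∀ n ∈ S, s n = g • t n := by
  rcases S.eq_empty_or_nonempty with rfl | ⟨n₀, hn₀⟩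
  · exact ⟨1, by simp⟩
  have := hp.toContinuousConstSMul
  obtain ⟨g, hg⟩ := hp.apply_eq_iff_mem_orbit.1 (h n₀ hn₀)
  refine ⟨g, hp.isCoveringMap.eqOn_of_comp_eqOn hS hs (ht.const_smul g) (fun n hn => ?_) hn₀ hg.symm⟩
  simp only [Function.comp_apply, hp.map_smul]
  exact h n hn

/-- On a surface of finite type, any sequence of maps into the base of a finite Galois covering has
two terms for which the obstructions to lifting cancel. -/
theorem exists_ne_continuousOn_of_isQuotientCoveringMap {N : Type} [TopologicalSpace N]
    [ChartedSpace (EuclideanHalfSpace 2) N] [CompactSpace N] [T2Space N]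
    {E B G A : Type} [TopologicalSpace E] [TopologicalSpace B] [Group G] [Finite G] [MulAction G E]
    [TopologicalSpace A] [Nonempty A] {p : E → B} (hp : IsQuotientCoveringMap p G)
    {q : ℕ → N → B} (hq : ∀ k, ContinuousOn (q k) (surfaceInterior N))
    {m : E × E → A} (hm : Continuous m) (hinv : ∀ (g : G) (u v : E), m (g • u, g • v) = m (u, v)) :
    ∃ k l, k ≠ l ∧ ∃ h : N → A, ContinuousOn h (surfaceInterior N) ∧
      ∀ n ∈ surfaceInterior N, ∃ u v, p u = q k n ∧ p v = q l n ∧ h n = m (u, v) := by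
  classical
  have hnice := fun (x : N) (W : Set N) (hW : W ∈ 𝓝 x) => exists_isOpen_lift_surfaceInterior x hW
  choose U hUo hxU hUW hUc hUl using fun x : N => hnice x Set.univ univ_mem
  have hK (x : N) : ∃ K, IsClosed K ∧ K ∈ 𝓝 x ∧ K ⊆ U x := by
    obtain ⟨K, hK, hKc, hKU⟩ := exists_mem_nhds_isClosed_subset ((hUo x).mem_nhds (hxU x))
    exact ⟨K, hKc, hK, hKU⟩
  choose K hKc hKn hKU using hK
  obtain ⟨I, hI⟩ := CompactSpace.elim_nhds_subcover (fun x => interior (K x))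
    fun x => isOpen_interior.mem_nhds (mem_interior_iff_mem_nhds.2 (hKn x))
  -- This neighbourhood meets `K a` only if x lies in `K a`, and is then inside `U a`. Hence a small
  -- set `O c` meeting `K a` is contained in `U a`, where the lift indexed by `a` is defined.
  let W (x : N) : Set N := ⋂ a ∈ I, if x ∈ K a then U a else (K a)ᶜ
  have hW (x : N) : W x ∈ 𝓝 x := by
    refine (Filter.biInter_finset_mem I).2 fun a _ => ?_
    split_ifs with h
    · exact (hUo a).mem_nhds (hKU a h)
    · exact (hKc a).isOpen_compl.mem_nhds h
  choose O hOo hxO hOW hOc _ using fun x : N => hnice x (W x) (hW x)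
  obtain ⟨J, hJ⟩ := CompactSpace.elim_nhds_subcover O fun x => (hOo x).mem_nhds (hxO x)
  have hOU (c a : N) (ha : a ∈ I) (n : N) (hn : n ∈ O c) (hna : n ∈ K a) : O c ⊆ U a := by
    have h1 : W c ⊆ if c ∈ K a then U a else (K a)ᶜ := Set.biInter_subset_of_mem ha
    split_ifs at h1 with h
    · exact (hOW c).trans h1
    · exact absurd hna (h1 (hOW c hn))
  choose s hs hsq using fun (k : ℕ) (a : N) =>
    hUl a hp.isCoveringMap hp.surjective (hq k)
  have hsign (k : ℕ) (c a b : N) : ∃ g : G, O c ⊆ U a → O c ⊆ U b →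
      ∀ n ∈ O c ∩ surfaceInterior N, s k a n = g • s k b n := by
    by_cases h : O c ⊆ U a ∧ O c ⊆ U b
    · obtain ⟨g, hg⟩ := hp.exists_smul_eqOn (hOc c)
        ((hs k a).mono (Set.inter_subset_inter_left _ h.1))
        ((hs k b).mono (Set.inter_subset_inter_left _ h.2)) (fun n hn => by
          rw [hsq k a n ⟨h.1 hn.1, hn.2⟩, hsq k b n ⟨h.2 hn.1, hn.2⟩])
      exact ⟨g, fun _ _ => hg⟩
    · exact ⟨1, fun h1 h2 => absurd ⟨h1, h2⟩ h⟩
  choose g hg using hsign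
  -- The finite cover is independent of the map, so the comparison elements form a function from one
  -- finite set to the finite group `G`; two of infinitely many maps share it.
  obtain ⟨k, l, hkl, hgkl⟩ := Finite.exists_ne_map_eq_of_infinite
    fun (k : ℕ) (t : J × I × I) => g k t.1 t.2.1 t.2.2
  have hcov (n : N) : ∃ a ∈ I, n ∈ interior (K a) := by
    have : n ∈ ⋃ x ∈ I, interior (K x) := hI ▸ Set.mem_univ n
    simpa using this
  choose a haI haK using hcov
  -- Changing the index from `a n` to `b` multiplies both lifts by the same group element, which the
  -- invariance of `m` cancels.
  have hwd (n : N) (hn : n ∈ surfaceInterior N) (b : N) (hb : b ∈ I) (hnb : n ∈ K b) :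
      m (s k (a n) n, s l (a n) n) = m (s k b n, s l b n) := by
    obtain ⟨c, hc, hnc⟩ : ∃ c ∈ J, n ∈ O c := by
      have : n ∈ ⋃ x ∈ J, O x := hJ ▸ Set.mem_univ n
      simpa using this
    have h1 := hOU c (a n) (haI n) n hnc (interior_subset (haK n))
    have h2 := hOU c b hb n hnc hnb
    have h3 : g k c (a n) b = g l c (a n) b :=
      congr_fun hgkl (⟨c, hc⟩, ⟨a n, haI n⟩, ⟨b, hb⟩)
    rw [hg k c (a n) b h1 h2 n ⟨hnc, hn⟩, hg l c (a n) b h1 h2 n ⟨hnc, hn⟩, h3, hinv]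
  refine ⟨k, l, hkl, fun n => m (s k (a n) n, s l (a n) n), fun n hn => ?_, fun n hn => ?_⟩
  · have hloc : ContinuousOn (fun y => m (s k (a n) y, s l (a n) y))
        (U (a n) ∩ surfaceInterior N) := hm.comp_continuousOn ((hs k _).prodMk (hs l _))
    have hnU : n ∈ U (a n) := hKU _ (interior_subset (haK n))
    have h1 : ContinuousWithinAt (fun y => m (s k (a n) y, s l (a n) y)) (surfaceInterior N) n :=
      (hloc n ⟨hnU, hn⟩).mono_of_mem_nhdsWithin
        (inter_mem (mem_nhdsWithin_of_mem_nhds ((hUo _).mem_nhds hnU)) self_mem_nhdsWithin)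
    refine h1.congr_of_eventuallyEq ?_ rfl
    filter_upwards [self_mem_nhdsWithin,
      mem_nhdsWithin_of_mem_nhds (isOpen_interior.mem_nhds (haK n))] with y hy hyK
    exact hwd y hy _ (haI n) (interior_subset hyK)
  · have hnU : n ∈ U (a n) := hKU _ (interior_subset (haK n))
    exact ⟨_, _, hsq k _ n ⟨hnU, hn⟩, hsq l _ n ⟨hnU, hn⟩, rfl⟩

end

/-! ### Pairs of square roots and the antipodal quotient of ℂ² ∖ {0} -/

noncomputable section

/-- The punctured space `ℂ² ∖ {0}`. -/
def PuncturedSpace : Type := {v : ℂ × ℂ // v ≠ 0}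

namespace PuncturedSpace

instance : TopologicalSpace PuncturedSpace := inferInstanceAs (TopologicalSpace {v : ℂ × ℂ // v ≠ 0})
instance : T2Space PuncturedSpace := inferInstanceAs (T2Space {v : ℂ × ℂ // v ≠ 0})
instance : LocallyCompactSpace PuncturedSpace :=
  IsOpen.locallyCompactSpace (isOpen_ne : IsOpen {v : ℂ × ℂ | v ≠ 0})

/-- The inclusion into `ℂ²`. -/
def val (v : PuncturedSpace) : ℂ × ℂ := Subtype.val v

/-- A nonzero vector as a point of the punctured space. -/
def mk (v : ℂ × ℂ) (hv : v ≠ 0) : PuncturedSpace := ⟨v, hv⟩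

@[simp] lemma val_mk (v : ℂ × ℂ) (hv : v ≠ 0) : (mk v hv).val = v := rfl

lemma continuous_val : Continuous val := continuous_subtype_val

lemma val_injective : Function.Injective val := Subtype.val_injective

instance : MulAction ℤˣ PuncturedSpace where
  smul g v := ⟨((g : ℤ) : ℂ) • v.val, smul_ne_zero (by exact_mod_cast g.ne_zero) v.2⟩
  one_smul v := by
    apply val_injective
    change (((1 : ℤˣ) : ℤ) : ℂ) • v.val = v.val
    simp
  mul_smul g h v := by
    apply val_injective
    change (((g * h : ℤˣ) : ℤ) : ℂ) • v.val = ((g : ℤ) : ℂ) • ((h : ℤ) : ℂ) • v.val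
    rw [smul_smul]
    push_cast
    rfl

lemma val_smul (g : ℤˣ) (v : PuncturedSpace) : (g • v).val = ((g : ℤ) : ℂ) • v.val := rfl

lemma val_smul_eq (g : ℤˣ) (v : PuncturedSpace) : (g • v).val = v.val ∨ (g • v).val = -v.val := by
  rw [val_smul]
  rcases Int.units_eq_one_or g with rfl | rfl <;> simp

instance : ContinuousConstSMul ℤˣ PuncturedSpace where
  continuous_const_smul g := (continuous_val.const_smul ((g : ℤ) : ℂ)).subtype_mk _

instance : IsCancelSMul ℤˣ PuncturedSpace := by
  rw [isCancelSMul_iff_eq_one_of_smul_eq]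
  intro g v h
  rcases Int.units_eq_one_or g with rfl | rfl
  · rfl
  · have h1 := congrArg val h
    rw [val_smul] at h1
    simp only [Units.val_neg, Units.val_one, Int.cast_neg, Int.cast_one, neg_smul, one_smul,
      neg_eq_self] at h1
    exact absurd h1 v.2

/-- The quotient of `ℂ² ∖ {0}` by the antipodal involution. -/
abbrev Cone : Type := Quotient (MulAction.orbitRel ℤˣ PuncturedSpace)

/-- The projection to the quotient. -/
def proj (v : PuncturedSpace) : Cone := Quotient.mk _ v

lemma isQuotientCoveringMap_proj : IsQuotientCoveringMap proj ℤˣ :=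
  isQuotientCoveringMap_quotientMk_of_properlyDiscontinuousSMul

/-- The projection to the quotient, extended by an arbitrary value at the origin. -/
def toCone (v : ℂ × ℂ) : Cone :=
  open Classical in if h : v ≠ 0 then proj (mk v h) else proj (mk (1, 0) (by simp))

lemma toCone_of_ne_zero {v : ℂ × ℂ} (hv : v ≠ 0) : toCone v = proj (mk v hv) := dif_pos hv

lemma continuousAt_toCone {v : ℂ × ℂ} (hv : v ≠ 0) : ContinuousAt toCone v := by
  have : ContinuousOn toCone {0}ᶜ := by
    rw [continuousOn_iff_continuous_domRestrict]
    refine Continuous.congr (f := fun v : ({0}ᶜ : Set (ℂ × ℂ)) => proj (mk v.1 v.2))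
      (isQuotientCoveringMap_proj.continuous.comp (continuous_subtype_val.subtype_mk _))
      fun v => (toCone_of_ne_zero v.2).symm
  exact this.continuousAt (isOpen_ne.mem_nhds hv)

lemma toCone_neg {v : ℂ × ℂ} (hv : v ≠ 0) : toCone (-v) = toCone v := by
  have h : mk (-v) (neg_ne_zero.2 hv) = (-1 : ℤˣ) • mk v hv := by
    apply val_injective
    simp [val_smul]
  rw [toCone_of_ne_zero hv, toCone_of_ne_zero (neg_ne_zero.2 hv), h,
    isQuotientCoveringMap_proj.map_smul]

lemma eq_or_eq_neg_of_proj_eq {u : PuncturedSpace} {v : ℂ × ℂ} (hv : v ≠ 0)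
    (h : proj u = toCone v) : u.val = v ∨ u.val = -v := by
  rw [toCone_of_ne_zero hv] at h
  obtain ⟨g, rfl⟩ := isQuotientCoveringMap_proj.apply_eq_iff_mem_orbit.1 h
  exact val_smul_eq g (mk v hv)

end PuncturedSpace

namespace Hyp
variable {F : ℂ → ℂ} {U : ℝ → ℝ}
open PuncturedSpace

/-- `v` is a pair of square roots of `z - a` and `F z / (z - a)` with product `w`. -/
def IsRootPair (a : ℂ) (x : Hyp F U) (v : ℂ × ℂ) : Prop :=
  v.1 ^ 2 = x.z - a ∧ v.2 ^ 2 = dslope F a x.z ∧ v.1 * v.2 = x.w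

/-- Prescribing the product `w` ties the two signs together, leaving only a common sign. -/
lemma IsRootPair.eq_or_eq_neg {a : ℂ} {x : Hyp F U} {u v : ℂ × ℂ} (hu : IsRootPair a x u)
    (hv : IsRootPair a x v) : u = v ∨ u = -v := by
  obtain ⟨hu1, hu2, hu3⟩ := hu
  obtain ⟨hv1, hv2, hv3⟩ := hv
  have h1 : u.1 = v.1 ∨ u.1 = -v.1 := sq_eq_sq_iff_eq_or_eq_neg.1 (hu1.trans hv1.symm)
  have h2 : u.2 = v.2 ∨ u.2 = -v.2 := sq_eq_sq_iff_eq_or_eq_neg.1 (hu2.trans hv2.symm)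
  have h3 : u.1 * u.2 = v.1 * v.2 := hu3.trans hv3.symm
  by_cases hz : v.1 = 0
  · have h0 : u.1 = 0 := by simpa [hz] using h1
    rcases h2 with h2 | h2
    · exact Or.inl (Prod.ext (h0.trans hz.symm) h2)
    · exact Or.inr (Prod.ext (by simp [h0, hz]) h2)
  · rcases h1 with h1 | h1 <;> rw [h1] at h3
    · left
      exact Prod.ext h1 (mul_left_cancel₀ hz h3)
    · right
      refine Prod.ext h1 (mul_left_cancel₀ (neg_ne_zero.2 hz) ?_)
      rw [h3]
      simp

variable [HypData F U]

/-- Since the zero `a` of `F` is simple, z - a and F/(z - a) have no common zero; hence a root pair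
is never the origin. -/
lemma dslope_zero_ne (U : ℝ → ℝ) [HypData F U] {a z : ℂ} (ha : a ≠ 0) (hFa : F a = 0)
    (h : z - a = 0) : dslope F a z ≠ 0 := by
  rw [sub_eq_zero.1 h, dslope_same]
  exact HypData.deriv_ne_zero (F := F) U a ha hFa

lemma IsRootPair.ne_zero {a : ℂ} (ha : a ≠ 0) (hFa : F a = 0) {x : Hyp F U} {v : ℂ × ℂ}
    (hv : IsRootPair a x v) : v ≠ 0 := by
  rintro rfl
  refine dslope_zero_ne U ha hFa (z := x.z) ?_ ?_
  · simpa using hv.1.symm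
  · simpa using hv.2.1.symm

/-- One of the two factors is nonzero near x₀: take a root of it that is continuous at x₀ and obtain
the other root by dividing `w`. This also covers the branch point over `a`. -/
lemma exists_isRootPair {a : ℂ} (ha : a ≠ 0) (hFa : F a = 0) (x₀ : Hyp F U) :
    ∃ v : Hyp F U → ℂ × ℂ, ContinuousAt v x₀ ∧ ∀ᶠ x in 𝓝 x₀, IsRootPair a x (v x) := by
  have hfac (x : Hyp F U) : (x.z - a) * dslope F a x.z = x.w ^ 2 := by
    rw [← smul_eq_mul, sub_smul_dslope, hFa, sub_zero, w_sq]
  have hψ : Continuous fun x : Hyp F U => dslope F a x.z := by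
    have : ContinuousOn (dslope F a) {0}ᶜ :=
      (continuousOn_dslope (isOpen_compl_singleton.mem_nhds ha)).2
        ⟨HypData.differentiableOn (F := F) U |>.continuousOn,
          (HypData.differentiableOn (F := F) U).differentiableAt
            (isOpen_compl_singleton.mem_nhds ha)⟩
    exact this.comp_continuous continuous_z fun x => x.z_ne_zero
  have hφ : Continuous fun x : Hyp F U => x.z - a := continuous_z.sub continuous_const
  by_cases h : x₀.z - a = 0
  · have h' := dslope_zero_ne U ha hFa h
    obtain ⟨b, hb⟩ := IsAlgClosed.exists_pow_nat_eq (dslope F a x₀.z) two_pos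
    obtain ⟨r, hr, -, hrc⟩ := exists_sqrt_continuousAt b
    rw [hb] at hrc
    have hb0 : r (dslope F a x₀.z) ≠ 0 := fun h0 => h' (by rw [← hr (dslope F a x₀.z), h0]; simp)
    have hc : ContinuousAt (fun x : Hyp F U => r (dslope F a x.z)) x₀ :=
      ContinuousAt.comp (f := fun x : Hyp F U => dslope F a x.z) hrc hψ.continuousAt
    refine ⟨fun x => (x.w / r (dslope F a x.z), r (dslope F a x.z)),
      (continuous_w.continuousAt.div hc hb0).prodMk hc, ?_⟩
    filter_upwards [hψ.continuousAt.eventually_ne h'] with x hx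
    have hx0 : r (dslope F a x.z) ≠ 0 := fun h0 => hx (by rw [← hr (dslope F a x.z), h0]; simp)
    refine ⟨?_, hr _, div_mul_cancel₀ _ hx0⟩
    simp only
    rw [div_pow, hr, ← hfac, mul_div_cancel_right₀ _ hx]
  · obtain ⟨b, hb⟩ := IsAlgClosed.exists_pow_nat_eq (x₀.z - a) two_pos
    obtain ⟨r, hr, -, hrc⟩ := exists_sqrt_continuousAt b
    rw [hb] at hrc
    have hb0 : r (x₀.z - a) ≠ 0 := fun h0 => h (by rw [← hr (x₀.z - a), h0]; simp)
    have hc : ContinuousAt (fun x : Hyp F U => r (x.z - a)) x₀ :=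
      ContinuousAt.comp (f := fun x : Hyp F U => x.z - a) hrc hφ.continuousAt
    refine ⟨fun x => (r (x.z - a), x.w / r (x.z - a)),
      hc.prodMk (continuous_w.continuousAt.div hc hb0), ?_⟩
    filter_upwards [hφ.continuousAt.eventually_ne h] with x hx
    have hx0 : r (x.z - a) ≠ 0 := fun h0 => hx (by rw [← hr (x.z - a), h0]; simp)
    refine ⟨hr _, ?_, mul_div_cancel₀ _ hx0⟩
    simp only
    rw [div_pow, hr, ← hfac, mul_div_cancel_left₀ _ hx]

/-- The map to the antipodal quotient of `ℂ² ∖ {0}` given by the pairs of square roots of `z - a`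
and `F z / (z - a)`. -/
lemma exists_continuous_toCone {a : ℂ} (ha : a ≠ 0) (hFa : F a = 0) :
    ∃ q : Hyp F U → Cone, Continuous q ∧
      ∀ (x : Hyp F U) (u : PuncturedSpace), proj u = q x → u.val.1 ^ 2 = x.z - a := by
  have hex (x : Hyp F U) : ∃ v, IsRootPair a x v := by
    obtain ⟨v, -, hv⟩ := exists_isRootPair ha hFa x
    exact ⟨_, hv.self_of_nhds⟩
  choose v hv using hex
  refine ⟨fun x => toCone (v x), continuous_iff_continuousAt.2 fun x => ?_, fun x u hu => ?_⟩
  · obtain ⟨v', hvc, hv'⟩ := exists_isRootPair ha hFa x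
    have h0 : v' x ≠ 0 := hv'.self_of_nhds.ne_zero ha hFa
    have h1 : ContinuousAt (fun y => toCone (v' y)) x :=
      ContinuousAt.comp (f := v') (continuousAt_toCone h0) hvc
    refine h1.congr ?_
    filter_upwards [hv'] with y hy
    have hy0 := (hv y).ne_zero ha hFa
    rcases hy.eq_or_eq_neg (hv y) with h | h
    · rw [h]
    · rw [h, toCone_neg hy0]
  · rw [← (hv x).1]
    rcases eq_or_eq_neg_of_proj_eq ((hv x).ne_zero ha hFa) hu with h | h <;> simp [h]

/-- The product of the first coordinates of two root pairs is unchanged when both pairs change sign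
together, so it descends for two branch points with the same sign pattern. The pairs are nonzero at
branch points, hence no point of the curve is removed. -/
theorem exists_sqrt_of_hasFiniteTopologicalType (hfin : HasFiniteTopologicalType (Hyp F U))
    {a : ℕ → ℂ} (ha : ∀ k, a k ≠ 0) (hFa : ∀ k, F (a k) = 0) :
    ∃ k l, k ≠ l ∧ ∃ h : Hyp F U → ℂ, Continuous h ∧ ∀ x, h x ^ 2 = (x.z - a k) * (x.z - a l) := by
  classical
  obtain ⟨N, _, _, _, _, ⟨e⟩⟩ := hfin
  choose q hqc hq using fun k => exists_continuous_toCone (U := U) (ha k) (hFa k)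
  let q' (k : ℕ) (n : N) : Cone :=
    if h : n ∈ surfaceInterior N then q k (e.symm ⟨n, h⟩) else toCone (1, 0)
  have hq' (k : ℕ) (n : surfaceInterior N) : q' k n = q k (e.symm n) := by
    simp only [q', dif_pos n.2]
  have hqc' (k : ℕ) : ContinuousOn (q' k) (surfaceInterior N) := by
    rw [continuousOn_iff_continuous_domRestrict]
    exact ((hqc k).comp e.symm.continuous).congr fun n => (hq' k n).symm
  obtain ⟨k, l, hkl, h, hc, hh⟩ := exists_ne_continuousOn_of_isQuotientCoveringMap
    isQuotientCoveringMap_proj hqc' (m := fun u => u.1.val.1 * u.2.val.1)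
    (by
      have := PuncturedSpace.continuous_val
      fun_prop)
    (fun g u v => by
      simp only [val_smul]
      rcases Int.units_eq_one_or g with rfl | rfl <;> simp)
  refine ⟨k, l, hkl, fun x => h (e x), ?_, fun x => ?_⟩
  · exact hc.comp_continuous (continuous_subtype_val.comp e.continuous) fun x => (e x).2
  · obtain ⟨u, v, hu, hv, hm⟩ := hh (e x) (e x).2
    rw [hq', e.symm_apply_apply] at hu hv
    simp only at hm ⊢
    rw [hm, mul_pow, hq k x u hu, hq l x v hv]

end Hyp

end

/-! ### Monodromy around two neighbouring branch points -/

noncomputable section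

/-- A nonvanishing continuous function on a star-shaped set has a continuous square root. -/
lemma StarConvex.exists_continuousOn_sqrt {T : Set ℂ} {c : ℂ} (hT : StarConvex ℝ c T)
    {f : ℂ → ℂ} (hf : ContinuousOn f T) (h0 : ∀ z ∈ T, f z ≠ 0) :
    ∃ g : ℂ → ℂ, ContinuousOn g T ∧ ∀ z ∈ T, g z ^ 2 = f z := by
  classical
  let q : ℂ → {x : ℂ // x ≠ 0} := fun z => if h : f z ≠ 0 then ⟨f z, h⟩ else ⟨1, one_ne_zero⟩
  have hqv (z : ℂ) (hz : z ∈ T) : (q z : ℂ) = f z := by simp [q, h0 z hz]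
  have hq : ContinuousOn q T := by
    have hI : IsInducing (Subtype.val : {x : ℂ // x ≠ 0} → ℂ) := .subtypeVal
    rw [hI.continuousOn_iff]
    exact hf.congr hqv
  obtain ⟨s, hs, hsq⟩ := (isCoveringMap_npow (𝕜 := ℂ) 2
    two_ne_zero).exists_continuousOn_lift_of_starConvex (fun x => by
      obtain ⟨y, hy⟩ := IsAlgClosed.exists_pow_nat_eq x.1 two_pos
      have hy0 : y ≠ 0 := by
        rintro rfl
        exact x.2 (by simpa using hy.symm)
      exact ⟨⟨y, hy0⟩, Subtype.ext hy⟩) hT hq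
  refine ⟨fun z => s z, continuous_subtype_val.comp_continuousOn hs, fun z hz => ?_⟩
  rw [← hqv z hz, ← hsq z hz]

/-- A holomorphic function on a convex domain with exactly two zeros, both simple, is the square of
a continuous function up to the obvious quadratic factor. -/
lemma exists_continuousOn_eq_mul_sq {T : Set ℂ} (hTo : IsOpen T) (hT : Convex ℝ T) {f : ℂ → ℂ}
    (hf : DifferentiableOn ℂ f T) {a b : ℂ} (ha : a ∈ T) (hb : b ∈ T) (hab : a ≠ b) (hfa : f a = 0)
    (hfb : f b = 0) (hda : deriv f a ≠ 0) (hdb : deriv f b ≠ 0)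
    (hz : ∀ z ∈ T, f z = 0 → z = a ∨ z = b) :
    ∃ g : ℂ → ℂ, ContinuousOn g T ∧ ∀ z ∈ T, f z = (z - a) * (z - b) * g z ^ 2 := by
  have h1 : DifferentiableOn ℂ (dslope f a) T :=
    (Complex.differentiableOn_dslope (hTo.mem_nhds ha)).2 hf
  have h2 : DifferentiableOn ℂ (dslope (dslope f a) b) T :=
    (Complex.differentiableOn_dslope (hTo.mem_nhds hb)).2 h1
  have e1 (z : ℂ) : (z - a) * dslope f a z = f z := by
    rw [← smul_eq_mul, sub_smul_dslope, hfa, sub_zero]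
  have hb0 : dslope f a b = 0 := by
    have := e1 b
    rw [hfb, mul_eq_zero] at this
    exact this.resolve_left (sub_ne_zero.2 hab.symm)
  have e2 (z : ℂ) : (z - b) * dslope (dslope f a) b z = dslope f a z := by
    rw [← smul_eq_mul, sub_smul_dslope, hb0, sub_zero]
  obtain ⟨g, hg, hgs⟩ := (hT.starConvex ha).exists_continuousOn_sqrt h2.continuousOn
    (fun z hzT h0 => by
      have h3 : dslope f a z = 0 := by rw [← e2, h0, mul_zero]
      rcases hz z hzT (by rw [← e1, h3, mul_zero]) with rfl | rfl
      · rw [dslope_same] at h3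
        exact hda h3
      · rw [dslope_same] at h0
        have h4 : HasDerivAt (dslope f a) 0 z :=
          h0 ▸ (h1.differentiableAt (hTo.mem_nhds hb)).hasDerivAt
        have h5 := ((hasDerivAt_id z).sub_const a).mul h4
        have h6 : HasDerivAt f 0 z := by
          refine (h5.congr_of_eventuallyEq (Eventually.of_forall fun y => ?_)).congr_deriv ?_
          · exact (e1 y).symm
          · simp [hb0]
        exact hdb h6.deriv)
  exact ⟨g, hg, fun z hzT => by rw [hgs z hzT, mul_assoc, e2, e1]⟩

namespace Hyp
variable {F : ℂ → ℂ} {U : ℝ → ℝ} [HypData F U]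

/-- A loop around two neighbouring branch points obstructs square roots of `(z - a) (z - p)`, where
`a` is one of the two branch points and `p` lies outside the loop. -/
lemma false_of_sq_eq {A B a b p : ℝ} (hBb : B < b) (hba : b < a) (haA : a < A) (hA : A ≤ 0)
    (hp : A ≤ p) (hFa : F a = 0) (hFb : F b = 0)
    (hz : ∀ z : ℂ, B < z.re → z.re < A → F z = 0 → z = a ∨ z = b)
    {h : Hyp F U → ℂ} (hc : Continuous h) (hh : ∀ x, h x ^ 2 = (x.z - a) * (x.z - p)) : False := by
  set T : Set ℂ := {z | z.re ∈ Set.Ioo B A} with hTdef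
  have hTo : IsOpen T := isOpen_Ioo.preimage Complex.continuous_re
  have hTc : Convex ℝ T := (convex_Ioo B A).linear_preimage Complex.reLm
  have hT0 (z : ℂ) (hz : z ∈ T) : z ≠ 0 := by
    rintro rfl
    have : (0 : ℝ) < A := hz.2
    linarith
  have haT : (a : ℂ) ∈ T := ⟨by simpa using hBb.trans hba, by simpa using haA⟩
  have hbT : (b : ℂ) ∈ T := ⟨by simpa using hBb, by simpa using hba.trans haA⟩
  obtain ⟨g, hg, hgF⟩ := exists_continuousOn_eq_mul_sq hTo hTc
    ((HypData.differentiableOn (F := F) U).mono hT0) haT hbT (by exact_mod_cast hba.ne') hFa hFb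
    (HypData.deriv_ne_zero (F := F) U _ (hT0 _ haT) hFa)
    (HypData.deriv_ne_zero (F := F) U _ (hT0 _ hbT) hFb) (fun z hzT => hz z hzT.1 hzT.2)
  set D : ℝ := (a - b) / 2 with hD
  set c : ℝ := (a + b) / 2 with hcdef
  have hD0 : 0 < D := by linarith
  -- The loop is an ellipse with foci a and b; η > 0 is small enough that its horizontal semi-axis D
  -- cosh η keeps it in the strip, and positive so that the foci are avoided.
  obtain ⟨η, hη, hη0⟩ : ∃ η : ℝ, D * Real.cosh η < D + min (A - a) (b - B) ∧ 0 < η := by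
    have h1 : ContinuousAt (fun η => D * Real.cosh η) 0 := by fun_prop
    have h2 : ∀ᶠ η in 𝓝 (0 : ℝ), D * Real.cosh η < D + min (A - a) (b - B) := by
      refine h1.eventually_lt continuousAt_const ?_
      simp [hBb, haA]
    exact ((h2.filter_mono nhdsWithin_le_nhds).and (self_mem_nhdsWithin (s := Set.Ioi 0))).exists
  let ζ : ℝ → ℂ := fun t => t + η * Complex.I
  have hζ : Continuous ζ := by fun_prop
  -- In this parametrization (Z - a)(Z - b) = (iD sin ζ)² with sin ζ of period 2π, so the loop lifts
  -- to a closed loop on the curve. But Z - a = -2D sin²(ζ/2), and sin(ζ/2) changes sign after one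
  -- turn.
  let Z : ℝ → ℂ := fun t => c + D * Complex.cos (ζ t)
  have hZ : Continuous Z := by fun_prop
  have hZT (t : ℝ) : Z t ∈ T := by
    have hre : (Z t).re = c + D * (Real.cos t * Real.cosh η) := by
      simp only [Z, ζ, Complex.cos_add_mul_I, Complex.add_re, Complex.ofReal_re, Complex.re_ofReal_mul,
        Complex.sub_re]
      rw [← Complex.ofReal_cos, ← Complex.ofReal_cosh, ← Complex.ofReal_sin, ← Complex.ofReal_sinh,
        ← Complex.ofReal_mul, ← Complex.ofReal_mul, Complex.ofReal_re, Complex.re_ofReal_mul,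
        Complex.I_re]
      ring
    have h1 : |D * (Real.cos t * Real.cosh η)| ≤ D * Real.cosh η := by
      rw [abs_mul, abs_mul, abs_of_pos hD0, abs_of_pos (Real.cosh_pos η)]
      exact mul_le_mul_of_nonneg_left
        (mul_le_of_le_one_left (Real.cosh_pos η).le (Real.abs_cos_le_one t)) hD0.le
    have h2 := abs_le.1 h1
    have h3 := min_le_left (A - a) (b - B)
    have h4 := min_le_right (A - a) (b - B)
    refine ⟨?_, ?_⟩ <;> rw [hre] <;> linarith [h2.1, h2.2]
  have hZa (t : ℝ) : Z t - a = -(2 * D) * Complex.sin (ζ t / 2) ^ 2 := by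
    have h1 : Complex.cos (ζ t) = 1 - 2 * Complex.sin (ζ t / 2) ^ 2 := by
      have h2 := Complex.cos_two_mul (ζ t / 2)
      have h3 := Complex.sin_sq_add_cos_sq (ζ t / 2)
      rw [mul_div_cancel₀ _ two_ne_zero] at h2
      linear_combination h2 + 2 * h3
    simp only [Z, h1]
    have : (a : ℂ) = c + D := by
      rw [← Complex.ofReal_add]
      congr 1
      rw [hcdef, hD]
      ring
    rw [this]
    ring
  have hZab (t : ℝ) : (Z t - a) * (Z t - b) = (Complex.I * D * Complex.sin (ζ t)) ^ 2 := by
    have h3 := Complex.sin_sq_add_cos_sq (ζ t)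
    have ha : (a : ℂ) = c + D := by
      rw [← Complex.ofReal_add]
      congr 1
      rw [hcdef, hD]
      ring
    have hb : (b : ℂ) = c - D := by
      rw [← Complex.ofReal_sub]
      congr 1
      rw [hcdef, hD]
      ring
    simp only [Z]
    rw [ha, hb, mul_pow, mul_pow, Complex.I_sq]
    linear_combination (D : ℂ) ^ 2 * h3
  let x : ℝ → Hyp F U := fun t => mk (Z t) (Complex.I * D * Complex.sin (ζ t) * g (Z t))
    (hT0 _ (hZT t)) (by rw [hgF _ (hZT t), hZab]; ring)
  have hx : Continuous x := by
    rw [continuous_iff]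
    have hgZ : Continuous fun t => g (Z t) := hg.comp_continuous hZ hZT
    have hsin : Continuous fun t => Complex.I * D * Complex.sin (ζ t) := by fun_prop
    exact hZ.prodMk (hsin.mul hgZ)
  -- As p lies to the right of the loop, p - Z stays in the right half plane and its principal root
  -- is single-valued.
  have hslit (t : ℝ) : 2 * D * (p - Z t) ∈ Complex.slitPlane := by
    left
    have h1 : (Z t).re < A := (hZT t).2
    have h2 : (2 * D * (p - Z t)).re = 2 * D * (p - (Z t).re) := by
      rw [show (2 * D * (p - Z t) : ℂ) = ((2 * D : ℝ) : ℂ) * (p - Z t) by push_cast; ring,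
        Complex.re_ofReal_mul, Complex.sub_re, Complex.ofReal_re]
    rw [h2]
    have : 0 < p - (Z t).re := by linarith
    positivity
  let r : ℝ → ℂ := fun t => (2 * D * (p - Z t)) ^ ((2 : ℕ) : ℂ)⁻¹
  have hr : Continuous r := by
    refine Continuous.cpow ?_ continuous_const hslit
    fun_prop
  have hr2 (t : ℝ) : r t ^ 2 = 2 * D * (p - Z t) := Complex.cpow_nat_inv_pow _ two_ne_zero
  have hr0 (t : ℝ) : r t ≠ 0 := fun h0 => by
    have h1 := hr2 t
    rw [h0, zero_pow two_ne_zero] at h1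
    exact Complex.slitPlane_ne_zero (hslit t) h1.symm
  have hs0 (t : ℝ) : Complex.sin (ζ t / 2) ≠ 0 := fun h0 => by
    obtain ⟨k, hk⟩ := Complex.sin_eq_zero_iff.1 h0
    have h1 := congrArg Complex.im (congrArg (· * 2) hk)
    rw [div_mul_cancel₀ _ two_ne_zero] at h1
    have h2 : (k * (Real.pi : ℂ) * 2).im = 0 := by
      rw [show (k * (Real.pi : ℂ) * 2) = ((k * Real.pi * 2 : ℝ) : ℂ) by push_cast; ring,
        Complex.ofReal_im]
    rw [h2] at h1
    simp [ζ] at h1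
    exact hη0.ne' h1
  -- The ratio of the supposed root to the explicit one is continuous with square 1, hence constant,
  -- yet it changes sign after one turn.
  let κ : ℝ → ℂ := fun t => h (x t) / (r t * Complex.sin (ζ t / 2))
  have hκ : Continuous κ := by
    refine (hc.comp hx).div (by fun_prop) fun t => mul_ne_zero (hr0 t) (hs0 t)
  have hκ2 (t : ℝ) : κ t ^ 2 = 1 := by
    have h1 : h (x t) ^ 2 = (r t * Complex.sin (ζ t / 2)) ^ 2 := by
      rw [hh, mul_pow, hr2]
      change (Z t - a) * (Z t - p) = _
      rw [hZa]
      ring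
    simp only [κ]
    rw [div_pow, h1, div_self (pow_ne_zero 2 (mul_ne_zero (hr0 t) (hs0 t)))]
  have hζp : ζ (2 * Real.pi) = ζ 0 + 2 * Real.pi := by
    simp only [ζ]
    push_cast
    ring
  have hcosp : Complex.cos (ζ (2 * Real.pi)) = Complex.cos (ζ 0) := by
    rw [hζp, Complex.cos_add_two_pi]
  have hsinp : Complex.sin (ζ (2 * Real.pi)) = Complex.sin (ζ 0) := by
    rw [hζp, Complex.sin_add_two_pi]
  have hZp : Z (2 * Real.pi) = Z 0 := by simp only [Z, hcosp]
  have hxp : x (2 * Real.pi) = x 0 := by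
    apply Hyp.ext
    · exact hZp
    · change Complex.I * D * Complex.sin (ζ (2 * Real.pi)) * g (Z (2 * Real.pi)) =
        Complex.I * D * Complex.sin (ζ 0) * g (Z 0)
      rw [hsinp, hZp]
  have hrp : r (2 * Real.pi) = r 0 := by simp only [r, hZp]
  have hsp : Complex.sin (ζ (2 * Real.pi) / 2) = -Complex.sin (ζ 0 / 2) := by
    rw [hζp, add_div, mul_div_cancel_left₀ _ two_ne_zero, Complex.sin_add_pi]
  have hκp : κ (2 * Real.pi) = -κ 0 := by
    simp only [κ]
    rw [hxp, hrp, hsp, mul_neg, div_neg]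
  rcases isPreconnected_univ.eq_one_or_eq_neg_one_of_sq_eq hκ.continuousOn
    (fun t _ => hκ2 t) with h1 | h1
  all_goals
    have h2 := h1 (Set.mem_univ (2 * Real.pi))
    have h3 := h1 (Set.mem_univ (0 : ℝ))
    rw [hκp, h3] at h2
    norm_num at h2

end Hyp

end

/-! ### Infinite topological type of the theta surface -/

noncomputable section

namespace ThetaSurface
open Hyp

/-- The theta surface has infinite genus. -/
theorem not_hasFiniteTopologicalType {L : ℝ} [hL : Fact (0 < L)] :
    ¬ HasFiniteTopologicalType (ThetaSurface L) := by
  intro hfin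
  have hL := hL.out
  let e : ℤ → ℝ := fun n => -Real.exp (L * (n + 1 / 2))
  have he : StrictAnti e := fun m n hmn => by
    have h1 : (m : ℝ) < n := by exact_mod_cast hmn
    simp only [e, neg_lt_neg_iff, Real.exp_lt_exp]
    gcongr
  have he0 (n : ℤ) : e n < 0 := neg_neg_of_pos (Real.exp_pos _)
  have hcast (n : ℤ) : (e n : ℂ) = -Real.exp (L * (n + 1 / 2)) := by simp [e]
  have hzero (n : ℤ) : theta L (e n) = 0 := by rw [hcast]; exact theta_node hL n
  obtain ⟨k, l, hkl, h, hc, hh⟩ := exists_sqrt_of_hasFiniteTopologicalType hfin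
    (a := fun n : ℕ => (e n : ℂ)) (fun n => Complex.ofReal_ne_zero.2 (he0 n).ne) (fun n => hzero n)
  have key (k l : ℕ) (hlk : l < k) (hh : ∀ x, h x ^ 2 = (x.z - (e k : ℝ)) * (x.z - (e l : ℝ))) :
      False := by
    -- The zeros `e n` decrease in n, so the open strip between those of indices k + 2 and k - 1
    -- contains just those of indices k and k + 1. With l < k, the zero of index l stays outside.
    refine false_of_sq_eq (A := e (k - 1)) (B := e (k + 2)) (a := e k) (b := e (k + 1)) (p := e l)
      (he (by omega)) (he (by omega)) (he (by omega)) (he0 _).le (he.antitone (by omega))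
      (hzero _) (hzero _) ?_ hc hh
    intro z hz1 hz2 hz
    have hz0 : z ≠ 0 := by
      rintro rfl
      exact lt_asymm (he0 (k - 1)) hz2
    obtain ⟨n, hn, -⟩ := theta_factorization hL hz0 hz
    rw [← hcast] at hn
    rw [hn, Complex.ofReal_re] at hz1 hz2
    have h1 := he.lt_iff_gt.1 hz1
    have h2 := he.lt_iff_gt.1 hz2
    obtain rfl | rfl : n = k ∨ n = k + 1 := by omega
    · exact Or.inl hn
    · exact Or.inr hn
  rcases lt_or_gt_of_ne hkl with hlt | hlt
  · exact key l k hlt fun x => by rw [hh, mul_comm]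
  · exact key k l hlt hh

end ThetaSurface

end

/-! ### The main theorem -/

theorem theorem2 (ε : ℝ) (hε : 0 < ε) :
    ∃ (M : Type) (_ : MetricSpace M) (_ : ChartedSpace Plane M)
      (_ : IsManifold (𝓡 2) ∞ M)
      (_ : RiemannianBundle (fun x : M => TangentSpace (𝓡 2) x))
      (_ : IsContMDiffRiemannianBundle (𝓡 2) ∞ Plane (fun x : M => TangentSpace (𝓡 2) x))
      (_ : IsRiemannianManifold (𝓡 2) M)
      (_ : MeasurableSpace M) (_ : BorelSpace M)
      (vol : Measure M) (p : M) (c c₁ c₂ : ℝ),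
      ConnectedSpace M ∧ SecondCountableTopology M ∧ CompleteSpace M ∧
      ¬ HasFiniteTopologicalType M ∧
      IsRiemannianVolume M vol ∧
      0 < c ∧ 0 < c₁ ∧ 0 < c₂ ∧
      ENNReal.ofReal c ≤
        liminf (fun r : ℝ => ⨅ m ∈ distSphere p r,
          vol (Metric.ball m (r / 2)) / ENNReal.ofReal (r ^ 2)) atTop ∧
      ENNReal.ofReal c₁ ≤
        liminf (fun r : ℝ => vol (Metric.ball p r) / ENNReal.ofReal (r ^ 2)) atTop ∧
      limsup (fun r : ℝ => vol (Metric.ball p r) / ENNReal.ofReal (r ^ 2)) atTop ≤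
        ENNReal.ofReal c₂ ∧
      limsup (fun r : ℝ => ⨆ m ∈ distSphere p r,
          ENNReal.ofReal (r ^ 2 * |gaussCurvature M m|)) atTop ≤
        ENNReal.ofReal ε := by
  have h196 : 0 < 196 / ε := by positivity
  -- The part 196/ε makes the curvature small; L ≥ 1 serves the geometric sums in the volume and
  -- distance estimates.
  set L : ℝ := max 1 (196 / ε)
  have h1 : 1 ≤ L := le_max_left _ _
  have : Fact (0 < L) := ⟨by linarith⟩
  have hLε : 196 / L ≤ ε := by
    rw [div_le_iff₀ (by linarith), mul_comm, ← div_le_iff₀ hε]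
    exact le_max_right _ _
  obtain ⟨p⟩ : Nonempty (ThetaSurface L) := inferInstance
  obtain ⟨c, hc, h2⟩ := ThetaSurface.eventually_le_area_ball h1 p
  obtain ⟨c₁, hc₁, h3⟩ := ThetaSurface.eventually_le_area_ball_center h1 p
  obtain ⟨c₂, hc₂, h4⟩ := ThetaSurface.eventually_area_ball_le h1 p
  refine ⟨ThetaSurface L, inferInstance, inferInstance, inferInstance, inferInstance, inferInstance,
    inferInstance, inferInstance, inferInstance, Hyp.area (theta L) (weight L), p, c, c₁, c₂,
    inferInstance, inferInstance, inferInstance, ThetaSurface.not_hasFiniteTopologicalType,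
    Hyp.isRiemannianVolume_area, hc, hc₁, hc₂, ?_, ?_, ?_, ?_⟩
  · refine le_liminf_of_le isCobounded_ge_of_top ?_
    filter_upwards [h2] with r hr
    exact le_iInf₂ fun m hm => hr m (ThetaSurface.dist_eq_of_mem_distSphere hm)
  · exact le_liminf_of_le isCobounded_ge_of_top h3
  · exact limsup_le_of_le isCobounded_le_of_bot h4
  · refine limsup_le_of_le isCobounded_le_of_bot ?_
    filter_upwards [ThetaSurface.eventually_curvature_le p hε hLε] with r hr
    exact iSup₂_le fun m hm => ENNReal.ofReal_le_ofReal (hr m hm)
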